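/- Let $s\ge 1/2$, $a>3/4$ and, for $n\ge1$, $$b_n=\frac{(s+n-2+2a)\,\Gamma(a+\frac n2-\frac12)\,\Gamma(s+a+\frac n2-1)}{2\,\Gamma(a+\frac n2)\,\Gamma(s+a+\frac n2-\frac12)},$$ let $b_0>0$ be a parameter, and put $\mathrm w=(s-s^2)/2$. The model gives a path $0=X_0,X_1,\dots,X_N$ in $\mathbb Z_+$ with $|X_{n+1}-X_n|=1$ a probability proportional to $\prod_{n=0}^N b_{X_n}^{-1}$. The density of returns to the origin is $m=m(b_0)$, the common limit, as $N\to\infty$, of $\frac1{2N-1}\mathbf E\big[\#\{1\le l\le 2N-1: X_l=0\}\,\big|\,X_{2N}=0\big]$ (paths of length $2N$) and of $\frac1N\mathbf E\big[\#\{1\le l\le N:X_l=0\}\big]$ (paths of length $N$). Let $R=(R_{p,q})_{p,q\ge1}$ have entries $R_{p,q}=\frac1{2\sqrt{b_pb_q}}$ if $|p-q|=1$ and $0$ otherwise; let $\rho_*(R)=\lim_n\big((R^{2n})_{i,j}\big)^{1/2n}$ (for all $i-j$ even), let $\mathfrak w_1(\rho)\in[0,\infty]$ be the infimum of $w_1$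 over all sequences $w=(w_p)_{p\ge1}>0$ with $Rw=\rho w-\mathbf 1_{p=1}$, and let $b_0^c=\lim_{\rho\searrow\rho_*(R)}\mathfrak w_1(\rho)/(4b_1\rho)$. Write $F={}_2F_1$. Then the limits defining $\rho_*(R)$ and $b_0^c$ exist and $0<b_0^c<\infty$; for $0<b_0<b_0^c$ the equation $\mathfrak w_1(\rho)=4\rho b_0b_1$ has a unique solution $\rho=\rho(b_0)>1$, the two limits defining $m(b_0)$ exist and coincide, and the following hold. (i) For every $0<b_0<b_0^c$, with $\rho=\rho(b_0)$, $$m(b_0)=\frac{1}{2+\frac{2}{\rho^2}\frac{F(a+1,a+3/2;2a+s+1;\rho^{-2})}{F(a,a+1/2;2a+s;\rho^{-2})}\frac{a(a+1/2)}{2a+s}-\frac{2}{\rho^2}\frac{F(a+1/2,a+1;2a+s;\rho^{-2})}{F(a-1/2,a;2a+s-1;\rho^{-2})}\frac{a(a-1/2)}{2a+s-1}},$$ where the denominator is positive. (ii) If $1/2<s<3/2$ (equivalently $-3/8<\mathrm w<1/8$), then $\lim_{b_0\nearrow b_0^c}m(b_0)=0$, and $$\lim_{b_0\nearrow b_0^c}\frac{m(b_0)}{(b_0^c-b_0)^{(3/2-s)/(s-1/2)}}$$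 exists, is finite and nonzero. Moreover $\frac{3/2-s}{s-1/2}=\frac{2-\sqrt{1-8\mathrm w}}{\sqrt{1-8\mathrm w}}$. (iii) If $s>3/2$ (equivalently $\mathrm w<-3/8$), then $$\lim_{b_0\nearrow b_0^c}m(b_0)=\frac{1}{2+\frac{2a}{s-3/2}}>0.$$ -/

import Mathlib

open Filter Topology
open scoped ENNReal

noncomputable section

/-! Nearest-neighbour Solid-on-Solid model on the half line, with one-body potential
`V n = log (b n)`. -/

namespace SOS

/-- The paths `X` of `N` steps in `ℕ` with `X 0 = 0` and steps `±1` (such paths satisfy `X n ≤ N`,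
so they form a finite set). -/
def paths (N : ℕ) : Finset (Fin (N + 1) → ℕ) :=
  (Fintype.piFinset fun _ : Fin (N + 1) => Finset.range (N + 1)).filter fun X =>
    X 0 = 0 ∧ ∀ i : Fin N, X i.castSucc + 1 = X i.succ ∨ X i.succ + 1 = X i.castSucc

/-- The Boltzmann weight `∏_{n < N} e^{-W(X n, X (n+1))} ∏_{n ≤ N} e^{-V(X n)}` of a path, with
`e^{-W} = 1/2` for each step and `e^{-V(n)} = 1 / b n`. -/
def weight (b : ℕ → ℝ) {N : ℕ} (X : Fin (N + 1) → ℕ) : ℝ :=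
  (1 / 2) ^ N * ∏ n : Fin (N + 1), (b (X n))⁻¹

/-- The number of `l ∈ {1, …, N}` with `X l = 0`. -/
def returns {N : ℕ} (X : Fin (N + 1) → ℕ) : ℕ :=
  (Finset.univ.filter fun l : Fin (N + 1) => l ≠ 0 ∧ X l = 0).card

/-- The number of `l ∈ {1, …, N - 1}` with `X l = 0`. -/
def interiorReturns {N : ℕ} (X : Fin (N + 1) → ℕ) : ℕ :=
  (Finset.univ.filter fun l : Fin (N + 1) => l ≠ 0 ∧ l ≠ Fin.last N ∧ X l = 0).card

/-- The expected number of returns to the origin among the times `1, …, N`, per unit time, for the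
model with free endpoint. -/
def freeDensity (b : ℕ → ℝ) (N : ℕ) : ℝ :=
  1 / (N : ℝ) *
    ((∑ X ∈ paths N, weight b X * (returns X : ℝ)) / ∑ X ∈ paths N, weight b X)

/-- The paths of `N` steps that are back at the origin at time `N`. -/
def bridges (N : ℕ) : Finset (Fin (N + 1) → ℕ) :=
  (paths N).filter fun X => X (Fin.last N) = 0

/-- The expected number of returns to the origin among the times `1, …, 2 N - 1`, per unit time,
for the model conditioned on `X (2 N) = 0`. -/
def bridgeDensity (b : ℕ → ℝ) (N : ℕ) : ℝ :=
  1 / (2 * (N : ℝ) - 1) *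
    ((∑ X ∈ bridges (2 * N), weight b X * (interiorReturns X : ℝ)) /
      ∑ X ∈ bridges (2 * N), weight b X)

/-- `m` is the (asymptotic) density of returns to the origin: both for the bridge and for the free
boundary condition, the expected density of returns converges to `m`. -/
def IsReturnDensity (b : ℕ → ℝ) (m : ℝ) : Prop :=
  Tendsto (bridgeDensity b) atTop (𝓝 m) ∧ Tendsto (freeDensity b) atTop (𝓝 m)

/-- The transfer matrix `Q`. -/
def matQ (b : ℕ → ℝ) : Matrix ℕ ℕ ℝ := Matrix.of fun p q =>
  if p + 1 = q ∨ q + 1 = p then 1 / (2 * √(b p * b q)) else 0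

/-- The matrix `R`: `Q` without its first row and first column. The index `p` of `R` stands for
the index `p + 1` of `Q`. The value `b 0` does not enter. -/
def matR (b : ℕ → ℝ) : Matrix ℕ ℕ ℝ := (matQ b).submatrix Nat.succ Nat.succ

/-- The action `w ↦ R w` on infinite sequences: `(R w) p = ∑_q R p q * w q`, where
`R p q = 0` for `q > p + 1`. The entry `w p` stands for the coordinate with index `p + 1`. -/
def applyR (b : ℕ → ℝ) (w : ℕ → ℝ) (p : ℕ) : ℝ :=
  ∑ q ∈ Finset.range (p + 2), matR b p q * w q

/-- The entry `(i, j)` of the matrix power `R ^ n`. -/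
def powR (b : ℕ → ℝ) (n i j : ℕ) : ℝ := (applyR b)^[n] (Pi.single j 1) i

/-- `r` is the convergence norm `ρ_*(R) = lim_n ((R ^ (2 n))_{i,j}) ^ (1 / (2 n))`, for all `i, j`
with `i - j` even. -/
def IsConvergenceNorm (b : ℕ → ℝ) (r : ℝ) : Prop :=
  ∀ i j : ℕ, Even (i + j) →
    Tendsto (fun n : ℕ => powR b (2 * n) i j ^ (1 / (2 * (n : ℝ)))) atTop (𝓝 r)

/-- The positive solutions `w` of `R w = ρ w - 1_{p = 1}` (first coordinate: index `0` here). -/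
def positiveSolutions (b : ℕ → ℝ) (ρ : ℝ) : Set (ℕ → ℝ) :=
  {w | (∀ p, 0 < w p) ∧ ∀ p, applyR b w p = ρ * w p - if p = 0 then 1 else 0}

/-- The infimum `𝔴₁(ρ)` of the first coordinates of the positive solutions; it is `∞` if there is
no positive solution. -/
def minW (b : ℕ → ℝ) (ρ : ℝ) : ℝ≥0∞ :=
  ⨅ w ∈ positiveSolutions b ρ, ENNReal.ofReal (w 0)

/-- `c` is the critical value `b₀ᶜ = lim_{ρ ↘ ρ_*(R)} 𝔴₁(ρ) / (4 b₁ ρ)`, finite and positive. -/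
def IsCriticalValue (b : ℕ → ℝ) (c : ℝ) : Prop :=
  0 < c ∧ ∃ r : ℝ, IsConvergenceNorm b r ∧
    Tendsto (fun ρ : ℝ => minW b ρ / ENNReal.ofReal (4 * b 1 * ρ)) (𝓝[>] r)
      (𝓝 (ENNReal.ofReal c))

/-- `r` is the unique solution `ρ > 1` of the equation `𝔴₁(ρ) = 4 ρ b₀ b₁`. -/
def IsGibbsRoot (b : ℕ → ℝ) (r : ℝ) : Prop :=
  (1 < r ∧ minW b r = ENNReal.ofReal (4 * r * b 0 * b 1)) ∧
    ∀ r' : ℝ, 1 < r' → minW b r' = ENNReal.ofReal (4 * r' * b 0 * b 1) → r' = r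

/-- The sequence of the hypergeometric model, with the free parameter `b₀` at the origin. -/
def hyperB (a s b₀ : ℝ) (n : ℕ) : ℝ :=
  if n = 0 then b₀ else
    (s + n - 2 + 2 * a) * Real.Gamma (a + n / 2 - 1 / 2) * Real.Gamma (s + a + n / 2 - 1) /
      (2 * Real.Gamma (a + n / 2) * Real.Gamma (s + a + n / 2 - 1 / 2))

/-- The denominator of the explicit formula for the density of returns, as a function of `ρ`. -/
def densityDenom (a s ρ : ℝ) : ℝ :=
  2 + 2 / ρ ^ 2 *
      (₂F₁ (a + 1) (a + 3 / 2) (2 * a + s + 1) ((ρ ^ 2)⁻¹) /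
        ₂F₁ a (a + 1 / 2) (2 * a + s) ((ρ ^ 2)⁻¹)) * (a * (a + 1 / 2) / (2 * a + s))
    - 2 / ρ ^ 2 *
      (₂F₁ (a + 1 / 2) (a + 1) (2 * a + s) ((ρ ^ 2)⁻¹) /
        ₂F₁ (a - 1 / 2) a (2 * a + s - 1) ((ρ ^ 2)⁻¹)) * (a * (a - 1 / 2) / (2 * a + s - 1))

end SOS

end

noncomputable section

namespace SOS

/-! ### Sums over paths -/

/-! The model is a renewal process: returns to the origin cut a path into independent excursions.
Sums over paths are iterates of the transfer operator `stepOp` evaluated at `0`, and conjugation by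
`√b` turns the part killed at the origin into the Jacobi matrix `R`. The weight `u n` of returning
at time `2 n` therefore satisfies a renewal equation (`retVal_succ`) whose step law is `f n = (R ^
(2 n))₁₁ / (4 b₀ b₁)`. Multiplying `u n` by `z ^ n` with `z = ρ⁻²` makes the step law a probability
exactly when `𝔴₁(ρ) = 4 ρ b₀ b₁`.

The limit of the tilted `u` needs no general renewal theorem. The operator `stepOp` is symmetric in
`ℓ²(1 / b)`, so `u` is a sequence of even moments, hence logarithmically convex
(`retVal_logConvex`). Being bounded by `1`, it decreases to a limit, which an Abelian argument
identifies as `1 / μ`, with `μ` the mean of the step law (`renewal_limit`). Since excursions have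
even length, the density is `1 / (2 μ)`. For the free endpoint the only extra ingredient is
summability of the weights of the final stretch away from the origin (`summable_killVal`).

The hypergeometric model is solvable because a contiguous relation for `U_p = F(a - 1/2 + p/2, a +
p/2; 2a + s - 1 + p; z)` is the recursion `R w = ρ w` in disguise (`hypU_rec`, `minSol_mem`). The
resulting solution is the Neumann series, hence minimal, and `𝔴₁(ρ) / ρ = Φ(z) = z U₁(z) / U₀(z)`
(`gibbsFun`). Thus `μ = z Φ'(z) / Φ(z)`, half of the denominator in (i), and the critical point is
`z = 1`.

Near `z = 1` everything depends on `γ - α - β = s - 1/2`, the same for all `U_p`. If `1/2 < s <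
3/2`, the functions `U_p` stay finite while their derivatives blow up like `(1 - z) ^ -(3/2 - s)`.
Then `m` is of order `(1 - z) ^ (3/2 - s)`, whereas `b₀ᶜ - b₀` is of order `(1 - z) ^ (s - 1/2)`;
eliminating `1 - z` gives the exponent. If `s > 3/2`, the derivatives converge too, and `U_p'(1) /
U_p(1)` is explicit (`tsum_hypCoeff_derivative`). -/

lemma mem_paths_iff {N : ℕ} {X : Fin (N + 1) → ℕ} :
    X ∈ paths N ↔
      X 0 = 0 ∧ ∀ i : Fin N, X i.castSucc + 1 = X i.succ ∨ X i.succ + 1 = X i.castSucc := by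
  refine ⟨fun h => (Finset.mem_filter.1 h).2, fun h => Finset.mem_filter.2 ⟨?_, h⟩⟩
  have hle : ∀ i : Fin (N + 1), X i ≤ i := by
    intro i
    induction i using Fin.induction with
    | zero => simp [h.1]
    | succ i ih =>
      have h2 := h.2 i
      simp only [Fin.val_castSucc] at ih
      simp only [Fin.val_succ]
      lia
  rw [Fintype.mem_piFinset]
  intro i
  have := hle i
  have := i.2
  simp only [Finset.mem_range]
  lia

/-- The sites at distance one from `y` on the half line. -/
def nbrs (y : ℕ) : Finset ℕ := (Finset.range (y + 2)).filter fun x => y + 1 = x ∨ x + 1 = y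

lemma mem_nbrs {x y : ℕ} : x ∈ nbrs y ↔ y + 1 = x ∨ x + 1 = y := by
  simp only [nbrs, Finset.mem_filter, Finset.mem_range]
  lia

lemma sum_nbrs_zero (h : ℕ → ℝ) : ∑ x ∈ nbrs 0, h x = h 1 := by
  have : nbrs 0 = {1} := by
    ext x
    rw [mem_nbrs, Finset.mem_singleton]
    lia
  rw [this, Finset.sum_singleton]

lemma sum_nbrs_succ (h : ℕ → ℝ) (y : ℕ) : ∑ x ∈ nbrs (y + 1), h x = h y + h (y + 2) := by
  have : nbrs (y + 1) = {y, y + 2} := by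
    ext x
    rw [mem_nbrs, Finset.mem_insert, Finset.mem_singleton]
    lia
  rw [this, Finset.sum_pair (by lia)]

/-- The path `Y` followed by the site `x`. -/
def extend {N : ℕ} (Y : Fin (N + 1) → ℕ) (x : ℕ) : Fin (N + 1 + 1) → ℕ :=
  Fin.snoc (α := fun _ => ℕ) Y x

lemma extend_castSucc {N : ℕ} (Y : Fin (N + 1) → ℕ) (x : ℕ) (i : Fin (N + 1)) :
    extend Y x i.castSucc = Y i :=
  Fin.snoc_castSucc (α := fun _ => ℕ) x Y i

lemma extend_last {N : ℕ} (Y : Fin (N + 1) → ℕ) (x : ℕ) :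
    extend Y x (Fin.last (N + 1)) = x :=
  Fin.snoc_last (α := fun _ => ℕ) x Y

lemma extend_mem_paths {N : ℕ} {Y : Fin (N + 1) → ℕ} {x : ℕ} :
    extend Y x ∈ paths (N + 1) ↔ Y ∈ paths N ∧ x ∈ nbrs (Y (Fin.last N)) := by
  rw [mem_paths_iff, mem_paths_iff, mem_nbrs, Fin.forall_fin_succ', ← Fin.castSucc_zero,
    extend_castSucc, Fin.succ_last, extend_last, extend_castSucc, ← and_assoc]
  simp only [Fin.succ_castSucc, extend_castSucc]

lemma sum_paths_succ {N : ℕ} (g : (Fin (N + 1 + 1) → ℕ) → ℝ) :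
    ∑ X ∈ paths (N + 1), g X =
      ∑ Y ∈ paths N, ∑ x ∈ nbrs (Y (Fin.last N)), g (extend Y x) := by
  rw [Finset.sum_sigma']
  have key : ∀ X : Fin (N + 1 + 1) → ℕ, extend (fun i => X i.castSucc) (X (Fin.last _)) = X :=
    fun X => Fin.snoc_init_self (α := fun _ => ℕ) X
  refine Finset.sum_bij' (fun X _ => ⟨fun i => X i.castSucc, X (Fin.last _)⟩)
    (fun p _ => extend p.1 p.2) ?_ ?_ ?_ ?_ ?_
  · intro X hX
    rw [← key X, extend_mem_paths] at hX
    simpa using hX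
  · rintro ⟨Y, x⟩ h
    rw [Finset.mem_sigma] at h
    exact extend_mem_paths.2 h
  · intro X _
    exact key X
  · rintro ⟨Y, x⟩ _
    simp [extend_castSucc, extend_last]
  · intro X _
    rw [key X]

lemma weight_extend (b : ℕ → ℝ) {N : ℕ} (Y : Fin (N + 1) → ℕ) (x : ℕ) :
    weight b (extend Y x) = weight b Y * (1 / (2 * b x)) := by
  unfold weight
  rw [Fin.prod_univ_castSucc, extend_last, pow_succ]
  simp only [extend_castSucc]
  rw [one_div (2 * b x), mul_inv]
  ring

lemma returns_extend {N : ℕ} (Y : Fin (N + 1) → ℕ) (x : ℕ) :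
    returns (extend Y x) = returns Y + if x = 0 then 1 else 0 := by
  unfold returns
  rw [Finset.card_filter, Finset.card_filter, Fin.sum_univ_castSucc, extend_last]
  simp only [extend_castSucc]
  congr 1
  · refine Finset.sum_congr rfl fun i _ => ?_
    simp only [ne_eq, Fin.castSucc_eq_zero_iff]
  · simp [Fin.last_eq_zero_iff]

lemma returns_eq_interiorReturns_add {N : ℕ} {X : Fin (N + 1) → ℕ} (hN : N ≠ 0)
    (hX : X (Fin.last N) = 0) : returns X = interiorReturns X + 1 := by
  unfold returns interiorReturns
  have : (Finset.univ.filter fun l : Fin (N + 1) => l ≠ 0 ∧ l ≠ Fin.last N ∧ X l = 0) =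
      (Finset.univ.filter fun l : Fin (N + 1) => l ≠ 0 ∧ X l = 0).erase (Fin.last N) := by
    ext l
    simp only [Finset.mem_filter, Finset.mem_univ, true_and, Finset.mem_erase]
    tauto
  rw [this, Finset.card_erase_add_one]
  simp [hX, Fin.last_eq_zero_iff, hN]

/-! ### The transfer operator -/

/-- One step of the path: `(M f) y = ∑_{x ∼ y} f x / (2 b x)`. -/
def stepOp (b : ℕ → ℝ) (f : ℕ → ℝ) (y : ℕ) : ℝ := ∑ x ∈ nbrs y, 1 / (2 * b x) * f x

lemma stepOp_zero (b f : ℕ → ℝ) : stepOp b f 0 = 1 / (2 * b 1) * f 1 :=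
  sum_nbrs_zero _

lemma stepOp_succ (b f : ℕ → ℝ) (y : ℕ) :
    stepOp b f (y + 1) = 1 / (2 * b y) * f y + 1 / (2 * b (y + 2)) * f (y + 2) :=
  sum_nbrs_succ _ _

lemma stepOp_add (b f g : ℕ → ℝ) : stepOp b (f + g) = stepOp b f + stepOp b g := by
  ext y
  simp [stepOp, mul_add, Finset.sum_add_distrib]

lemma stepOp_smul (b f : ℕ → ℝ) (c : ℝ) : stepOp b (c • f) = c • stepOp b f := by
  ext y
  simp only [stepOp, Pi.smul_apply, smul_eq_mul, Finset.mul_sum]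
  exact Finset.sum_congr rfl fun _ _ => by ring

/-- The value at `0` of `M ^ n f`. -/
def stepVal (b f : ℕ → ℝ) (n : ℕ) : ℝ := (stepOp b)^[n] f 0

lemma stepVal_zero (b f : ℕ → ℝ) : stepVal b f 0 = f 0 := rfl

lemma stepVal_succ (b f : ℕ → ℝ) (n : ℕ) : stepVal b f (n + 1) = stepVal b (stepOp b f) n := rfl

lemma stepVal_add (b f g : ℕ → ℝ) (n : ℕ) :
    stepVal b (f + g) n = stepVal b f n + stepVal b g n := by
  induction n generalizing f g with
  | zero => rfl
  | succ n ih => rw [stepVal_succ, stepOp_add, ih, ← stepVal_succ, ← stepVal_succ]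

lemma stepVal_smul (b f : ℕ → ℝ) (c : ℝ) (n : ℕ) :
    stepVal b (c • f) n = c * stepVal b f n := by
  induction n generalizing f with
  | zero => rfl
  | succ n ih => rw [stepVal_succ, stepOp_smul, ih, ← stepVal_succ]

/-- The unit mass at the origin. -/
def delta : ℕ → ℝ := Pi.single 0 1

lemma delta_zero : delta 0 = 1 := by simp [delta]

lemma delta_of_ne {x : ℕ} (h : x ≠ 0) : delta x = 0 := by simp [delta, h]

lemma sum_paths_zero (g : (Fin (0 + 1) → ℕ) → ℝ) : ∑ X ∈ paths 0, g X = g fun _ => 0 := by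
  have : paths 0 = {fun _ => 0} := by
    ext X
    rw [mem_paths_iff, Finset.mem_singleton]
    constructor
    · rintro ⟨h, -⟩
      ext i
      have hi : i = 0 := Fin.ext (by have := i.2; simp only [Fin.val_zero]; lia)
      rw [hi, h]
    · rintro rfl
      simp
  rw [this, Finset.sum_singleton]

/-- Summing out the last site replaces `f` by `stepOp b f`. Each later site carries its step factor
`1/2`; the site at time `0` has none, whence the remaining `1 / b 0`. -/
lemma sum_weight_mul (b f : ℕ → ℝ) (N : ℕ) :
    ∑ X ∈ paths N, weight b X * f (X (Fin.last N)) = stepVal b f N / b 0 := by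
  induction N generalizing f with
  | zero =>
    rw [sum_paths_zero]
    simp [weight, stepVal_zero]
    ring
  | succ N ih =>
    rw [sum_paths_succ, stepVal_succ, ← ih]
    refine Finset.sum_congr rfl fun Y _ => ?_
    simp only [extend_last, weight_extend, stepOp, Finset.mul_sum]
    exact Finset.sum_congr rfl fun _ _ => by ring

/-- A return at time `i + 1` splits the path into two independent pieces. In the induction, a return
at the final time contributes the observable `f 0 • delta`, and earlier ones are handled by `stepOp
b f`. -/
lemma sum_weight_mul_returns (b f : ℕ → ℝ) (N : ℕ) :
    ∑ X ∈ paths N, weight b X * (returns X : ℝ) * f (X (Fin.last N)) =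
      (∑ i ∈ Finset.range N, stepVal b delta (i + 1) * stepVal b f (N - 1 - i)) / b 0 := by
  induction N generalizing f with
  | zero =>
    rw [sum_paths_zero]
    have : returns (N := 0) (fun _ => 0) = 0 := by
      simp [returns]
    simp [this]
  | succ N ih =>
    have h1 : ∑ X ∈ paths (N + 1), weight b X * (returns X : ℝ) * f (X (Fin.last (N + 1))) =
        (∑ Y ∈ paths N, weight b Y * (returns Y : ℝ) * stepOp b f (Y (Fin.last N))) +
        ∑ X ∈ paths (N + 1), weight b X * (f 0 • delta) (X (Fin.last (N + 1))) := by
      rw [sum_paths_succ, sum_paths_succ, ← Finset.sum_add_distrib]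
      refine Finset.sum_congr rfl fun Y _ => ?_
      simp only [stepOp, Finset.mul_sum]
      rw [← Finset.sum_add_distrib]
      refine Finset.sum_congr rfl fun x _ => ?_
      rw [weight_extend, returns_extend, extend_last]
      by_cases hx : x = 0
      · subst hx
        simp [delta_zero]
        ring
      · simp [hx, delta_of_ne hx]
        ring
    rw [h1, ih, sum_weight_mul, stepVal_smul, Finset.sum_range_succ, add_div]
    congr 1
    · congr 1
      refine Finset.sum_congr rfl fun i hi => ?_
      rw [← stepVal_succ]
      have := Finset.mem_range.1 hi
      congr 2
      lia
    · simp [stepVal_zero]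
      ring

lemma freeDensity_eq {b : ℕ → ℝ} (hb : b 0 ≠ 0) (N : ℕ) :
    freeDensity b N = 1 / (N : ℝ) *
      ((∑ i ∈ Finset.range N, stepVal b delta (i + 1) * stepVal b 1 (N - 1 - i)) /
        stepVal b 1 N) := by
  have h1 := sum_weight_mul b 1 N
  have h2 := sum_weight_mul_returns b 1 N
  simp only [Pi.one_apply, mul_one] at h1 h2
  rw [freeDensity, h1, h2, div_div_div_cancel_right₀ hb]

lemma sum_bridges (N : ℕ) (g : (Fin (N + 1) → ℕ) → ℝ) :
    ∑ X ∈ bridges N, g X = ∑ X ∈ paths N, g X * delta (X (Fin.last N)) := by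
  rw [bridges, Finset.sum_filter]
  refine Finset.sum_congr rfl fun X _ => ?_
  by_cases h : X (Fin.last N) = 0
  · simp [h, delta_zero]
  · simp [h, delta_of_ne h]

lemma bridgeDensity_eq {b : ℕ → ℝ} (hb : b 0 ≠ 0) {N : ℕ} (hN : N ≠ 0) :
    bridgeDensity b N = 1 / (2 * (N : ℝ) - 1) *
      ((∑ i ∈ Finset.range (2 * N), stepVal b delta (i + 1) * stepVal b delta (2 * N - 1 - i)
        - stepVal b delta (2 * N)) / stepVal b delta (2 * N)) := by
  have h3 : ∑ X ∈ bridges (2 * N), weight b X * (interiorReturns X : ℝ) =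
      ∑ X ∈ bridges (2 * N), weight b X * (returns X : ℝ) - ∑ X ∈ bridges (2 * N), weight b X := by
    rw [← Finset.sum_sub_distrib]
    refine Finset.sum_congr rfl fun X hX => ?_
    rw [returns_eq_interiorReturns_add (by lia) (Finset.mem_filter.1 hX).2]
    push_cast
    ring
  rw [bridgeDensity, h3, sum_bridges, sum_bridges, sum_weight_mul, sum_weight_mul_returns,
    ← sub_div, div_div_div_cancel_right₀ hb]

/-! ### Decomposition at the last visit to the origin -/

/-- The function `f` with its value at the origin replaced by `0`. -/
def offOrigin (f : ℕ → ℝ) (x : ℕ) : ℝ := if x = 0 then 0 else f x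

/-- One step of a path killed at the origin. -/
def killOp (b f : ℕ → ℝ) : ℕ → ℝ := stepOp b (offOrigin f)

/-- The value at `0` of the `n`-th iterate of the killed transfer operator. -/
def killVal (b f : ℕ → ℝ) (n : ℕ) : ℝ := (killOp b)^[n] f 0

lemma killVal_zero (b f : ℕ → ℝ) : killVal b f 0 = f 0 := rfl

lemma killVal_succ (b f : ℕ → ℝ) (n : ℕ) : killVal b f (n + 1) = killVal b (killOp b f) n := rfl

lemma killVal_succ' (b f : ℕ → ℝ) (n : ℕ) :
    killVal b f (n + 1) = 1 / (2 * b 1) * (killOp b)^[n] f 1 := by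
  rw [killVal, Function.iterate_succ_apply', killOp, stepOp_zero]
  rfl

lemma stepOp_eq (b f : ℕ → ℝ) : stepOp b f = f 0 • stepOp b delta + killOp b f := by
  rw [killOp, ← stepOp_smul, ← stepOp_add]
  congr 1
  ext x
  by_cases hx : x = 0
  · simp [hx, delta_zero, offOrigin]
  · simp [hx, delta_of_ne hx, offOrigin]

/-- Here `l` is the time of the last visit: for a positive number of steps `killVal` forbids the
origin at every later time, the final one included, while for zero steps it keeps `f 0`. -/
lemma stepVal_eq_sum (b f : ℕ → ℝ) (n : ℕ) :
    stepVal b f n = ∑ l ∈ Finset.range (n + 1), stepVal b delta l * killVal b f (n - l) := by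
  induction n generalizing f with
  | zero => simp [stepVal_zero, killVal_zero, delta_zero]
  | succ n ih =>
    rw [stepVal_succ, stepOp_eq, stepVal_add, stepVal_smul, ← stepVal_succ, ih (killOp b f),
      Finset.sum_range_succ _ (n + 1), Nat.sub_self, killVal_zero, add_comm, mul_comm (f 0)]
    congr 1
    refine Finset.sum_congr rfl fun l hl => ?_
    have := Finset.mem_range.1 hl
    rw [← killVal_succ]
    congr 2
    lia

lemma stepOp_iterate_eq_zero (b : ℕ → ℝ) {f : ℕ → ℝ} {e : ℕ}
    (hf : ∀ x, (x + e) % 2 = 1 → f x = 0) (n : ℕ) :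
    ∀ x, (x + e + n) % 2 = 1 → (stepOp b)^[n] f x = 0 := by
  induction n with
  | zero => exact fun x hx => hf x hx
  | succ n ih =>
    intro x hx
    rw [Function.iterate_succ_apply']
    refine Finset.sum_eq_zero fun y hy => ?_
    rw [ih y (by rw [mem_nbrs] at hy; lia), mul_zero]

lemma stepVal_delta_odd (b : ℕ → ℝ) (n : ℕ) : stepVal b delta (2 * n + 1) = 0 :=
  stepOp_iterate_eq_zero b (e := 0) (fun x hx => delta_of_ne (by lia)) _ 0 (by lia)

lemma sum_range_two_mul (f : ℕ → ℝ) (n : ℕ) :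
    ∑ l ∈ Finset.range (2 * n), f l = ∑ i ∈ Finset.range n, (f (2 * i) + f (2 * i + 1)) := by
  induction n with
  | zero => simp
  | succ n ih =>
    rw [show 2 * (n + 1) = 2 * n + 1 + 1 by ring, Finset.sum_range_succ, Finset.sum_range_succ, ih,
      Finset.sum_range_succ]
    ring

/-- The weight of the returns at time `2 n`. -/
def retVal (b : ℕ → ℝ) (n : ℕ) : ℝ := stepVal b delta (2 * n)

lemma retVal_zero (b : ℕ → ℝ) : retVal b 0 = 1 := delta_zero

/-- Returns occur at even times only, so half of the terms vanish; `e` is the parity of the length.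
-/
lemma sum_stepVal_delta_mul (b : ℕ → ℝ) (g : ℕ → ℝ) (n e : ℕ) (he : e < 2) :
    ∑ l ∈ Finset.range (2 * n + e + 1), stepVal b delta l * g (2 * n + e - l) =
      ∑ i ∈ Finset.range (n + 1), retVal b i * g (2 * (n - i) + e) := by
  have h1 : ∑ l ∈ Finset.range (2 * (n + 1)), stepVal b delta l * g (2 * n + e - l) =
      ∑ i ∈ Finset.range (n + 1), retVal b i * g (2 * (n - i) + e) := by
    rw [sum_range_two_mul]
    refine Finset.sum_congr rfl fun i hi => ?_
    have := Finset.mem_range.1 hi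
    rw [stepVal_delta_odd, zero_mul, add_zero, retVal]
    congr 2
    lia
  rw [← h1]
  obtain rfl | rfl : e = 0 ∨ e = 1 := by lia
  · rw [show 2 * (n + 1) = 2 * n + 0 + 1 + 1 by ring, Finset.sum_range_succ _ (2 * n + 0 + 1),
      add_zero, stepVal_delta_odd, zero_mul, add_zero]
  · rfl

lemma stepVal_eq_sum_retVal (b f : ℕ → ℝ) (n e : ℕ) (he : e < 2) :
    stepVal b f (2 * n + e) =
      ∑ i ∈ Finset.range (n + 1), retVal b i * killVal b f (2 * (n - i) + e) := by
  rw [stepVal_eq_sum, sum_stepVal_delta_mul b (killVal b f) n e he]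

lemma sum_stepVal_delta_succ_mul (b : ℕ → ℝ) (g : ℕ → ℝ) (n e : ℕ) (he : e < 2) :
    ∑ l ∈ Finset.range (2 * n + e), stepVal b delta (l + 1) * g (2 * n + e - 1 - l) =
      ∑ i ∈ Finset.range n, retVal b (i + 1) * g (2 * (n - 1 - i) + e) := by
  have h := sum_stepVal_delta_mul b g n e he
  rw [Finset.sum_range_succ', Finset.sum_range_succ'] at h
  have h0 : stepVal b delta 0 * g (2 * n + e - 0) = retVal b 0 * g (2 * (n - 0) + e) := rfl
  rw [h0] at h
  refine Eq.trans (Finset.sum_congr rfl fun i hi => ?_)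
    ((add_right_cancel h).trans (Finset.sum_congr rfl fun i hi => ?_))
  · congr 2
    lia
  · congr 2
    lia

/-! ### The matrix `R` as a Jacobi operator -/

/-- The off-diagonal entries of `R`. -/
def jac (b : ℕ → ℝ) (p : ℕ) : ℝ := 1 / (2 * √(b (p + 1) * b (p + 2)))

lemma applyR_zero (b w : ℕ → ℝ) : applyR b w 0 = jac b 0 * w 1 := by
  simp [applyR, matR, matQ, jac]

lemma applyR_succ (b w : ℕ → ℝ) (p : ℕ) :
    applyR b w (p + 1) = jac b p * w p + jac b (p + 1) * w (p + 2) := by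
  rw [applyR, Finset.sum_range_succ, Finset.sum_range_succ, Finset.sum_range_succ,
    Finset.sum_eq_zero]
  · simp [matR, matQ, jac, mul_comm (b (p + 1 + 1)) (b (p + 1))]
  · intro q hq
    have := Finset.mem_range.1 hq
    have : matR b (p + 1) q = 0 := by
      simp only [matR, matQ, Matrix.submatrix_apply, Matrix.of_apply]
      rw [if_neg (by lia)]
    rw [this, zero_mul]

lemma applyR_add (b f g : ℕ → ℝ) : applyR b (f + g) = applyR b f + applyR b g := by
  ext p
  simp [applyR, mul_add, Finset.sum_add_distrib]

lemma applyR_smul (b f : ℕ → ℝ) (c : ℝ) : applyR b (c • f) = c • applyR b f := by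
  ext p
  simp only [applyR, Pi.smul_apply, smul_eq_mul, Finset.mul_sum]
  exact Finset.sum_congr rfl fun _ _ => by ring

lemma applyR_iterate_smul (b f : ℕ → ℝ) (c : ℝ) (n : ℕ) :
    (applyR b)^[n] (c • f) = c • (applyR b)^[n] f := by
  induction n generalizing f with
  | zero => rfl
  | succ n ih => rw [Function.iterate_succ_apply, applyR_smul, ih, Function.iterate_succ_apply]

lemma applyR_iterate_single_eq_zero (b : ℕ → ℝ) (j n : ℕ) :
    ∀ x, (x + j + n) % 2 = 1 → powR b n x j = 0 := by
  unfold powR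
  induction n with
  | zero =>
    intro x hx
    have : x ≠ j := by lia
    simp [this]
  | succ n ih =>
    intro x hx
    rw [Function.iterate_succ_apply']
    cases x with
    | zero => rw [applyR_zero, ih 1 (by lia), mul_zero]
    | succ x => rw [applyR_succ, ih x (by lia), ih (x + 2) (by lia), mul_zero, mul_zero, add_zero]

lemma powR_odd (b : ℕ → ℝ) (n : ℕ) : powR b (2 * n + 1) 0 0 = 0 :=
  applyR_iterate_single_eq_zero b 0 _ 0 (by lia)

lemma jac_mul_sqrt {b : ℕ → ℝ} (hb : ∀ p, 0 < b (p + 1)) (p : ℕ) :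
    √(b (p + 1)) * jac b p = 1 / (2 * b (p + 2)) * √(b (p + 2)) := by
  have h1 : 0 < √(b (p + 1)) := Real.sqrt_pos.2 (hb p)
  have h2 : 0 < √(b (p + 2)) := Real.sqrt_pos.2 (hb (p + 1))
  rw [jac, Real.sqrt_mul (hb p).le]
  have h3 := (hb (p + 1)).ne'
  have h4 := Real.sq_sqrt (hb (p + 1)).le
  field_simp
  linarith

lemma jac_mul_sqrt' {b : ℕ → ℝ} (hb : ∀ p, 0 < b (p + 1)) (p : ℕ) :
    √(b (p + 2)) * jac b p = 1 / (2 * b (p + 1)) * √(b (p + 1)) := by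
  have h1 : 0 < √(b (p + 1)) := Real.sqrt_pos.2 (hb p)
  have h2 : 0 < √(b (p + 2)) := Real.sqrt_pos.2 (hb (p + 1))
  rw [jac, Real.sqrt_mul (hb p).le]
  have h3 := (hb p).ne'
  have h4 := Real.sq_sqrt (hb p).le
  field_simp
  linarith

/-- Conjugation by the diagonal matrix `√b` symmetrises the killed operator into `R`; the shift of
index reflects the removal of the origin. -/
lemma killOp_iterate_eq {b : ℕ → ℝ} (hb : ∀ p, 0 < b (p + 1)) {f w : ℕ → ℝ}
    (h : ∀ p, f (p + 1) = √(b (p + 1)) * w p) (n : ℕ) :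
    ∀ p, (killOp b)^[n] f (p + 1) = √(b (p + 1)) * (applyR b)^[n] w p := by
  induction n with
  | zero => exact h
  | succ n ih =>
    intro p
    rw [Function.iterate_succ_apply', Function.iterate_succ_apply', killOp, stepOp_succ]
    cases p with
    | zero =>
      rw [applyR_zero, ← mul_assoc, jac_mul_sqrt hb]
      simp only [offOrigin, if_true, mul_zero, zero_add, OfNat.ofNat_ne_zero,
        if_false, ih 1]
      ring
    | succ p =>
      have h1 := jac_mul_sqrt' hb p
      have h2 := jac_mul_sqrt hb (p + 1)
      rw [applyR_succ, mul_add, ← mul_assoc, ← mul_assoc, h1, h2]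
      simp only [offOrigin, Nat.add_eq_zero_iff, OfNat.ofNat_ne_zero, one_ne_zero, and_false,
        if_false, ih p, ih (p + 2)]
      ring

/-- This is the weight of an excursion of length `n + 2`: the step out of the origin, `n` steps on
the positive sites, and the step back. The outer two steps produce the factor `1 / (4 b₀ b₁)`. -/
lemma killVal_stepOp_delta {b : ℕ → ℝ} (hb : ∀ p, 0 < b p) (n : ℕ) :
    killVal b (stepOp b delta) (n + 1) = powR b n 0 0 / (4 * b 0 * b 1) := by
  have hs : 0 < √(b 1) := Real.sqrt_pos.2 (hb 1)
  have h0 := (hb 0).ne'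
  have h1 := (hb 1).ne'
  have key := killOp_iterate_eq (fun p => hb (p + 1)) (f := stepOp b delta)
    (w := (1 / (2 * b 0 * √(b 1))) • Pi.single 0 1) (fun p => by
      cases p with
      | zero =>
        rw [stepOp_succ, delta_zero, delta_of_ne (by lia)]
        simp
        field_simp
      | succ p =>
        rw [stepOp_succ, delta_of_ne (by lia), delta_of_ne (by lia)]
        simp) n 0
  rw [killVal_succ', zero_add] at *
  rw [key, applyR_iterate_smul, Pi.smul_apply, smul_eq_mul, powR]
  field_simp
  ring

lemma retVal_succ {b : ℕ → ℝ} (hb : ∀ p, 0 < b p) (n : ℕ) :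
    retVal b (n + 1) = ∑ i ∈ Finset.range (n + 1),
      retVal b i * (powR b (2 * (n - i)) 0 0 / (4 * b 0 * b 1)) := by
  rw [retVal, show 2 * (n + 1) = 2 * n + 1 + 1 by ring, stepVal_succ,
    stepVal_eq_sum_retVal b _ n 1 (by lia)]
  exact Finset.sum_congr rfl fun i _ => by rw [killVal_stepOp_delta hb]

/-! ### Logarithmic convexity of the return weights -/

/-- Symmetry of `stepOp` for the weight `1 / b`, as a discrete Green formula: truncation at `L`
leaves only a boundary term. -/
lemma sum_stepOp_symm (b f g : ℕ → ℝ) (L : ℕ) :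
    ∑ x ∈ Finset.range (L + 1), (f x * stepOp b g x - g x * stepOp b f x) / b x =
      (f L * g (L + 1) - g L * f (L + 1)) / (2 * b L * b (L + 1)) := by
  have aux : ∀ x y : ℝ, 1 / (2 * x) * y = y / 2 * x⁻¹ := fun x y => by
    rw [one_div, mul_inv]; ring
  induction L with
  | zero =>
    simp only [zero_add, Finset.sum_range_one, stepOp_zero, div_eq_mul_inv, mul_inv]
    ring
  | succ L ih =>
    rw [Finset.sum_range_succ, ih, stepOp_succ, stepOp_succ]
    simp only [div_eq_mul_inv, mul_inv]
    ring

lemma stepOp_iterate_delta_eq_zero (b : ℕ → ℝ) (n : ℕ) :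
    ∀ x, n < x → (stepOp b)^[n] delta x = 0 := by
  induction n with
  | zero => exact fun x hx => delta_of_ne (by lia)
  | succ n ih =>
    intro x hx
    rw [Function.iterate_succ_apply']
    refine Finset.sum_eq_zero fun y hy => ?_
    rw [ih y (by rw [mem_nbrs] at hy; lia), mul_zero]

/-- Iterates move one at a time across the symmetric pairing; the boundary term vanishes because
they have not reached `L`. -/
lemma sum_stepOp_iterate_mul (b : ℕ → ℝ) (n m L : ℕ) (hL : n + m < L) :
    ∑ x ∈ Finset.range (L + 1), (stepOp b)^[n] delta x * (stepOp b)^[m] delta x / b x =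
      stepVal b delta (n + m) / b 0 := by
  induction n generalizing m with
  | zero =>
    rw [Finset.sum_eq_single 0]
    · simp [stepVal, delta_zero]
    · intro x _ hx
      simp [delta_of_ne hx]
    · simp
  | succ n ih =>
    have h := sum_stepOp_symm b ((stepOp b)^[n] delta) ((stepOp b)^[m] delta) L
    rw [stepOp_iterate_delta_eq_zero b m L (by lia), stepOp_iterate_delta_eq_zero b n L (by lia),
      zero_mul, zero_mul, sub_zero, zero_div] at h
    rw [← Function.iterate_succ_apply' (stepOp b) m, ← Function.iterate_succ_apply' (stepOp b) n] at h
    simp only [sub_div, Finset.sum_sub_distrib] at h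
    rw [ih (m + 1) (by lia)] at h
    have h' : ∀ x, (stepOp b)^[n + 1] delta x * (stepOp b)^[m] delta x / b x =
      (stepOp b)^[m] delta x * (stepOp b)^[n.succ] delta x / b x := fun x => by
        rw [mul_comm]
    simp only [h']
    rw [show n + 1 + m = n + (m + 1) by ring]
    linarith

/-- Cauchy–Schwarz for the `n`-th and `(n + 2)`-th iterates of `delta`, whose pairings are the
moments of orders `2 n`, `2 n + 2` and `2 n + 4`. -/
lemma retVal_logConvex {b : ℕ → ℝ} (hb : ∀ p, 0 < b p) (n : ℕ) :
    retVal b (n + 1) ^ 2 ≤ retVal b n * retVal b (n + 2) := by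
  have key : (stepVal b delta (n + (n + 2)) / b 0) ^ 2 ≤
      (stepVal b delta (n + n) / b 0) * (stepVal b delta (n + 2 + (n + 2)) / b 0) := by
    rw [← sum_stepOp_iterate_mul b n (n + 2) (2 * n + 5) (by lia),
      ← sum_stepOp_iterate_mul b n n (2 * n + 5) (by lia),
      ← sum_stepOp_iterate_mul b (n + 2) (n + 2) (2 * n + 5) (by lia)]
    refine Finset.sum_sq_le_sum_mul_sum_of_sq_le_mul _ (fun x _ => ?_) (fun x _ => ?_)
      (fun x _ => le_of_eq (by ring))
    · exact div_nonneg (mul_self_nonneg _) (hb x).le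
    · exact div_nonneg (mul_self_nonneg _) (hb x).le
  rw [show n + (n + 2) = 2 * (n + 1) by ring, show n + n = 2 * n by ring,
    show n + 2 + (n + 2) = 2 * (n + 2) by ring, div_pow, div_mul_div_comm, ← sq,
    div_le_div_iff_of_pos_right (pow_pos (hb 0) 2)] at key
  exact key

/-! ### Convolutions and power series at the boundary -/

/-- Abelian theorem for ratios of power series. -/
lemma tendsto_powerSeries_div {a c : ℕ → ℝ} {A B : ℝ → ℝ} {L : ℝ} (hc : ∀ n, 0 < c n)
    (hac : Tendsto (fun n => a n / c n) atTop (𝓝 L))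
    (hA : ∀ x ∈ Set.Ioo (0 : ℝ) 1, HasSum (fun n => a n * x ^ n) (A x))
    (hB : ∀ x ∈ Set.Ioo (0 : ℝ) 1, HasSum (fun n => c n * x ^ n) (B x))
    (hBtop : Tendsto B (𝓝[<] 1) atTop) :
    Tendsto (fun x => A x / B x) (𝓝[<] 1) (𝓝 L) := by
  rw [Metric.tendsto_nhds]
  intro ε hε
  obtain ⟨N, hN⟩ := (Metric.tendsto_atTop.1 hac) (ε / 2) (by positivity)
  -- The finitely many terms where the ratio is not yet close to `L` contribute at most `C`, which
  -- is negligible against `B x → ∞`.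
  set C := ∑ n ∈ Finset.range N, |a n - L * c n| with hC
  have hC0 : 0 ≤ C := Finset.sum_nonneg fun _ _ => abs_nonneg _
  have hmem : ∀ᶠ x : ℝ in 𝓝[<] 1, x ∈ Set.Ioo (0 : ℝ) 1 := Ioo_mem_nhdsLT one_pos
  filter_upwards [hmem, hBtop.eventually_gt_atTop (2 * C / ε), hBtop.eventually_gt_atTop 0]
    with x hx hBC hB0
  have hdiff : HasSum (fun n => a n * x ^ n - L * (c n * x ^ n)) (A x - L * B x) :=
    (hA x hx).sub ((hB x hx).mul_left L)
  have hbound : ∀ n, |a n * x ^ n - L * (c n * x ^ n)| ≤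
      (if n < N then |a n - L * c n| else 0) + ε / 2 * (c n * x ^ n) := by
    intro n
    have hxn : 0 < x ^ n := pow_pos hx.1 n
    have hxn1 : x ^ n ≤ 1 := pow_le_one₀ hx.1.le hx.2.le
    have e1 : a n * x ^ n - L * (c n * x ^ n) = (a n - L * c n) * x ^ n := by ring
    rw [e1, abs_mul, abs_of_pos hxn]
    have hpos : 0 ≤ ε / 2 * (c n * x ^ n) := by have := hc n; positivity
    split_ifs with h
    · nlinarith [abs_nonneg (a n - L * c n)]
    · have h1 := hN n (not_lt.1 h)
      rw [Real.dist_eq] at h1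
      have e2 : a n - L * c n = (a n / c n - L) * c n := by
        field_simp [(hc n).ne']
      rw [e2, abs_mul, abs_of_pos (hc n), zero_add, mul_assoc]
      exact mul_le_mul_of_nonneg_right h1.le (by have := hc n; positivity)
  have hsumC : HasSum (fun n => if n < N then |a n - L * c n| else 0) C := by
    have h1 : HasSum (fun n => if n < N then |a n - L * c n| else 0)
        (∑ n ∈ Finset.range N, if n < N then |a n - L * c n| else 0) :=
      hasSum_sum_of_ne_finset_zero fun n hn => by
        rw [Finset.mem_range] at hn
        simp [hn]
    rwa [Finset.sum_congr rfl fun n hn => if_pos (Finset.mem_range.1 hn)] at h1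
  have hle : |A x - L * B x| ≤ C + ε / 2 * B x := by
    have hs := hsumC.add ((hB x hx).mul_left (ε / 2))
    rw [abs_le]
    constructor
    · have := hasSum_le (fun n => (abs_le.1 (hbound n)).1) hs.neg hdiff
      linarith
    · exact hasSum_le (fun n => (abs_le.1 (hbound n)).2) hdiff hs
  rw [Real.dist_eq, show A x / B x - L = (A x - L * B x) / B x by field_simp, abs_div,
    abs_of_pos hB0, div_lt_iff₀ hB0]
  have := (div_lt_iff₀ hε).1 hBC
  linarith

/-- A bounded logarithmically convex sequence is nonincreasing. -/
lemma antitone_of_logConvex {u : ℕ → ℝ} (hpos : ∀ n, 0 < u n) (hle : ∀ n, u n ≤ 1)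
    (hlog : ∀ n, u (n + 1) ^ 2 ≤ u n * u (n + 2)) : Antitone u := by
  refine antitone_nat_of_succ_le fun n => ?_
  by_contra! h
  set q := u (n + 1) / u n with hq
  have hq1 : 1 < q := (one_lt_div (hpos n)).2 h
  -- Logarithmic convexity makes successive ratios nondecreasing, so a single ratio `q > 1` persists
  -- and forces geometric growth beyond the bound.
  have hstep : ∀ k, q * u (n + k) ≤ u (n + k + 1) := by
    intro k
    induction k with
    | zero => rw [add_zero, hq, div_mul_cancel₀ _ (hpos n).ne']
    | succ k ih =>
      have h1 := hlog (n + k)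
      have h2 := hpos (n + k)
      have h3 := hpos (n + k + 1)
      have h4 := hpos (n + k + 2)
      have h5 : q * u (n + k + 1) * u (n + k) ≤ u (n + k + 2) * u (n + k) := by nlinarith
      exact le_of_mul_le_mul_right h5 h2
  have hgrow : ∀ k, u n * q ^ k ≤ u (n + k) := by
    intro k
    induction k with
    | zero => simp
    | succ k ih =>
      have := hstep k
      rw [pow_succ, ← add_assoc]
      nlinarith
  obtain ⟨k, hk⟩ := pow_unbounded_of_one_lt (1 / u n) hq1
  have h1 := hgrow k
  have h2 := hle (n + k)
  rw [div_lt_iff₀ (hpos n)] at hk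
  linarith

/-- The limit of a renewal sequence. -/
lemma renewal_limit {u f : ℕ → ℝ} {F : ℝ → ℝ} {lim μ : ℝ} (hu0 : u 0 = 1)
    (hu : ∀ n, u (n + 1) = ∑ i ∈ Finset.range (n + 1), u i * f (n - i))
    (hpos : ∀ n, 0 < u n) (hle : ∀ n, u n ≤ 1)
    (hF : ∀ x ∈ Set.Ioo (0 : ℝ) 1, HasSum (fun n => f n * x ^ (n + 1)) (F x))
    (hF1 : F 1 = 1) (hderiv : HasDerivAt F μ 1) (hlim : Tendsto u atTop (𝓝 lim)) :
    lim * μ = 1 := by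
  have hsumU : ∀ x ∈ Set.Ioo (0 : ℝ) 1, Summable fun n => u n * x ^ n := fun x hx =>
    Summable.of_nonneg_of_le (fun n => mul_nonneg (hpos n).le (pow_nonneg hx.1.le n))
      (fun n => mul_le_of_le_one_left (pow_nonneg hx.1.le n) (hle n))
      (summable_geometric_of_lt_one hx.1.le hx.2)
  -- The renewal equation for generating functions, `U = 1 + U F`. Below, `(1 - x) U(x) → lim` by
  -- comparison with the geometric series, while `(1 - F x) / (1 - x) → μ`; the product of the two
  -- is identically `1`.
  have hUF : ∀ x ∈ Set.Ioo (0 : ℝ) 1, (∑' n, u n * x ^ n) * (1 - F x) = 1 := by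
    intro x hx
    have h1 := hsumU x hx
    have h2 := hF x hx
    have h3 := tsum_mul_tsum_eq_tsum_sum_range_of_summable_norm h1.norm h2.summable.norm
    have h4 : ∀ n, ∑ k ∈ Finset.range (n + 1), u k * x ^ k * (f (n - k) * x ^ (n - k + 1)) =
        u (n + 1) * x ^ (n + 1) := by
      intro n
      rw [hu, Finset.sum_mul]
      refine Finset.sum_congr rfl fun k hk => ?_
      have hk' : k + (n - k + 1) = n + 1 := by
        have := Finset.mem_range.1 hk
        lia
      rw [← hk', pow_add]
      ring
    simp only [h4] at h3
    have h5 := h1.tsum_eq_zero_add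
    rw [hu0, pow_zero, mul_one, ← h3, h2.tsum_eq] at h5
    linarith
  have hB : ∀ x ∈ Set.Ioo (0 : ℝ) 1, HasSum (fun n => (fun _ : ℕ => (1 : ℝ)) n * x ^ n) (1 - x)⁻¹ :=
    fun x hx => by simpa using hasSum_geometric_of_lt_one hx.1.le hx.2
  have hBtop : Tendsto (fun x : ℝ => (1 - x)⁻¹) (𝓝[<] 1) atTop := by
    refine Tendsto.inv_tendsto_nhdsGT_zero (tendsto_nhdsWithin_iff.2 ⟨?_, ?_⟩)
    · have : Tendsto (fun x : ℝ => 1 - x) (𝓝 1) (𝓝 (1 - 1)) := tendsto_id.const_sub 1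
      rw [sub_self] at this
      exact this.mono_left nhdsWithin_le_nhds
    · filter_upwards [self_mem_nhdsWithin] with x hx
      exact sub_pos.2 (Set.mem_Iio.1 hx)
  have h1 := tendsto_powerSeries_div (a := u) (c := fun _ => 1) (L := lim) (fun _ => one_pos)
    (by simpa using hlim) (fun x hx => (hsumU x hx).hasSum) hB hBtop
  have h2 : Tendsto (slope F 1) (𝓝[<] 1) (𝓝 μ) :=
    hderiv.tendsto_slope.mono_left (nhdsWithin_mono _ fun x hx => ne_of_lt hx)
  refine tendsto_nhds_unique (h1.mul h2) (tendsto_const_nhds.congr' ?_)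
  filter_upwards [Ioo_mem_nhdsLT one_pos] with x hx
  have h3 := hUF x hx
  have h4 : 1 - x ≠ 0 := (sub_pos.2 hx.2).ne'
  rw [slope_def_field, hF1, div_inv_eq_mul, show F x - 1 = -(1 - F x) by ring,
    show x - 1 = -(1 - x) by ring, neg_div_neg_eq, mul_assoc, mul_div_cancel₀ _ h4, h3]

lemma tendsto_average_convolution {x y : ℕ → ℝ} {lx ly : ℝ} (hx : Tendsto x atTop (𝓝 lx))
    (hy : Tendsto y atTop (𝓝 ly)) :
    Tendsto (fun n : ℕ => (n : ℝ)⁻¹ * ∑ i ∈ Finset.range n, x (i + 1) * y (n - 1 - i)) atTop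
      (𝓝 (lx * ly)) := by
  obtain ⟨C, hC⟩ := hy.norm.bddAbove_range
  have hC' : ∀ n, |y n| ≤ C := fun n => hC ⟨n, rfl⟩
  have hx1 : Tendsto (fun n => |x (n + 1) - lx|) atTop (𝓝 0) := by
    have := ((hx.comp (tendsto_add_atTop_nat 1)).sub_const lx).abs
    simpa using this
  have h1 := hx1.cesaro.const_mul C
  have h2 := (hy.cesaro.const_mul lx)
  rw [mul_zero] at h1
  have h3 : Tendsto (fun n : ℕ => (n : ℝ)⁻¹ *
      ∑ i ∈ Finset.range n, (x (i + 1) - lx) * y (n - 1 - i)) atTop (𝓝 0) := by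
    refine squeeze_zero_norm (fun n => ?_) h1
    rw [Real.norm_eq_abs, abs_mul, abs_of_nonneg (by positivity : (0 : ℝ) ≤ (n : ℝ)⁻¹),
      mul_left_comm]
    refine mul_le_mul_of_nonneg_left ?_ (by positivity)
    rw [Finset.mul_sum]
    refine (Finset.abs_sum_le_sum_abs _ _).trans (Finset.sum_le_sum fun i _ => ?_)
    rw [abs_mul, mul_comm]
    exact mul_le_mul_of_nonneg_right (hC' _) (abs_nonneg _)
  refine ((h3.add h2).congr fun n => ?_).trans (by rw [zero_add])
  rw [← Finset.sum_range_reflect y n, mul_left_comm, ← mul_add, Finset.mul_sum,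
    ← Finset.sum_add_distrib]
  congr 1
  exact Finset.sum_congr rfl fun i _ => by ring

lemma tendsto_convolution_summable {u h : ℕ → ℝ} {lim : ℝ} (hu : Tendsto u atTop (𝓝 lim))
    (hle : ∀ n, |u n| ≤ 1) (hh : Summable h) :
    Tendsto (fun n => ∑ i ∈ Finset.range (n + 1), u i * h (n - i)) atTop
      (𝓝 (lim * ∑' j, h j)) := by
  have h1 : Tendsto (fun n => ∑' j, (if j ≤ n then u (n - j) * h j else 0)) atTop
      (𝓝 (∑' j, lim * h j)) := by
    refine tendsto_tsum_of_dominated_convergence hh.norm (fun j => ?_)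
      (Eventually.of_forall fun n j => ?_)
    · refine ((hu.comp (tendsto_sub_atTop_nat j)).mul_const (h j)).congr' ?_
      filter_upwards [eventually_ge_atTop j] with n hn
      simp [hn]
    · split_ifs
      · rw [norm_mul]
        exact mul_le_of_le_one_left (norm_nonneg _) (hle _)
      · simp
  rw [tsum_mul_left] at h1
  refine h1.congr fun n => ?_
  rw [tsum_eq_sum (s := Finset.range (n + 1)) (fun j hj => by
    rw [Finset.mem_range] at hj
    rw [if_neg (by lia)]), ← Finset.sum_range_reflect]
  refine Finset.sum_congr rfl fun i hi => ?_
  have := Finset.mem_range.1 hi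
  rw [if_pos (by lia)]
  congr 2
  lia

lemma tendsto_of_even_odd {f : ℕ → ℝ} {l : ℝ}
    (h : ∀ e < 2, Tendsto (fun n => f (2 * n + e)) atTop (𝓝 l)) : Tendsto f atTop (𝓝 l) := by
  rw [Metric.tendsto_atTop]
  intro ε hε
  obtain ⟨N, hN⟩ := Metric.tendsto_atTop.1 (h 0 (by lia)) ε hε
  obtain ⟨M, hM⟩ := Metric.tendsto_atTop.1 (h 1 (by lia)) ε hε
  refine ⟨2 * N + 2 * M + 1, fun n hn => ?_⟩
  obtain ⟨k, rfl | rfl⟩ := Nat.even_or_odd' n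
  · exact hN k (by lia)
  · exact hM k (by lia)

/-! ### The density of returns -/

/-- The factor `1/2` is the period: `n` possible return times within a length `2 n + e`. The
sequence `y` is to be the tilted partition function, and its limit cancels between numerator and
denominator. -/
lemma tendsto_density_aux {x y : ℕ → ℝ} {lx ly : ℝ} (e : ℝ) (hx : Tendsto x atTop (𝓝 lx))
    (hy : Tendsto y atTop (𝓝 ly)) (hly : ly ≠ 0) :
    Tendsto (fun n : ℕ => 1 / (2 * (n : ℝ) + e) *
      ((∑ i ∈ Finset.range n, x (i + 1) * y (n - 1 - i)) / y n)) atTop (𝓝 (lx / 2)) := by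
  have h1 := (tendsto_average_convolution hx hy).div hy hly
  have h2 : Tendsto (fun n : ℕ => (2 + e / (n : ℝ))⁻¹) atTop (𝓝 ((2 + 0)⁻¹)) :=
    (tendsto_const_nhds.add (tendsto_const_div_atTop_nhds_zero_nat e)).inv₀ (by norm_num)
  have h3 := h2.mul h1
  rw [add_zero, mul_div_assoc, div_self hly, mul_one, inv_mul_eq_div] at h3
  refine h3.congr' ?_
  filter_upwards [eventually_gt_atTop 0] with n hn
  have hn' : (n : ℝ) ≠ 0 := by exact_mod_cast hn.ne'
  have h4 : 2 * (n : ℝ) + e = (2 + e / n) * n := by field_simp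
  rw [h4, one_div, mul_inv]
  simp only [Pi.div_apply]
  ring

lemma powR_nonneg (b : ℕ → ℝ) (n i j : ℕ) : 0 ≤ powR b n i j := by
  have hj : ∀ p, 0 ≤ jac b p := fun p => by unfold jac; positivity
  unfold powR
  induction n generalizing i with
  | zero =>
    by_cases h : i = j
    · subst h; simp
    · simp [h]
  | succ n ih =>
    rw [Function.iterate_succ_apply']
    cases i with
    | zero => rw [applyR_zero]; exact mul_nonneg (hj _) (ih _)
    | succ i =>
      rw [applyR_succ]
      exact add_nonneg (mul_nonneg (hj _) (ih _)) (mul_nonneg (hj _) (ih _))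

lemma killOp_iterate_one_pos {b : ℕ → ℝ} (hb : ∀ p, 0 < b p) (n : ℕ) :
    ∀ x, 0 < (killOp b)^[n] 1 x := by
  induction n with
  | zero => intro x; simp
  | succ n ih =>
    intro x
    rw [Function.iterate_succ_apply', killOp]
    cases x with
    | zero =>
      rw [stepOp_zero]
      have := hb 1
      have := ih 1
      simp only [offOrigin, one_ne_zero, if_false]
      positivity
    | succ x =>
      rw [stepOp_succ]
      have := hb x
      have := hb (x + 2)
      have := ih (x + 2)
      have h0 : 0 ≤ offOrigin ((killOp b)^[n] 1) x := by
        unfold offOrigin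
        split_ifs
        · exact le_rfl
        · exact (ih x).le
      have h2 : offOrigin ((killOp b)^[n] 1) (x + 2) = (killOp b)^[n] 1 (x + 2) := by
        simp [offOrigin]
      rw [h2]
      positivity

/-- The density of returns is half the inverse of the mean of the tilted renewal law. -/
theorem isReturnDensity_of_renewal {b : ℕ → ℝ} (hb : ∀ p, 0 < b p) {t μ : ℝ} (ht : 0 < t)
    {F : ℝ → ℝ}
    (hF : ∀ x, 0 < x → x ≤ 1 → HasSum
      (fun n => powR b (2 * n) 0 0 / (4 * b 0 * b 1) * t ^ (2 * (n + 1)) * x ^ (n + 1)) (F x))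
    (hF1 : F 1 = 1) (hderiv : HasDerivAt F μ 1)
    (hk : Summable fun j => killVal b 1 j * t ^ j) :
    0 < μ ∧ IsReturnDensity b (1 / (2 * μ)) := by
  set f : ℕ → ℝ := fun n => powR b (2 * n) 0 0 / (4 * b 0 * b 1) * t ^ (2 * (n + 1)) with hf
  set u : ℕ → ℝ := fun n => retVal b n * t ^ (2 * n) with hu
  have hb0 := hb 0
  have hb1 := hb 1
  have hf0 : ∀ n, 0 ≤ f n := fun n => by
    have := powR_nonneg b (2 * n) 0 0
    simp only [hf]
    positivity
  have hf00 : 0 < f 0 := by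
    simp only [hf, powR, mul_zero, Function.iterate_zero_apply, Pi.single_eq_same]
    positivity
  have hu0 : u 0 = 1 := by simp [hu, retVal_zero]
  have hrec : ∀ n, u (n + 1) = ∑ i ∈ Finset.range (n + 1), u i * f (n - i) := by
    intro n
    simp only [hu, hf]
    rw [retVal_succ hb, Finset.sum_mul]
    refine Finset.sum_congr rfl fun i hi => ?_
    have hi' : 2 * (n + 1) = 2 * i + 2 * (n - i + 1) := by
      have := Finset.mem_range.1 hi
      lia
    rw [hi', pow_add]
    ring
  have hupos : ∀ n, 0 < u n := by
    intro n
    induction n using Nat.strong_induction_on with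
    | _ n ih =>
      cases n with
      | zero => rw [hu0]; exact one_pos
      | succ n =>
        rw [hrec]
        refine Finset.sum_pos' (fun i hi => ?_) ⟨n, by simp, ?_⟩
        · exact mul_nonneg (ih i (by simpa using hi)).le (hf0 _)
        · rw [Nat.sub_self]
          exact mul_pos (ih n (by lia)) hf00
  have hfsum : HasSum f 1 := by
    have := hF 1 one_pos le_rfl
    simpa only [one_pow, mul_one, hF1] using this
  -- Inductively, `u (n + 1)` is at most a partial sum of the probability law `f`.
  have hule : ∀ n, u n ≤ 1 := by
    intro n
    induction n using Nat.strong_induction_on with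
    | _ n ih =>
      cases n with
      | zero => rw [hu0]
      | succ n =>
        rw [hrec]
        calc ∑ i ∈ Finset.range (n + 1), u i * f (n - i)
            ≤ ∑ i ∈ Finset.range (n + 1), f (n + 1 - 1 - i) := Finset.sum_le_sum fun i hi =>
              mul_le_of_le_one_left (hf0 _) (ih i (by simpa using hi))
          _ = ∑ i ∈ Finset.range (n + 1), f i := Finset.sum_range_reflect f (n + 1)
          _ ≤ 1 := sum_le_hasSum _ (fun i _ => hf0 i) hfsum
  have hlog : ∀ n, u (n + 1) ^ 2 ≤ u n * u (n + 2) := by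
    intro n
    simp only [hu]
    have h1 := retVal_logConvex hb n
    have h2 : 0 ≤ t ^ (4 * n + 4) := by positivity
    calc (retVal b (n + 1) * t ^ (2 * (n + 1))) ^ 2
        = retVal b (n + 1) ^ 2 * t ^ (4 * n + 4) := by ring
      _ ≤ retVal b n * retVal b (n + 2) * t ^ (4 * n + 4) := mul_le_mul_of_nonneg_right h1 h2
      _ = _ := by ring
  have hanti := antitone_of_logConvex hupos hule hlog
  obtain ⟨lim, hlim⟩ : ∃ lim, Tendsto u atTop (𝓝 lim) :=
    ⟨_, tendsto_atTop_ciInf hanti ⟨0, by rintro _ ⟨n, rfl⟩; exact (hupos n).le⟩⟩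
  have hlim0 : 0 ≤ lim := ge_of_tendsto' hlim fun n => (hupos n).le
  have hlm : lim * μ = 1 := renewal_limit hu0 hrec hupos hule
    (fun x hx => hF x hx.1 hx.2.le) hF1 hderiv hlim
  have hlimpos : 0 < lim := lt_of_le_of_ne hlim0 fun h => by
    rw [← h, zero_mul] at hlm
    exact one_ne_zero hlm.symm
  have hμ : 0 < μ := by
    by_contra! h
    nlinarith
  have hm : 1 / (2 * μ) = lim / 2 := by
    field_simp
    linarith
  refine ⟨hμ, ?_, ?_⟩
  · rw [hm]
    have h1 := tendsto_density_aux (-1) hlim hlim hlimpos.ne'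
    -- The forced return at the final time is not counted for the bridge; removing it costs one
    -- visit, which vanishes in the density.
    have h2 : Tendsto (fun n : ℕ => 1 / (2 * (n : ℝ) - 1)) atTop (𝓝 0) := by
      refine Tendsto.const_div_atTop ?_ 1
      exact tendsto_atTop_add_const_right _ _
        (tendsto_natCast_atTop_atTop.const_mul_atTop two_pos)
    have h3 := h1.sub h2
    rw [sub_zero] at h3
    refine h3.congr' ?_
    filter_upwards [eventually_gt_atTop 0] with n hn
    have hs := sum_stepVal_delta_succ_mul b (stepVal b delta) n 0 (by lia)
    simp only [add_zero] at hs
    rw [bridgeDensity_eq hb0.ne' hn.ne', hs]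
    have hne : stepVal b delta (2 * n) ≠ 0 := fun h => by
      have := hupos n
      simp only [hu, retVal, h, zero_mul] at this
      exact lt_irrefl _ this
    have hsum : ∑ i ∈ Finset.range n, u (i + 1) * u (n - 1 - i) =
        (∑ i ∈ Finset.range n, retVal b (i + 1) * stepVal b delta (2 * (n - 1 - i))) *
          t ^ (2 * n) := by
      rw [Finset.sum_mul]
      refine Finset.sum_congr rfl fun i hi => ?_
      have hi' : 2 * n = 2 * (i + 1) + 2 * (n - 1 - i) := by
        have := Finset.mem_range.1 hi
        lia
      simp only [hu]
      have ht' : t ^ (2 * n) = t ^ (2 * (i + 1)) * t ^ (2 * (n - 1 - i)) := by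
        rw [← pow_add, ← hi']
      rw [ht', retVal, retVal]
      ring
    rw [hsum]
    simp only [hu, retVal]
    rw [mul_div_mul_right _ _ (pow_pos ht _).ne', sub_div, div_self hne]
    ring
  · rw [hm]
    -- For each parity, the partition function with free endpoint is the convolution of `u` with the
    -- summable weights `h` of the stretch after the last visit, so it converges to a positive
    -- limit.
    refine tendsto_of_even_odd fun e he => ?_
    set h : ℕ → ℝ := fun j => killVal b 1 (2 * j + e) * t ^ (2 * j + e) with hh
    have hhpos : ∀ j, 0 < h j := fun j =>
      mul_pos (killOp_iterate_one_pos hb _ 0) (pow_pos ht _)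
    have hhsum : Summable h := hk.comp_injective
      (i := fun j => 2 * j + e) (fun i j hij => by simp only at hij; lia)
    set V : ℕ → ℝ := fun n => stepVal b 1 (2 * n + e) * t ^ (2 * n + e) with hV
    have hVlim : Tendsto V atTop (𝓝 (lim * ∑' j, h j)) := by
      refine (tendsto_convolution_summable hlim
        (fun n => by rw [abs_of_pos (hupos n)]; exact hule n) hhsum).congr fun n => ?_
      simp only [hV, hu, hh]
      rw [stepVal_eq_sum_retVal b 1 n e he, Finset.sum_mul]
      refine Finset.sum_congr rfl fun i hi => ?_
      have hi' : 2 * n + e = 2 * i + (2 * (n - i) + e) := by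
        have := Finset.mem_range.1 hi
        lia
      have ht' : t ^ (2 * n + e) = t ^ (2 * i) * t ^ (2 * (n - i) + e) := by
        rw [← pow_add, ← hi']
      rw [ht']
      ring
    have hHpos : 0 < ∑' j, h j := hhsum.tsum_pos (fun j => (hhpos j).le) 0 (hhpos 0)
    refine (tendsto_density_aux (e : ℝ) hlim hVlim (mul_pos hlimpos hHpos).ne').congr fun n => ?_
    rw [freeDensity_eq hb0.ne', sum_stepVal_delta_succ_mul b (stepVal b 1) n e he]
    have hsum : ∑ i ∈ Finset.range n, u (i + 1) * V (n - 1 - i) =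
        (∑ i ∈ Finset.range n, retVal b (i + 1) * stepVal b 1 (2 * (n - 1 - i) + e)) *
          t ^ (2 * n + e) := by
      rw [Finset.sum_mul]
      refine Finset.sum_congr rfl fun i hi => ?_
      have hi' : 2 * n + e = 2 * (i + 1) + (2 * (n - 1 - i) + e) := by
        have := Finset.mem_range.1 hi
        lia
      simp only [hu, hV]
      have ht' : t ^ (2 * n + e) = t ^ (2 * (i + 1)) * t ^ (2 * (n - 1 - i) + e) := by
        rw [← pow_add, ← hi']
      rw [ht']
      ring
    rw [hsum]
    simp only [hV]
    rw [mul_div_mul_right _ _ (pow_pos ht _).ne']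
    push_cast
    rfl

/-! ### Powers of the Jacobi operator -/

lemma jac_nonneg (b : ℕ → ℝ) (p : ℕ) : 0 ≤ jac b p := by unfold jac; positivity

lemma applyR_mono (b : ℕ → ℝ) {f g : ℕ → ℝ} (h : f ≤ g) : applyR b f ≤ applyR b g := by
  intro p
  cases p with
  | zero =>
    rw [applyR_zero, applyR_zero]
    exact mul_le_mul_of_nonneg_left (h 1) (jac_nonneg b 0)
  | succ p =>
    rw [applyR_succ, applyR_succ]
    exact add_le_add (mul_le_mul_of_nonneg_left (h _) (jac_nonneg b _))
      (mul_le_mul_of_nonneg_left (h _) (jac_nonneg b _))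

lemma applyR_iterate_mono (b : ℕ → ℝ) {f g : ℕ → ℝ} (h : f ≤ g) (n : ℕ) :
    (applyR b)^[n] f ≤ (applyR b)^[n] g := by
  induction n generalizing f g with
  | zero => exact h
  | succ n ih => exact ih (applyR_mono b h)

lemma applyR_iterate_add (b f g : ℕ → ℝ) (n : ℕ) :
    (applyR b)^[n] (f + g) = (applyR b)^[n] f + (applyR b)^[n] g := by
  induction n generalizing f g with
  | zero => rfl
  | succ n ih =>
    rw [Function.iterate_succ_apply, applyR_add, ih]
    rfl

lemma applyR_iterate_sum (b : ℕ → ℝ) (f : ℕ → ℕ → ℝ) (n L : ℕ) :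
    (applyR b)^[n] (∑ q ∈ Finset.range L, f q) =
      ∑ q ∈ Finset.range L, (applyR b)^[n] (f q) := by
  induction L with
  | zero =>
    have h := applyR_iterate_smul b 0 0 n
    simpa using h
  | succ L ih => rw [Finset.sum_range_succ, applyR_iterate_add, ih, Finset.sum_range_succ]

lemma applyR_iterate_le (b : ℕ → ℝ) {w : ℕ → ℝ} {ρ : ℝ} (hρ : 0 ≤ ρ) (h : applyR b w ≤ ρ • w)
    (n : ℕ) : (applyR b)^[n] w ≤ ρ ^ n • w := by
  induction n with
  | zero => simp
  | succ n ih =>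
    rw [Function.iterate_succ_apply']
    refine (applyR_mono b ih).trans ?_
    rw [applyR_smul, pow_succ, mul_smul]
    intro p
    exact mul_le_mul_of_nonneg_left (h p) (pow_nonneg hρ n)

lemma le_applyR_iterate (b : ℕ → ℝ) {w : ℕ → ℝ} {ρ : ℝ} (hρ : 0 ≤ ρ) (h : ρ • w ≤ applyR b w)
    (n : ℕ) : ρ ^ n • w ≤ (applyR b)^[n] w := by
  induction n with
  | zero => simp
  | succ n ih =>
    rw [Function.iterate_succ_apply']
    refine le_trans ?_ (applyR_mono b ih)
    rw [applyR_smul, pow_succ, mul_smul]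
    intro p
    exact mul_le_mul_of_nonneg_left (h p) (pow_nonneg hρ n)

lemma smul_single_le {w : ℕ → ℝ} (hw : ∀ p, 0 ≤ w p) (j : ℕ) :
    w j • (Pi.single j 1 : ℕ → ℝ) ≤ w := by
  intro p
  by_cases h : p = j
  · subst h; simp
  · simpa [h] using hw p

lemma powR_mul_le (b : ℕ → ℝ) {w : ℕ → ℝ} (hw : ∀ p, 0 ≤ w p) (n i j : ℕ) :
    powR b n i j * w j ≤ (applyR b)^[n] w i := by
  have h := applyR_iterate_mono b (smul_single_le hw j) n i
  rw [applyR_iterate_smul] at h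
  rw [mul_comm]
  exact h

/-- Keep only the paths that are at `k` after `n` steps. -/
lemma powR_mul_powR_le (b : ℕ → ℝ) (n m i j k : ℕ) :
    powR b n i k * powR b m k j ≤ powR b (n + m) i j := by
  have h := powR_mul_le b (w := (applyR b)^[m] (Pi.single j 1)) (fun p => powR_nonneg b m p j) n i k
  rwa [← Function.iterate_add_apply] at h

lemma powR_to_zero_pos {b : ℕ → ℝ} (hr : ∀ p, 0 < jac b p) (i : ℕ) : 0 < powR b i i 0 := by
  induction i with
  | zero => simp [powR]
  | succ i ih =>
    have h1 : jac b i ≤ powR b 1 (i + 1) i := by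
      simp [powR, applyR_succ]
    have h2 := powR_mul_powR_le b 1 i (i + 1) 0 i
    rw [add_comm 1 i] at h2
    have h3 := hr i
    nlinarith

lemma powR_from_zero_pos {b : ℕ → ℝ} (hr : ∀ p, 0 < jac b p) (j : ℕ) : 0 < powR b j 0 j := by
  induction j with
  | zero => simp [powR]
  | succ j ih =>
    have h1 : jac b j ≤ powR b 1 j (j + 1) := by
      cases j with
      | zero => simp [powR, applyR_zero]
      | succ j =>
        have : j ≠ j + 1 + 1 := by lia
        simp [powR, applyR_succ, this]
    have h2 := powR_mul_powR_le b j 1 0 (j + 1) j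
    have h3 := hr j
    nlinarith

lemma powR_even_pos {b : ℕ → ℝ} (hr : ∀ p, 0 < jac b p) (k : ℕ) : 0 < powR b (2 * k) 0 0 := by
  induction k with
  | zero => simp [powR]
  | succ k ih =>
    have h1 : 0 < powR b 2 0 0 := by
      have := hr 0
      have h : powR b 2 0 0 = jac b 0 * jac b 0 := by
        simp [powR, applyR_zero, applyR_succ]
      rw [h]
      positivity
    have h2 := powR_mul_powR_le b (2 * k) 2 0 0 0
    rw [show 2 * (k + 1) = 2 * k + 2 by ring]
    nlinarith

/-! ### The convergence norm -/

/-- The formal eigenvector of the Jacobi operator with eigenvalue `t`. -/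
def orthoPoly (b : ℕ → ℝ) (t : ℝ) : ℕ → ℝ
  | 0 => 1
  | 1 => t / jac b 0
  | p + 2 => (t * orthoPoly b t (p + 1) - jac b p * orthoPoly b t p) / jac b (p + 1)

/-- Below the essential spectrum there is no positive eigenvector. -/
lemma exists_orthoPoly_nonpos {b : ℕ → ℝ} (hr : ∀ p, 0 < jac b p) {t c : ℝ} (ht : 0 < t)
    (hc : 1 / 4 < c) (hlarge : ∀ᶠ p in atTop, c * t ^ 2 ≤ jac b p ^ 2) :
    ∃ p, orthoPoly b t p ≤ 0 := by
  by_contra! hP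
  obtain ⟨p₀, hp₀⟩ := eventually_atTop.1 hlarge
  -- Riccati variable of the three-term recursion. Its limiting map `q ↦ 1 - c / q` has no fixed
  -- point once `c > 1/4`, so `q` falls by at least `c - 1/4` per step and cannot remain positive.
  set q : ℕ → ℝ := fun p => jac b p * orthoPoly b t (p + 1) / (t * orthoPoly b t p) with hq
  have hqpos : ∀ p, 0 < q p := fun p =>
    div_pos (mul_pos (hr p) (hP _)) (mul_pos ht (hP _))
  have hrec : ∀ p, q (p + 1) = 1 - jac b p ^ 2 / (t ^ 2 * q p) := by
    intro p
    have h0 := (hr p).ne'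
    have h1 := (hr (p + 1)).ne'
    have h2 := (hP p).ne'
    have h3 := (hP (p + 1)).ne'
    have h4 := ht.ne'
    have h5 : orthoPoly b t (p + 1 + 1) =
      (t * orthoPoly b t (p + 1) - jac b p * orthoPoly b t p) / jac b (p + 1) := rfl
    simp only [hq, h5]
    field_simp
  have hlt : ∀ p, q (p + 1) < 1 := by
    intro p
    rw [hrec]
    have := hqpos p
    have := hr p
    have : 0 < jac b p ^ 2 / (t ^ 2 * q p) := by positivity
    linarith
  have hdec : ∀ p, p₀ ≤ p → q (p + 2) ≤ q (p + 1) - (c - 1 / 4) := by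
    intro p hp
    have h1 := hrec (p + 1)
    have h2 := hqpos (p + 1)
    have h3 := hlt p
    have h4 := hp₀ (p + 1) (by lia)
    have h5 : c / q (p + 1) ≤ jac b (p + 1) ^ 2 / (t ^ 2 * q (p + 1)) := by
      rw [div_le_div_iff₀ h2 (by positivity)]
      nlinarith
    have h6 : 1 + (c - 1 / 4) - q (p + 1) ≤ c / q (p + 1) := by
      rw [le_div_iff₀ h2]
      nlinarith [sq_nonneg (q (p + 1) - 1 / 2)]
    rw [show p + 2 = p + 1 + 1 by ring]
    linarith
  have hiter : ∀ k : ℕ, q (p₀ + 1 + k) ≤ 1 - k * (c - 1 / 4) := by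
    intro k
    induction k with
    | zero => simpa using (hlt p₀).le
    | succ k ih =>
      have h1 := hdec (p₀ + k) (by lia)
      rw [show p₀ + 1 + (k + 1) = p₀ + k + 2 by ring]
      rw [show p₀ + 1 + k = p₀ + k + 1 by ring] at ih
      push_cast
      linarith
  obtain ⟨k, hk⟩ := exists_nat_gt (1 / (c - 1 / 4))
  rw [div_lt_iff₀ (by linarith)] at hk
  have h1 := hiter k
  have h2 := hqpos (p₀ + 1 + k)
  linarith

/-- The formal eigenvector, cut off at its first nonpositive entry, is a finitely supported `f ≥ 0`
with `t f ≤ R f`: the discarded entry could only have lowered `R f`. Hence `R ^ n f` grows at least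
like `t ^ n`, and this growth is transferred to the corner entry. -/
lemma exists_powR_zero_ge {b : ℕ → ℝ} (hr : ∀ p, 0 < jac b p) {t c : ℝ} (ht : 0 < t)
    (hc : 1 / 4 < c) (hlarge : ∀ᶠ p in atTop, c * t ^ 2 ≤ jac b p ^ 2) :
    ∃ d > 0, ∃ L : ℕ, ∀ n : ℕ, d * t ^ (2 * n) ≤ powR b (2 * n + 2 * L) 0 0 := by
  classical
  have hex := exists_orthoPoly_nonpos hr ht hc hlarge
  set L := Nat.find hex with hL
  have hPL : orthoPoly b t L ≤ 0 := Nat.find_spec hex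
  have hPpos : ∀ p < L, 0 < orthoPoly b t p := fun p hp => not_le.1 (Nat.find_min hex hp)
  have hL0 : 0 < L := by
    by_contra! h
    have : L = 0 := by lia
    rw [this] at hPL
    exact absurd hPL (not_le.2 one_pos)
  set f : ℕ → ℝ := ∑ q ∈ Finset.range L, orthoPoly b t q • (Pi.single q 1 : ℕ → ℝ) with hf
  have hfval : ∀ x, f x = if x < L then orthoPoly b t x else 0 := by
    intro x
    simp only [hf, Finset.sum_apply, Pi.smul_apply, Pi.single_apply, smul_eq_mul, mul_ite, mul_one,
      mul_zero, Finset.sum_ite_eq, Finset.mem_range]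
  have hfnn : ∀ x, 0 ≤ f x := by
    intro x
    rw [hfval]
    split_ifs with h
    · exact (hPpos x h).le
    · exact le_rfl
  have hfge : ∀ x, x ≤ L → orthoPoly b t x ≤ f x := by
    intro x hx
    rw [hfval]
    split_ifs with h
    · exact le_rfl
    · rwa [show x = L by lia]
  have hsub : t • f ≤ applyR b f := by
    intro x
    by_cases hx : x < L
    · rw [Pi.smul_apply, smul_eq_mul, hfval, if_pos hx]
      cases x with
      | zero =>
        rw [applyR_zero]
        refine le_trans (le_of_eq ?_) (mul_le_mul_of_nonneg_left (hfge 1 hx) (hr 0).le)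
        simp only [orthoPoly]
        field_simp [(hr 0).ne']
      | succ x =>
        rw [applyR_succ]
        refine le_trans (le_of_eq ?_) (add_le_add
          (mul_le_mul_of_nonneg_left (hfge x (by lia)) (hr x).le)
          (mul_le_mul_of_nonneg_left (hfge (x + 2) hx) (hr (x + 1)).le))
        rw [orthoPoly]
        field_simp [(hr (x + 1)).ne']
        ring
    · rw [Pi.smul_apply, smul_eq_mul, hfval, if_neg hx, mul_zero]
      have h0 := applyR_mono b (show (0 : ℕ → ℝ) ≤ f from hfnn) x
      refine le_trans (le_of_eq ?_) h0
      simp [applyR]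
  have hpow := fun n => le_applyR_iterate b ht.le hsub n 0
  -- A path ending at an even `q` is closed up by `q` steps back to `0` and a loop of length `2 (L -
  -- q / 2)`, adding `2 L` steps whatever `q` is. Odd `q` drop out by parity.
  set C := ∑ q ∈ Finset.range L,
    (orthoPoly b t q / (powR b q q 0 * powR b (2 * (L - q / 2)) 0 0)) with hC
  have hterm : ∀ q ∈ Finset.range L,
      0 < orthoPoly b t q / (powR b q q 0 * powR b (2 * (L - q / 2)) 0 0) := fun q hq =>
    div_pos (hPpos q (Finset.mem_range.1 hq)) (mul_pos (powR_to_zero_pos hr q) (powR_even_pos hr _))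
  have hCpos : 0 < C := Finset.sum_pos hterm ⟨0, Finset.mem_range.2 hL0⟩
  refine ⟨C⁻¹, inv_pos.2 hCpos, L, fun n => ?_⟩
  rw [inv_mul_le_iff₀ hCpos]
  have h1 := hpow (2 * n)
  rw [Pi.smul_apply, smul_eq_mul, hfval, if_pos hL0, hf, applyR_iterate_sum, Finset.sum_apply] at h1
  simp only [orthoPoly, mul_one] at h1
  refine h1.trans ?_
  rw [hC, Finset.sum_mul]
  refine Finset.sum_le_sum fun q hq => ?_
  rw [applyR_iterate_smul, Pi.smul_apply, smul_eq_mul]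
  change orthoPoly b t q * powR b (2 * n) 0 q ≤ _
  have hq' := Finset.mem_range.1 hq
  have hp1 := powR_to_zero_pos hr q
  have hp2 := powR_even_pos hr (L - q / 2)
  have hP := hPpos q hq'
  rw [div_mul_eq_mul_div, le_div_iff₀ (mul_pos hp1 hp2), mul_assoc]
  refine mul_le_mul_of_nonneg_left ?_ hP.le
  obtain ⟨k, hk | hk⟩ := Nat.even_or_odd' q
  · have e1 := powR_mul_powR_le b (2 * n) q 0 0 q
    have e2 := powR_mul_powR_le b (2 * n + q) (2 * (L - q / 2)) 0 0 0
    rw [show 2 * n + q + 2 * (L - q / 2) = 2 * n + 2 * L by lia] at e2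
    rw [← mul_assoc]
    exact (mul_le_mul_of_nonneg_right e1 hp2.le).trans e2
  · rw [applyR_iterate_single_eq_zero b q (2 * n) 0 (by lia), zero_mul]
    exact powR_nonneg _ _ _ _

lemma tendsto_of_forall_between {x : ℕ → ℝ} (hlow : ∀ t, 0 < t → t < 1 → ∀ᶠ n in atTop, t ≤ x n)
    (hup : ∀ t, 1 < t → ∀ᶠ n in atTop, x n ≤ t) : Tendsto x atTop (𝓝 1) := by
  refine tendsto_order.2 ⟨fun a ha => ?_, fun a ha => ?_⟩
  · have hm : a < max ((a + 1) / 2) (1 / 2) := lt_max_of_lt_left (by linarith)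
    filter_upwards [hlow (max ((a + 1) / 2) (1 / 2)) (lt_max_of_lt_right (by norm_num))
      (max_lt (by linarith) (by norm_num))] with n hn
    exact hm.trans_le hn
  · filter_upwards [hup ((a + 1) / 2) (by linarith)] with n hn
    linarith

lemma eventually_pow_le_mul_pow {c r t : ℝ} (hc : 0 < c) (hr : 0 < r) (hrt : r < t) :
    ∀ᶠ n : ℕ in atTop, r ^ (2 * n) ≤ c * t ^ (2 * n) := by
  have h1 : 1 < t / r := (one_lt_div hr).2 hrt
  have h2 : Tendsto (fun n : ℕ => (t / r) ^ (2 * n)) atTop atTop :=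
    (tendsto_pow_atTop_atTop_of_one_lt h1).comp
      (tendsto_id.const_mul_atTop' (by norm_num : 0 < 2))
  filter_upwards [h2.eventually_ge_atTop (1 / c)] with n hn
  rw [div_pow, div_le_div_iff₀ hc (pow_pos hr _)] at hn
  linarith

lemma pow_rpow_one_div {t : ℝ} (ht : 0 ≤ t) {n : ℕ} (hn : n ≠ 0) :
    (t ^ (2 * n)) ^ (1 / (2 * (n : ℝ))) = t := by
  have h := Real.pow_rpow_inv_natCast ht (n := 2 * n) (by lia)
  push_cast at h
  rwa [one_div]

/-- Lower bound: off-diagonal entries tending to `1/2` give growth at every rate `t < 1`, by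
`exists_powR_zero_ge`. Upper bound: a positive supersolution at `ρ` controls every entry of `R ^ n`
by a multiple of `ρ ^ n`. -/
theorem isConvergenceNorm_one {b : ℕ → ℝ} (hr : ∀ p, 0 < jac b p)
    (hlim : Tendsto (jac b) atTop (𝓝 (1 / 2)))
    (hsuper : ∀ ρ : ℝ, 1 < ρ → ∃ w : ℕ → ℝ, (∀ p, 0 < w p) ∧ applyR b w ≤ ρ • w) :
    IsConvergenceNorm b 1 := by
  intro i j hij
  refine tendsto_of_forall_between (fun r hr0 hr1 => ?_) fun r hr1 => ?_
  · set t := (r + 1) / 2 with ht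
    have ht0 : 0 < t := by rw [ht]; linarith
    have ht1 : t < 1 := by rw [ht]; linarith
    have htsq : t ^ 2 < 1 := by nlinarith
    have hlim2 := hlim.pow 2
    -- The midpoint of `1 / 4` and `1 / (4 t ^ 2)`: above the threshold `1/4`, and still with `c * t
    -- ^ 2` below the limit `1/4` of `jac b p ^ 2`.
    have hc : 1 / 4 < (1 / t ^ 2 + 1) / 8 := by
      have : 1 < 1 / t ^ 2 := (one_lt_div (by positivity)).2 htsq
      linarith
    have hc2 : (1 / t ^ 2 + 1) / 8 * t ^ 2 = (1 + t ^ 2) / 8 := by field_simp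
    obtain ⟨d, hd, L, hL⟩ := exists_powR_zero_ge hr ht0 hc (by
      rw [hc2]
      exact hlim2.eventually_const_le (by norm_num; linarith))
    obtain ⟨k, hk⟩ := hij
    set d' := powR b i i 0 * d * powR b j 0 j with hd'
    have hpi := powR_to_zero_pos hr i
    have hpj := powR_from_zero_pos hr j
    have hd'0 : 0 < d' := by positivity
    have hlow : ∀ n, L + k ≤ n → d' * t ^ (2 * n) ≤ powR b (2 * n) i j := by
      intro n hn
      have e0 := hL (n - L - k)
      have e1 := powR_mul_powR_le b i (2 * (n - L - k) + 2 * L) i 0 0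
      have e2 := powR_mul_powR_le b (i + (2 * (n - L - k) + 2 * L)) j i j 0
      rw [show i + (2 * (n - L - k) + 2 * L) + j = 2 * n by lia] at e2
      have e3 : t ^ (2 * n) ≤ t ^ (2 * (n - L - k)) :=
        pow_le_pow_of_le_one ht0.le ht1.le (by lia)
      refine le_trans ?_ ((mul_le_mul_of_nonneg_right e1 hpj.le).trans e2)
      have e4 : d * t ^ (2 * n) ≤ powR b (2 * (n - L - k) + 2 * L) 0 0 :=
        (mul_le_mul_of_nonneg_left e3 hd.le).trans e0
      calc d' * t ^ (2 * n) = powR b i i 0 * (d * t ^ (2 * n)) * powR b j 0 j := by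
            rw [hd']; ring
        _ ≤ _ := mul_le_mul_of_nonneg_right (mul_le_mul_of_nonneg_left e4 hpi.le) hpj.le
    filter_upwards [eventually_pow_le_mul_pow hd'0 hr0 (show r < t by rw [ht]; linarith),
      eventually_ge_atTop (L + k), eventually_gt_atTop 0] with n h1 h2 h3
    calc r = (r ^ (2 * n)) ^ (1 / (2 * (n : ℝ))) := (pow_rpow_one_div hr0.le h3.ne').symm
      _ ≤ _ := Real.rpow_le_rpow (by positivity) (h1.trans (hlow n h2)) (by positivity)
  · set ρ := (r + 1) / 2 with hρ
    have hρ1 : 1 < ρ := by rw [hρ]; linarith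
    obtain ⟨w, hw, hsup⟩ := hsuper ρ hρ1
    have hr0 : 0 ≤ r := by linarith
    have hup : ∀ n, powR b (2 * n) i j ≤ w i / w j * ρ ^ (2 * n) := by
      intro n
      have h1 := powR_mul_le b (fun p => (hw p).le) (2 * n) i j
      have h2 := applyR_iterate_le b (by linarith) hsup (2 * n) i
      rw [Pi.smul_apply, smul_eq_mul] at h2
      rw [div_mul_eq_mul_div, le_div_iff₀ (hw j)]
      linarith
    have hwi := hw i
    have hwj := hw j
    filter_upwards [eventually_pow_le_mul_pow (show 0 < w j / w i by positivity)
      (show 0 < ρ by linarith) (show ρ < r by rw [hρ]; linarith), eventually_gt_atTop 0]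
      with n h1 h2
    calc powR b (2 * n) i j ^ (1 / (2 * (n : ℝ))) ≤ (r ^ (2 * n)) ^ (1 / (2 * (n : ℝ))) := by
          refine Real.rpow_le_rpow (powR_nonneg _ _ _ _) ((hup n).trans ?_) (by positivity)
          rw [div_mul_eq_mul_div, le_div_iff₀ hwi] at h1
          rw [div_mul_eq_mul_div, div_le_iff₀ hwj]
          linarith
      _ = r := pow_rpow_one_div hr0 h2.ne'

/-! ### The minimal solution -/

/-- Iterating `w = (R w + 1_{p = 1}) / ρ` gives the partial sums of the Neumann series and a
remainder, which is nonnegative for positive `w`. -/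
lemma applyR_iterate_expand (b : ℕ → ℝ) {w : ℕ → ℝ} {ρ : ℝ} (hρ : ρ ≠ 0)
    (h : ∀ p, applyR b w p = ρ * w p - if p = 0 then 1 else 0) (n i : ℕ) :
    w i = ∑ k ∈ Finset.range n, powR b k i 0 / ρ ^ (k + 1) + (applyR b)^[n] w i / ρ ^ n := by
  have hfun : ρ • w = applyR b w + Pi.single 0 1 := by
    ext p
    rw [Pi.add_apply, h p, Pi.single_apply]
    simp
  induction n with
  | zero => simp
  | succ n ih =>
    have h1 := congrFun (congrArg (applyR b)^[n] hfun) i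
    rw [applyR_iterate_smul, applyR_iterate_add, ← Function.iterate_succ_apply] at h1
    simp only [Pi.smul_apply, smul_eq_mul, Pi.add_apply] at h1
    rw [Finset.sum_range_succ, powR]
    rw [ih]
    rw [show (applyR b)^[n] w i =
      ((applyR b)^[n.succ] w i + (applyR b)^[n] (Pi.single 0 1) i) / ρ by
        rw [← h1]; field_simp]
    rw [div_div, ← pow_succ']
    simp only [add_assoc]
    congr 1
    rw [add_div, add_comm]

/-- A positive solution which is dominated by a supersolution at a smaller value of the spectral
parameter is the Neumann series. -/
lemma hasSum_powR {b : ℕ → ℝ} {w v : ℕ → ℝ} {ρ ρ' C : ℝ} (hw : w ∈ positiveSolutions b ρ)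
    (hρ' : 0 ≤ ρ') (hC : 0 ≤ C) (hlt : ρ' < ρ) (hv : applyR b v ≤ ρ' • v) (hwv : w ≤ C • v) :
    HasSum (fun n => powR b n 0 0 / ρ ^ (n + 1)) (w 0) := by
  have hρ : 0 < ρ := by linarith
  have hnn : ∀ n, 0 ≤ powR b n 0 0 / ρ ^ (n + 1) := fun n =>
    div_nonneg (powR_nonneg _ _ _ _) (by positivity)
  rw [hasSum_iff_tendsto_nat_of_nonneg hnn]
  have hrem : Tendsto (fun n => (applyR b)^[n] w 0 / ρ ^ n) atTop (𝓝 0) := by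
    have h1 : Tendsto (fun n : ℕ => (ρ' / ρ) ^ n * (C * v 0)) atTop (𝓝 0) := by
      have := (tendsto_pow_atTop_nhds_zero_of_lt_one (div_nonneg hρ' hρ.le)
        ((div_lt_one hρ).2 hlt)).mul_const (C * v 0)
      rwa [zero_mul] at this
    refine squeeze_zero (fun n => ?_) (fun n => ?_) h1
    · have := powR_mul_le b (fun p => (hw.1 p).le) n 0 0
      have h0 := mul_nonneg (powR_nonneg b n 0 0) (hw.1 0).le
      exact div_nonneg (h0.trans this) (by positivity)
    · have h2 := applyR_iterate_mono b hwv n 0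
      rw [applyR_iterate_smul] at h2
      have h3 := mul_le_mul_of_nonneg_left (applyR_iterate_le b hρ' hv n 0) hC
      simp only [Pi.smul_apply, smul_eq_mul] at h2 h3
      rw [div_pow, div_mul_eq_mul_div]
      refine div_le_div_of_nonneg_right ?_ (by positivity)
      linarith
  have h := tendsto_const_nhds (x := w 0) |>.sub hrem
  rw [sub_zero] at h
  refine h.congr fun n => ?_
  have := applyR_iterate_expand b hρ.ne' hw.2 n 0
  linarith

/-- Every positive solution dominates all partial Neumann sums, so a solution equal to their limit
at the first coordinate attains the infimum. -/
lemma minW_eq {b : ℕ → ℝ} {w : ℕ → ℝ} {ρ : ℝ} (hρ : 0 < ρ) (hw : w ∈ positiveSolutions b ρ)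
    (hsum : HasSum (fun n => powR b n 0 0 / ρ ^ (n + 1)) (w 0)) :
    minW b ρ = ENNReal.ofReal (w 0) := by
  refine le_antisymm (iInf₂_le w hw) (le_iInf₂ fun v hv => ENNReal.ofReal_le_ofReal ?_)
  refine le_of_tendsto' hsum.tendsto_sum_nat fun n => ?_
  rw [applyR_iterate_expand b hρ.ne' hv.2 n 0, le_add_iff_nonneg_right]
  have := powR_mul_le b (fun p => (hv.1 p).le) n 0 0
  have h0 := mul_nonneg (powR_nonneg b n 0 0) (hv.1 0).le
  exact div_nonneg (h0.trans this) (by positivity)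

/-! ### Hypergeometric series with positive parameters -/

/-- The coefficients of the hypergeometric series. -/
def hypCoeff (α β γ : ℝ) (n : ℕ) : ℝ := ordinaryHypergeometricCoefficient α β γ n

lemma hypCoeff_zero (α β γ : ℝ) : hypCoeff α β γ 0 = 1 := by
  simp [hypCoeff, ordinaryHypergeometricCoefficient]

lemma hypCoeff_succ (α β γ : ℝ) (n : ℕ) :
    hypCoeff α β γ (n + 1) = hypCoeff α β γ n * ((α + n) * (β + n) / ((γ + n) * (n + 1))) := by
  simp only [hypCoeff, ordinaryHypergeometricCoefficient, ascPochhammer_succ_eval,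
    Nat.factorial_succ, Nat.cast_mul, Nat.cast_add, Nat.cast_one, div_eq_mul_inv, mul_inv]
  ring

lemma hypCoeff_pos {α β γ : ℝ} (hα : 0 < α) (hβ : 0 < β) (hγ : 0 < γ) (n : ℕ) :
    0 < hypCoeff α β γ n := by
  induction n with
  | zero => rw [hypCoeff_zero]; exact one_pos
  | succ n ih => rw [hypCoeff_succ]; positivity

lemma hypCoeff_comm (α β γ : ℝ) (n : ℕ) : hypCoeff α β γ n = hypCoeff β α γ n := by
  simp only [hypCoeff, ordinaryHypergeometricCoefficient]
  ring

lemma hypCoeff_shift_left {α : ℝ} (β γ : ℝ) (hα : 0 < α) (n : ℕ) :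
    hypCoeff (α + 1) β γ n = hypCoeff α β γ n * ((α + n) / α) := by
  induction n with
  | zero => simp [hypCoeff_zero, hα.ne']
  | succ n ih =>
    rw [hypCoeff_succ, hypCoeff_succ, ih]
    push_cast
    have : α + n ≠ 0 := by positivity
    field_simp
    ring

lemma hypCoeff_shift_mid (α : ℝ) {β : ℝ} (γ : ℝ) (hβ : 0 < β) (n : ℕ) :
    hypCoeff α (β + 1) γ n = hypCoeff α β γ n * ((β + n) / β) := by
  rw [hypCoeff_comm, hypCoeff_shift_left _ _ hβ, hypCoeff_comm]

lemma hypCoeff_shift_right (α β : ℝ) {γ : ℝ} (hγ : 0 < γ) (n : ℕ) :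
    hypCoeff α β (γ + 1) n = hypCoeff α β γ n * (γ / (γ + n)) := by
  induction n with
  | zero => simp [hypCoeff_zero, hγ.ne']
  | succ n ih =>
    rw [hypCoeff_succ, hypCoeff_succ, ih]
    push_cast
    have : γ + n ≠ 0 := by positivity
    have : γ + 1 + n ≠ 0 := by positivity
    have : γ + (n + 1) ≠ 0 := by positivity
    field_simp
    ring

lemma hypCoeff_derivative {α β γ : ℝ} (hα : 0 < α) (hβ : 0 < β) (hγ : 0 < γ) (n : ℕ) :
    (n + 1) * hypCoeff α β γ (n + 1) = α * β / γ * hypCoeff (α + 1) (β + 1) (γ + 1) n := by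
  rw [hypCoeff_shift_left _ _ hα, hypCoeff_shift_mid _ _ hβ, hypCoeff_shift_right _ _ hγ,
    hypCoeff_succ]
  have : γ + n ≠ 0 := by positivity
  field_simp

lemma hypCoeff_contiguous {α β γ : ℝ} (hα : 0 < α) (hβ : 0 < β) (hγ : 0 < γ) (n : ℕ) :
    hypCoeff α (β + 1) (γ + 1) (n + 1) - hypCoeff α β γ (n + 1) =
      α * (γ - β) / (γ * (γ + 1)) * hypCoeff (α + 1) (β + 1) (γ + 2) n := by
  rw [show γ + 2 = γ + 1 + 1 by ring, hypCoeff_shift_mid _ _ hβ, hypCoeff_shift_right _ _ hγ,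
    hypCoeff_shift_left _ _ hα, hypCoeff_shift_mid _ _ hβ,
    hypCoeff_shift_right _ _ (by positivity), hypCoeff_shift_right _ _ hγ, hypCoeff_succ]
  push_cast
  have : γ + n ≠ 0 := by positivity
  have : γ + 1 + n ≠ 0 := by positivity
  have : γ + (n + 1) ≠ 0 := by positivity
  field_simp
  ring

/-- Expresses Pochhammer symbols through Euler's approximants `logGammaSeq` of `log Γ`, whose known
limit yields the asymptotics of the coefficients. -/
lemma log_ascPochhammer_eval {x : ℝ} (hx : 0 < x) (n : ℕ) :
    Real.log ((ascPochhammer ℝ (n + 1)).eval x) =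
      x * Real.log n + Real.log (n.factorial) - Real.BohrMollerup.logGammaSeq x n := by
  have h : Real.log ((ascPochhammer ℝ (n + 1)).eval x) =
      ∑ m ∈ Finset.range (n + 1), Real.log (x + m) := by
    induction n + 1 with
    | zero => simp
    | succ k ih =>
      rw [ascPochhammer_succ_eval, Real.log_mul (ascPochhammer_pos k x hx).ne' (by positivity), ih,
        Finset.sum_range_succ]
  rw [h, Real.BohrMollerup.logGammaSeq]
  ring

/-- The constant in the asymptotics of the hypergeometric coefficients. -/
def hypConst (α β γ : ℝ) : ℝ := Real.Gamma γ / (Real.Gamma α * Real.Gamma β)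

lemma hypConst_pos {α β γ : ℝ} (hα : 0 < α) (hβ : 0 < β) (hγ : 0 < γ) : 0 < hypConst α β γ :=
  div_pos (Real.Gamma_pos_of_pos hγ)
    (mul_pos (Real.Gamma_pos_of_pos hα) (Real.Gamma_pos_of_pos hβ))

/-- With the factor `n + 1` and the index shifted by one, the factorials and powers of `n` cancel
exactly, leaving only the `logGammaSeq` terms at `γ`, `α` and `β`. -/
lemma tendsto_hypCoeff_mul_rpow {α β γ : ℝ} (hα : 0 < α) (hβ : 0 < β) (hγ : 0 < γ) :
    Tendsto (fun n : ℕ => (n + 1) * hypCoeff α β γ (n + 1) * (n : ℝ) ^ (γ - α - β)) atTop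
      (𝓝 (hypConst α β γ)) := by
  have hG := ((Real.BohrMollerup.tendsto_log_gamma hγ).sub
    ((Real.BohrMollerup.tendsto_log_gamma hα).add (Real.BohrMollerup.tendsto_log_gamma hβ))).rexp
  have e1 : Real.exp (Real.log (Real.Gamma γ) - (Real.log (Real.Gamma α) +
      Real.log (Real.Gamma β))) = hypConst α β γ := by
    rw [Real.exp_sub, Real.exp_add, Real.exp_log (Real.Gamma_pos_of_pos hγ),
      Real.exp_log (Real.Gamma_pos_of_pos hα), Real.exp_log (Real.Gamma_pos_of_pos hβ), hypConst]
  rw [e1] at hG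
  refine hG.congr' ?_
  filter_upwards [eventually_gt_atTop 0] with n hn
  have hn' : (0 : ℝ) < n := by exact_mod_cast hn
  have hc := hypCoeff_pos hα hβ hγ (n + 1)
  have hpos : 0 < (n + 1) * hypCoeff α β γ (n + 1) * (n : ℝ) ^ (γ - α - β) := by positivity
  rw [← Real.exp_log hpos]
  congr 1
  have hfac : (((n + 1).factorial : ℝ)) ≠ 0 := by positivity
  have hpa := (ascPochhammer_pos (n + 1) α hα).ne'
  have hpb := (ascPochhammer_pos (n + 1) β hβ).ne'
  have hpc := (ascPochhammer_pos (n + 1) γ hγ).ne'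
  have hn1 : (n : ℝ) + 1 ≠ 0 := by positivity
  rw [Real.log_mul (by positivity) (by positivity), Real.log_mul hn1 hc.ne', Real.log_rpow hn',
    hypCoeff, ordinaryHypergeometricCoefficient,
    Real.log_mul (mul_ne_zero (mul_ne_zero (inv_ne_zero hfac) hpa) hpb) (inv_ne_zero hpc),
    Real.log_mul (mul_ne_zero (inv_ne_zero hfac) hpa) hpb, Real.log_mul (inv_ne_zero hfac) hpa,
    Real.log_inv, Real.log_inv, log_ascPochhammer_eval hα, log_ascPochhammer_eval hβ,
    log_ascPochhammer_eval hγ, Nat.factorial_succ, Nat.cast_mul, Nat.cast_add, Nat.cast_one,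
    Real.log_mul hn1 (by positivity)]
  ring

lemma tendsto_hypCoeff_div {α β γ α' β' γ' : ℝ} (hα : 0 < α) (hβ : 0 < β) (hγ : 0 < γ)
    (hα' : 0 < α') (hβ' : 0 < β') (hγ' : 0 < γ') (h : γ - α - β = γ' - α' - β') :
    Tendsto (fun n => hypCoeff α β γ n / hypCoeff α' β' γ' n) atTop
      (𝓝 (hypConst α β γ / hypConst α' β' γ')) := by
  rw [← tendsto_add_atTop_iff_nat 1]
  refine ((tendsto_hypCoeff_mul_rpow hα hβ hγ).div (tendsto_hypCoeff_mul_rpow hα' hβ' hγ')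
    (hypConst_pos hα' hβ' hγ').ne').congr' ?_
  filter_upwards [eventually_gt_atTop 0] with n hn
  have hn' : (0 : ℝ) < n := by exact_mod_cast hn
  rw [Pi.div_apply, h, mul_div_mul_right _ _ (Real.rpow_pos_of_pos hn' _).ne',
    mul_div_mul_left _ _ (by positivity)]

lemma tendsto_mul_hypCoeff_zero {α β γ : ℝ} (hα : 0 < α) (hβ : 0 < β) (hγ : 0 < γ)
    (h : 0 < γ - α - β) :
    Tendsto (fun n : ℕ => (n + 1) * hypCoeff α β γ (n + 1)) atTop (𝓝 0) := by
  have h1 := (tendsto_hypCoeff_mul_rpow hα hβ hγ).mul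
    ((tendsto_rpow_neg_atTop h).comp tendsto_natCast_atTop_atTop)
  rw [mul_zero] at h1
  refine h1.congr' ?_
  filter_upwards [eventually_gt_atTop 0] with n hn
  have hn' : (0 : ℝ) < n := by exact_mod_cast hn
  rw [Function.comp_apply, mul_assoc, ← Real.rpow_add hn', add_neg_cancel, Real.rpow_zero, mul_one]

lemma summable_hypCoeff {α β γ : ℝ} (hα : 0 < α) (hβ : 0 < β) (hγ : 0 < γ)
    (h : 0 < γ - α - β) : Summable (hypCoeff α β γ) := by
  rw [← summable_nat_add_iff 1]
  obtain ⟨C, hC⟩ := (tendsto_hypCoeff_mul_rpow hα hβ hγ).bddAbove_range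
  have hsum : Summable fun n : ℕ => C * (1 / (n : ℝ) ^ (1 + (γ - α - β))) :=
    (Real.summable_one_div_nat_rpow.2 (by linarith)).mul_left C
  refine Summable.of_norm_bounded_eventually_nat hsum ?_
  filter_upwards [eventually_gt_atTop 0] with n hn
  have hn' : (0 : ℝ) < n := by exact_mod_cast hn
  have hc := hypCoeff_pos hα hβ hγ (n + 1)
  have h1 : (n + 1) * hypCoeff α β γ (n + 1) * (n : ℝ) ^ (γ - α - β) ≤ C := hC ⟨n, rfl⟩
  rw [Real.norm_of_nonneg hc.le, mul_one_div, le_div_iff₀ (by positivity),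
    Real.rpow_add hn', Real.rpow_one]
  have h2 : 0 < (n : ℝ) ^ (γ - α - β) := by positivity
  nlinarith [mul_pos hc h2]

lemma summable_hypCoeff_mul_pow {α β γ x : ℝ} (hα : 0 < α) (hβ : 0 < β) (hγ : 0 < γ)
    (hx : |x| < 1) : Summable fun n => hypCoeff α β γ n * x ^ n := by
  have hr := ordinaryHypergeometricSeries_radius_eq_one ℝ α β γ (fun k => by
    have : (0 : ℝ) ≤ k := Nat.cast_nonneg k
    refine ⟨?_, ?_, ?_⟩ <;> linarith)
  have h := (ordinaryHypergeometricSeries ℝ α β γ).summable (x := x) (by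
    rw [hr, Metric.mem_eball, edist_zero_right, ← ofReal_norm, ENNReal.ofReal_lt_one]
    exact hx)
  refine h.congr fun n => ?_
  rw [ordinaryHypergeometricSeries_apply_eq]
  rfl

lemma hasSum_hyp {α β γ x : ℝ} (hα : 0 < α) (hβ : 0 < β) (hγ : 0 < γ)
    (hx : |x| < 1) : HasSum (fun n => hypCoeff α β γ n * x ^ n) (₂F₁ α β γ x) := by
  rw [ordinaryHypergeometric_eq_tsum]
  exact (summable_hypCoeff_mul_pow hα hβ hγ hx).hasSum

lemma hasDerivAt_hyp {α β γ x : ℝ} (hα : 0 < α) (hβ : 0 < β) (hγ : 0 < γ)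
    (hx : |x| < 1) :
    HasDerivAt (₂F₁ α β γ) (α * β / γ * ₂F₁ (α + 1) (β + 1) (γ + 1) x) x := by
  obtain ⟨r, hxr, hr1⟩ := exists_between hx
  have hr0 : 0 ≤ r := (abs_nonneg x).trans hxr.le
  have hα' : 0 < α + 1 := by linarith
  have hβ' : 0 < β + 1 := by linarith
  have hγ' : 0 < γ + 1 := by linarith
  have hs := summable_hypCoeff_mul_pow hα' hβ' hγ' (x := r) (by rwa [abs_of_nonneg hr0])
  have hsu : Summable fun n : ℕ => hypCoeff α β γ n * (n * r ^ (n - 1)) := by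
    rw [← summable_nat_add_iff 1]
    refine (hs.mul_left (α * β / γ)).congr fun n => ?_
    have := hypCoeff_derivative hα hβ hγ n
    rw [← mul_assoc, ← this, Nat.add_sub_cancel]
    push_cast
    ring
  have hder := hasDerivAt_tsum_of_isPreconnected (𝕜 := ℝ) (F := ℝ)
    (g := fun n y => hypCoeff α β γ n * y ^ n)
    (g' := fun n y => hypCoeff α β γ n * (n * y ^ (n - 1))) (t := Set.Ioo (-r) r) (y₀ := x) (y := x)
    hsu isOpen_Ioo isPreconnected_Ioo (fun n y _ => (hasDerivAt_pow n y).const_mul _)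
    (fun n y hy => by
      have hc := hypCoeff_pos hα hβ hγ n
      have hy' : |y| ≤ r := (abs_lt.2 hy).le
      rw [norm_mul, norm_mul, norm_pow, Real.norm_of_nonneg hc.le, Real.norm_natCast,
        Real.norm_eq_abs]
      gcongr) (abs_lt.1 hxr) (summable_hypCoeff_mul_pow hα hβ hγ hx) (abs_lt.1 hxr)
  have e1 : (fun z : ℝ => ∑' n, hypCoeff α β γ n * z ^ n) = ₂F₁ α β γ := by
    rw [ordinaryHypergeometric_eq_tsum]
    rfl
  have hsum' : Summable fun n : ℕ => hypCoeff α β γ n * (n * x ^ (n - 1)) := by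
    refine Summable.of_norm_bounded hsu fun n => ?_
    have hc := hypCoeff_pos hα hβ hγ n
    rw [norm_mul, norm_mul, norm_pow, Real.norm_of_nonneg hc.le, Real.norm_natCast,
      Real.norm_eq_abs]
    gcongr
  have e2 : ∑' n : ℕ, hypCoeff α β γ n * (n * x ^ (n - 1)) =
      α * β / γ * ₂F₁ (α + 1) (β + 1) (γ + 1) x := by
    rw [hsum'.tsum_eq_zero_add, ← (hasSum_hyp hα' hβ' hγ' hx).tsum_eq, ← tsum_mul_left]
    simp only [Nat.cast_zero, zero_mul, mul_zero, zero_add]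
    refine tsum_congr fun n => ?_
    have := hypCoeff_derivative hα hβ hγ n
    rw [← mul_assoc (α * β / γ), ← this, Nat.add_sub_cancel]
    push_cast
    ring
  rwa [e1, e2] at hder

lemma hyp_contiguous {α β γ x : ℝ} (hα : 0 < α) (hβ : 0 < β) (hγ : 0 < γ) (hx : |x| < 1) :
    ₂F₁ α (β + 1) (γ + 1) x - ₂F₁ α β γ x =
      α * (γ - β) / (γ * (γ + 1)) * (x * ₂F₁ (α + 1) (β + 1) (γ + 2) x) := by
  have h1 := (hasSum_hyp hα (by linarith : 0 < β + 1) (by linarith : 0 < γ + 1) hx).sub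
    (hasSum_hyp hα hβ hγ hx)
  have h2 := ((hasSum_hyp (by linarith : 0 < α + 1) (by linarith : 0 < β + 1)
    (by linarith : 0 < γ + 2) hx).mul_left x).mul_left (α * (γ - β) / (γ * (γ + 1)))
  have h3 := (hasSum_nat_add_iff' 1).2 h1
  simp only [Finset.sum_range_one, hypCoeff_zero, pow_zero, sub_self, sub_zero] at h3
  refine h3.unique ?_
  refine h2.congr_fun fun n => ?_
  rw [← sub_mul, hypCoeff_contiguous hα hβ hγ]
  ring

lemma one_le_hyp {α β γ x : ℝ} (hα : 0 < α) (hβ : 0 < β) (hγ : 0 < γ) (hx0 : 0 ≤ x) (hx : x < 1) :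
    1 ≤ ₂F₁ α β γ x := by
  have h := le_hasSum (hasSum_hyp hα hβ hγ (x := x) (by rwa [abs_of_nonneg hx0])) 0
    (fun n _ => mul_nonneg (hypCoeff_pos hα hβ hγ n).le (pow_nonneg hx0 n))
  simpa [hypCoeff_zero] using h

lemma hyp_mono {α β γ x y : ℝ} (hα : 0 < α) (hβ : 0 < β) (hγ : 0 < γ) (hx0 : 0 ≤ x)
    (hxy : x ≤ y) (hy : y < 1) : ₂F₁ α β γ x ≤ ₂F₁ α β γ y := by
  refine hasSum_le (fun n => ?_)
    (hasSum_hyp hα hβ hγ (x := x) (by rw [abs_of_nonneg hx0]; linarith))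
    (hasSum_hyp hα hβ hγ (x := y) (by rw [abs_of_nonneg (hx0.trans hxy)]; linarith))
  exact mul_le_mul_of_nonneg_left (pow_le_pow_left₀ hx0 hxy n) (hypCoeff_pos hα hβ hγ n).le

/-- The binomial series, written as a hypergeometric series with two cancelling parameters so that
it can serve as the comparison series in `tendsto_powerSeries_div`. -/
lemma hasSum_one_sub_rpow {η x : ℝ} (hx0 : 0 ≤ x) (hx : x < 1) :
    HasSum (fun n => hypCoeff η 1 1 n * x ^ n) ((1 - x) ^ (-η)) := by
  have h := (Real.one_add_rpow_hasFPowerSeriesOnBall_zero (a := -η)).hasSum (y := -x) (by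
    rw [Metric.mem_eball, edist_zero_right, enorm_neg, ← ofReal_norm,
      ENNReal.ofReal_lt_one, Real.norm_of_nonneg hx0]
    exact hx)
  rw [binomialSeries_eq_ordinaryHypergeometricSeries (b := (1 : ℝ))
    (fun k => by have : (0 : ℝ) ≤ k := Nat.cast_nonneg k; linarith), neg_neg, zero_add,
    ← sub_eq_add_neg] at h
  refine h.congr_fun fun n => ?_
  have h1 := ordinaryHypergeometricSeries_apply_eq η 1 1 x n
  rw [smul_eq_mul] at h1
  rw [hypCoeff, ordinaryHypergeometricCoefficient, ← h1]
  rw [FormalMultilinearSeries.compContinuousLinearMap_apply]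
  congr 1
  funext i
  simp

/-- The value of the hypergeometric function at the boundary point `1`. -/
lemma tendsto_hyp_one {α β γ : ℝ} (hα : 0 < α) (hβ : 0 < β) (hγ : 0 < γ)
    (h : 0 < γ - α - β) :
    Tendsto (₂F₁ α β γ : ℝ → ℝ) (𝓝[<] 1) (𝓝 (∑' n, hypCoeff α β γ n)) := by
  have hs := (summable_hypCoeff hα hβ hγ h).hasSum.tendsto_sum_nat
  have := Real.tendsto_tsum_powerSeries_nhdsWithin_lt hs
  rw [ordinaryHypergeometric_eq_tsum]
  exact this

/-- The relation between the values at `1` of the hypergeometric function and its derivative. -/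
lemma tsum_hypCoeff_derivative {α β γ : ℝ} (hα : 0 < α) (hβ : 0 < β) (hγ : 0 < γ)
    (h : 1 < γ - α - β) :
    (γ - α - β - 1) * (α * β / γ * ∑' n, hypCoeff (α + 1) (β + 1) (γ + 1) n) =
      α * β * ∑' n, hypCoeff α β γ n := by
  have hα' : 0 < α + 1 := by linarith
  have hβ' : 0 < β + 1 := by linarith
  have hγ' : 0 < γ + 1 := by linarith
  have hs := (summable_hypCoeff hα hβ hγ (by linarith)).hasSum
  have hs' := (summable_hypCoeff hα' hβ' hγ' (by linarith)).hasSum.mul_left (α * β / γ)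
  have h1 : HasSum (fun n : ℕ => (n : ℝ) * hypCoeff α β γ n)
      (α * β / γ * ∑' n, hypCoeff (α + 1) (β + 1) (γ + 1) n) := by
    rw [← hasSum_nat_add_iff' 1]
    simp only [Finset.sum_range_one, Nat.cast_zero, zero_mul, sub_zero]
    refine hs'.congr_fun fun n => ?_
    rw [← hypCoeff_derivative hα hβ hγ]
    push_cast
    ring
  have h2 := (hs.mul_left (α * β)).sub (h1.mul_left (γ - α - β - 1))
  -- The coefficient recursion makes this combination telescope. The boundary term is of order `N ^
  -- (1 - (γ - α - β))`, so it vanishes in the limit precisely because `γ - α - β > 1`.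
  have htel : ∀ N : ℕ, ∑ n ∈ Finset.range N, (α * β * hypCoeff α β γ n -
      (γ - α - β - 1) * (n * hypCoeff α β γ n)) = N * (N - 1 + γ) * hypCoeff α β γ N := by
    intro N
    induction N with
    | zero => simp
    | succ N ih =>
      rw [Finset.sum_range_succ, ih, hypCoeff_succ]
      push_cast
      have : γ + N ≠ 0 := by positivity
      field_simp
      ring
  have h3 := h2.tendsto_sum_nat
  simp only [htel] at h3
  have h4 : Tendsto (fun N : ℕ => (N : ℝ) * (N - 1 + γ) * hypCoeff α β γ N) atTop (𝓝 0) := by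
    rw [← tendsto_add_atTop_iff_nat 2]
    have ha := (tendsto_mul_hypCoeff_zero hα' hβ' hγ' (by linarith)).const_mul (α * β / γ)
    have hb : Tendsto (fun n : ℕ => ((n : ℝ) + 1 + γ) / (n + 1)) atTop (𝓝 1) := by
      have : Tendsto (fun n : ℕ => 1 + γ / ((n : ℝ) + 1)) atTop (𝓝 (1 + 0)) := by
        refine tendsto_const_nhds.add (Tendsto.const_div_atTop ?_ γ)
        exact tendsto_atTop_add_const_right _ _ tendsto_natCast_atTop_atTop
      rw [add_zero] at this
      refine this.congr fun n => ?_
      have : (n : ℝ) + 1 ≠ 0 := by positivity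
      field_simp
    have hc := ha.mul hb
    rw [mul_zero, zero_mul] at hc
    refine hc.congr fun n => ?_
    have hd := hypCoeff_derivative hα hβ hγ (n + 1)
    push_cast at hd ⊢
    have : (n : ℝ) + 1 ≠ 0 := by positivity
    rw [show α * β / γ * ((n + 1) * hypCoeff (α + 1) (β + 1) (γ + 1) (n + 1)) =
      (n + 1) * (α * β / γ * hypCoeff (α + 1) (β + 1) (γ + 1) (n + 1)) by ring, ← hd]
    field_simp
    ring
  have h5 := tendsto_nhds_unique h3 h4
  linarith

/-! ### The hypergeometric model -/

lemma hyperB_zero (a s b₀ : ℝ) : hyperB a s b₀ 0 = b₀ := by simp [hyperB]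

lemma hyperB_succ (a s b₀ : ℝ) (n : ℕ) : hyperB a s b₀ (n + 1) =
    (2 * a + s - 1 + n) * Real.Gamma (a + n / 2) * Real.Gamma (a + s - 1 / 2 + n / 2) /
      (2 * Real.Gamma (a + 1 / 2 + n / 2) * Real.Gamma (a + s + n / 2)) := by
  rw [hyperB, if_neg (by lia)]
  push_cast
  rw [show s + ((n : ℝ) + 1) - 2 + 2 * a = 2 * a + s - 1 + n by ring,
    show a + ((n : ℝ) + 1) / 2 - 1 / 2 = a + n / 2 by ring,
    show s + a + ((n : ℝ) + 1) / 2 - 1 = a + s - 1 / 2 + n / 2 by ring,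
    show a + ((n : ℝ) + 1) / 2 = a + 1 / 2 + n / 2 by ring,
    show s + a + ((n : ℝ) + 1) / 2 - 1 / 2 = a + s + n / 2 by ring]

/-- The squares of the off-diagonal entries of `R`, for the hypergeometric model. -/
def jacSq (a s : ℝ) (p : ℕ) : ℝ :=
  (a + p / 2) * (a + s - 1 / 2 + p / 2) / ((2 * a + s - 1 + p) * (2 * a + s - 1 + p + 1))

variable {a s b₀ : ℝ}

lemma hyperB_succ_pos (ha : 1 / 2 < a) (hs : 1 / 2 ≤ s) (n : ℕ) : 0 < hyperB a s b₀ (n + 1) := by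
  have hn : (0 : ℝ) ≤ n := Nat.cast_nonneg n
  rw [hyperB_succ]
  have h1 := Real.Gamma_pos_of_pos (show 0 < a + n / 2 by linarith)
  have h2 := Real.Gamma_pos_of_pos (show 0 < a + s - 1 / 2 + n / 2 by linarith)
  have h3 := Real.Gamma_pos_of_pos (show 0 < a + 1 / 2 + n / 2 by linarith)
  have h4 := Real.Gamma_pos_of_pos (show 0 < a + s + n / 2 by linarith)
  have h5 : 0 < 2 * a + s - 1 + n := by linarith
  positivity

lemma hyperB_pos (ha : 1 / 2 < a) (hs : 1 / 2 ≤ s) (hb₀ : 0 < b₀) : ∀ n, 0 < hyperB a s b₀ n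
  | 0 => by rwa [hyperB_zero]
  | n + 1 => hyperB_succ_pos ha hs n

lemma jacSq_pos (ha : 1 / 2 < a) (hs : 1 / 2 ≤ s) (p : ℕ) : 0 < jacSq a s p := by
  have hp : (0 : ℝ) ≤ p := Nat.cast_nonneg p
  have h1 : 0 < a + p / 2 := by linarith
  have h2 : 0 < a + s - 1 / 2 + p / 2 := by linarith
  have h3 : 0 < 2 * a + s - 1 + p := by linarith
  unfold jacSq
  positivity

/-- Passing to the next site advances the Gamma arguments by `1/2`, so numerators and denominators
of neighbours cancel up to `Γ(x + 1) = x Γ(x)`. Hence `R` has rational squared entries. -/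
lemma hyperB_mul_hyperB (ha : 1 / 2 < a) (hs : 1 / 2 ≤ s) (p : ℕ) :
    hyperB a s b₀ (p + 1) * hyperB a s b₀ (p + 2) = 1 / (4 * jacSq a s p) := by
  have hn : (0 : ℝ) ≤ p := Nat.cast_nonneg p
  have p1 : 0 < a + (p : ℝ) / 2 := by linarith
  have p2 : 0 < a + s - 1 / 2 + (p : ℝ) / 2 := by linarith
  have p5 : 0 < 2 * a + s - 1 + (p : ℝ) := by linarith
  have h1 := (Real.Gamma_pos_of_pos p1).ne'
  have h2 := (Real.Gamma_pos_of_pos p2).ne'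
  have h3 := (Real.Gamma_pos_of_pos (show 0 < a + 1 / 2 + (p : ℝ) / 2 by linarith)).ne'
  have h4 := (Real.Gamma_pos_of_pos (show 0 < a + s + (p : ℝ) / 2 by linarith)).ne'
  rw [hyperB_succ, hyperB_succ, jacSq]
  push_cast
  rw [show a + ((p : ℝ) + 1) / 2 = a + 1 / 2 + p / 2 by ring,
    show a + s - 1 / 2 + ((p : ℝ) + 1) / 2 = a + s + p / 2 by ring,
    show a + 1 / 2 + ((p : ℝ) + 1) / 2 = a + p / 2 + 1 by ring,
    show a + s + ((p : ℝ) + 1) / 2 = a + s - 1 / 2 + p / 2 + 1 by ring,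
    Real.Gamma_add_one p1.ne', Real.Gamma_add_one p2.ne']
  generalize hA : Real.Gamma (a + (p : ℝ) / 2) = A at *
  generalize hB : Real.Gamma (a + s - 1 / 2 + (p : ℝ) / 2) = B at *
  generalize hC : Real.Gamma (a + 1 / 2 + (p : ℝ) / 2) = C at *
  generalize hD : Real.Gamma (a + s + (p : ℝ) / 2) = D at *
  generalize a + (p : ℝ) / 2 = X at *
  generalize a + s - 1 / 2 + (p : ℝ) / 2 = Y at *
  rw [show 2 * a + s - 1 + ((p : ℝ) + 1) = 2 * a + s - 1 + p + 1 by ring]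
  generalize 2 * a + s - 1 + (p : ℝ) = Z at *
  have hX := p1.ne'
  have hY := p2.ne'
  have hZ := p5.ne'
  have hZ' : Z + 1 ≠ 0 := by positivity
  field_simp
  norm_num

lemma jac_hyperB_sq (ha : 1 / 2 < a) (hs : 1 / 2 ≤ s) (p : ℕ) :
    jac (hyperB a s b₀) p ^ 2 = jacSq a s p := by
  have h := jacSq_pos ha hs p
  rw [jac, hyperB_mul_hyperB ha hs, div_pow, mul_pow, Real.sq_sqrt (by positivity)]
  field_simp
  norm_num

lemma jac_hyperB_pos (ha : 1 / 2 < a) (hs : 1 / 2 ≤ s) (p : ℕ) :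
    0 < jac (hyperB a s b₀) p := by
  have h : 0 < √(hyperB a s b₀ (p + 1) * hyperB a s b₀ (p + 2)) :=
    Real.sqrt_pos.2 (mul_pos (hyperB_succ_pos ha hs _) (hyperB_succ_pos ha hs _))
  unfold jac
  positivity

lemma tendsto_add_natCast_div (x y : ℝ) :
    Tendsto (fun n : ℕ => (x + n) / (y + n)) atTop (𝓝 1) := by
  have := tendsto_add_mul_div_add_mul_atTop_nhds x y (1 : ℝ) (one_ne_zero (α := ℝ))
  simpa using this

lemma tendsto_jac_hyperB (ha : 1 / 2 < a) (hs : 1 / 2 ≤ s) :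
    Tendsto (jac (hyperB a s b₀)) atTop (𝓝 (1 / 2)) := by
  have h1 := ((tendsto_add_natCast_div (2 * a) (2 * a + s - 1)).mul
    (tendsto_add_natCast_div (2 * a + 2 * s - 1) (2 * a + s))).mul_const (1 / 4)
  have h2 := h1.sqrt
  have e : √(1 * 1 * (1 / 4) : ℝ) = 1 / 2 := by
    rw [show (1 * 1 * (1 / 4) : ℝ) = (1 / 2) ^ 2 by norm_num, Real.sqrt_sq (by norm_num)]
  rw [e] at h2
  refine h2.congr fun p => ?_
  rw [← Real.sqrt_sq (jac_hyperB_pos (b₀ := b₀) ha hs p).le, jac_hyperB_sq ha hs, jacSq]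
  congr 1
  have hp : (0 : ℝ) ≤ p := Nat.cast_nonneg p
  have h3 : 2 * a + s - 1 + p ≠ 0 := by linarith
  have h4 : 2 * a + s + p ≠ 0 := by linarith
  have h5 : 2 * a + s - 1 + p + 1 ≠ 0 := by linarith
  field_simp
  ring

/-- Logarithmic convexity of `Γ` at the midpoint of `x` and `x + 1`. -/
lemma Gamma_add_half_le {x : ℝ} (hx : 0 < x) : Real.Gamma (x + 1 / 2) ≤ Real.Gamma x * √x := by
  have h := Real.Gamma_mul_add_mul_le_rpow_Gamma_mul_rpow_Gamma hx
    (by linarith : 0 < x + 1) (by norm_num : (0 : ℝ) < 1 / 2) (by norm_num : (0 : ℝ) < 1 / 2)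
    (by norm_num)
  have hG := Real.Gamma_pos_of_pos hx
  rw [show 1 / 2 * x + 1 / 2 * (x + 1) = x + 1 / 2 by ring, Real.Gamma_add_one hx.ne',
    Real.mul_rpow hx.le hG.le, mul_left_comm, ← Real.rpow_add hG, ← Real.sqrt_eq_rpow] at h
  norm_num at h
  norm_num
  linarith

/-- Apply `Gamma_add_half_le` to both Gamma quotients and bound `√x * √y` by `(x + y) / 2`. The
lower bound tends to `1`, which is all that the free boundary condition requires. -/
lemma le_hyperB_succ (ha : 1 / 2 < a) (hs : 1 / 2 ≤ s) (n : ℕ) :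
    (2 * a + s - 1 + n) / (2 * a + s - 1 / 2 + n) ≤ hyperB a s b₀ (n + 1) := by
  have hn : (0 : ℝ) ≤ n := Nat.cast_nonneg n
  have p1 : 0 < a + (n : ℝ) / 2 := by linarith
  have p2 : 0 < a + s - 1 / 2 + (n : ℝ) / 2 := by linarith
  have p5 : 0 < 2 * a + s - 1 + (n : ℝ) := by linarith
  have h1 := Real.Gamma_pos_of_pos p1
  have h2 := Real.Gamma_pos_of_pos p2
  have h3 := Gamma_add_half_le p1
  have h4 := Gamma_add_half_le p2
  have h5 := Real.Gamma_pos_of_pos (show 0 < a + (n : ℝ) / 2 + 1 / 2 by linarith)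
  have h6 := Real.Gamma_pos_of_pos (show 0 < a + s - 1 / 2 + (n : ℝ) / 2 + 1 / 2 by linarith)
  have h7 : √(a + (n : ℝ) / 2) * √(a + s - 1 / 2 + (n : ℝ) / 2) ≤ (2 * a + s - 1 / 2 + n) / 2 := by
    have := Real.sq_sqrt p1.le
    have := Real.sq_sqrt p2.le
    nlinarith [sq_nonneg (√(a + (n : ℝ) / 2) - √(a + s - 1 / 2 + (n : ℝ) / 2))]
  rw [hyperB_succ, show a + 1 / 2 + (n : ℝ) / 2 = a + n / 2 + 1 / 2 by ring,
    show a + s + (n : ℝ) / 2 = a + s - 1 / 2 + n / 2 + 1 / 2 by ring,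
    div_le_div_iff₀ (by linarith) (by positivity)]
  generalize Real.Gamma (a + (n : ℝ) / 2) = A at *
  generalize Real.Gamma (a + s - 1 / 2 + (n : ℝ) / 2) = B at *
  generalize Real.Gamma (a + (n : ℝ) / 2 + 1 / 2) = C at *
  generalize Real.Gamma (a + s - 1 / 2 + (n : ℝ) / 2 + 1 / 2) = D at *
  have h8 : C * D ≤ A * B * ((2 * a + s - 1 / 2 + n) / 2) := by
    calc C * D ≤ (A * √(a + (n : ℝ) / 2)) * (B * √(a + s - 1 / 2 + (n : ℝ) / 2)) :=
          mul_le_mul h3 h4 h6.le (by positivity)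
      _ = A * B * (√(a + (n : ℝ) / 2) * √(a + s - 1 / 2 + (n : ℝ) / 2)) := by ring
      _ ≤ _ := mul_le_mul_of_nonneg_left h7 (by positivity)
  nlinarith [mul_le_mul_of_nonneg_left h8 p5.le]

lemma eventually_inv_hyperB_le (ha : 1 / 2 < a) (hs : 1 / 2 ≤ s) {r : ℝ} (hr : 1 < r) :
    ∀ᶠ n : ℕ in atTop, 1 / hyperB a s b₀ (n + 1) ≤ r := by
  have h := tendsto_add_natCast_div (2 * a + s - 1 / 2) (2 * a + s - 1)
  filter_upwards [h.eventually_le_const hr] with n hn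
  refine le_trans ?_ hn
  have hn : (0 : ℝ) ≤ n := Nat.cast_nonneg n
  have p1 : 0 < 2 * a + s - 1 + (n : ℝ) := by linarith
  have p2 : 0 < 2 * a + s - 1 / 2 + (n : ℝ) := by linarith
  rw [← one_div_div (2 * a + s - 1 + (n : ℝ))]
  exact one_div_le_one_div_of_le (by positivity) (le_hyperB_succ ha hs n)

/-! ### The minimal solution for the hypergeometric model -/

/-- The hypergeometric functions of the model. -/
def hypU (a s : ℝ) (p : ℕ) : ℝ → ℝ := ₂F₁ (a - 1 / 2 + p / 2) (a + p / 2) (2 * a + s - 1 + p)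

lemma hyp_comm (α β γ : ℝ) : (₂F₁ α β γ : ℝ → ℝ) = ₂F₁ β α γ := by
  unfold ordinaryHypergeometric
  rw [ordinaryHypergeometricSeries_symm]

lemma one_le_hypU (ha : 1 / 2 < a) (hs : 1 / 2 ≤ s) (p : ℕ) {z : ℝ} (hz0 : 0 ≤ z) (hz : z < 1) :
    1 ≤ hypU a s p z := by
  have hp : (0 : ℝ) ≤ p := Nat.cast_nonneg p
  exact one_le_hyp (by linarith) (by linarith) (by linarith) hz0 hz

lemma hypU_pos (ha : 1 / 2 < a) (hs : 1 / 2 ≤ s) (p : ℕ) {z : ℝ} (hz0 : 0 ≤ z) (hz : z < 1) :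
    0 < hypU a s p z := one_pos.trans_le (one_le_hypU ha hs p hz0 hz)

lemma hypU_mono (ha : 1 / 2 < a) (hs : 1 / 2 ≤ s) (p : ℕ) {x y : ℝ} (hx0 : 0 ≤ x) (hxy : x ≤ y)
    (hy : y < 1) : hypU a s p x ≤ hypU a s p y := by
  have hp : (0 : ℝ) ≤ p := Nat.cast_nonneg p
  exact hyp_mono (by linarith) (by linarith) (by linarith) hx0 hxy hy

/-- Raising `p` by one swaps the two upper parameters and raises one of them, and the lower one, by
`1`; thus three consecutive functions are contiguous, with coefficient `jacSq a s p`. -/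
lemma hypU_rec (ha : 1 / 2 < a) (hs : 1 / 2 ≤ s) (p : ℕ) {z : ℝ} (hz0 : 0 ≤ z) (hz : z < 1) :
    hypU a s (p + 1) z = hypU a s p z + jacSq a s p * (z * hypU a s (p + 2) z) := by
  have hp : (0 : ℝ) ≤ p := Nat.cast_nonneg p
  have h := hyp_contiguous (α := a + p / 2) (β := a - 1 / 2 + p / 2) (γ := 2 * a + s - 1 + p)
    (by linarith) (by linarith) (by linarith) (x := z) (by rwa [abs_of_nonneg hz0])
  rw [hyp_comm (a + p / 2) (a - 1 / 2 + p / 2), hyp_comm (a + p / 2 + 1)] at h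
  unfold hypU jacSq
  push_cast
  rw [show a - 1 / 2 + ((p : ℝ) + 1) / 2 = a + p / 2 by ring,
    show a + ((p : ℝ) + 1) / 2 = a - 1 / 2 + p / 2 + 1 by ring,
    show 2 * a + s - 1 + ((p : ℝ) + 1) = 2 * a + s - 1 + p + 1 by ring,
    show a - 1 / 2 + ((p : ℝ) + 2) / 2 = a - 1 / 2 + p / 2 + 1 by ring,
    show a + ((p : ℝ) + 2) / 2 = a + p / 2 + 1 by ring,
    show 2 * a + s - 1 + ((p : ℝ) + 2) = 2 * a + s - 1 + p + 2 by ring,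
    show a + s - 1 / 2 + (p : ℝ) / 2 = 2 * a + s - 1 + p - (a - 1 / 2 + p / 2) by ring]
  linarith

/-- The minimal solution of `R w = t⁻¹ w - 1_{p = 1}`. -/
def minSol (a s b₀ t : ℝ) (p : ℕ) : ℝ :=
  (∏ i ∈ Finset.range p, jac (hyperB a s b₀) i) * t ^ (p + 1) * hypU a s (p + 1) (t ^ 2) /
    hypU a s 0 (t ^ 2)

lemma minSol_pos (ha : 1 / 2 < a) (hs : 1 / 2 ≤ s) {t : ℝ} (ht0 : 0 < t) (ht : t < 1) (p : ℕ) :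
    0 < minSol a s b₀ t p := by
  have h1 : t ^ 2 < 1 := by nlinarith
  have h2 := hypU_pos ha hs (p + 1) (sq_nonneg t) h1
  have h3 := hypU_pos ha hs 0 (sq_nonneg t) h1
  have h4 : 0 < ∏ i ∈ Finset.range p, jac (hyperB a s b₀) i :=
    Finset.prod_pos fun i _ => jac_hyperB_pos ha hs i
  unfold minSol
  positivity

/-- The recursion `hypU_rec` at `p + 1` is the eigenvalue equation at an interior coordinate. At the
first coordinate the term `hypU a s 0` has no counterpart, and the normalisation by it makes the
defect exactly `1`. -/
lemma minSol_mem (ha : 1 / 2 < a) (hs : 1 / 2 ≤ s) {t : ℝ} (ht0 : 0 < t) (ht : t < 1) :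
    minSol a s b₀ t ∈ positiveSolutions (hyperB a s b₀) t⁻¹ := by
  refine ⟨minSol_pos ha hs ht0 ht, fun p => ?_⟩
  have h1 : t ^ 2 < 1 := by nlinarith
  have h3 := (hypU_pos ha hs 0 (sq_nonneg t) h1).ne'
  cases p with
  | zero =>
    have h := hypU_rec ha hs 0 (sq_nonneg t) h1
    have hj := jac_hyperB_sq (b₀ := b₀) ha hs 0
    rw [applyR_zero]
    simp only [minSol, Finset.prod_range_zero, Finset.prod_range_one, if_true, zero_add] at h ⊢
    field_simp
    rw [h, ← hj]
    ring
  | succ p =>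
    have h := hypU_rec ha hs (p + 1) (sq_nonneg t) h1
    have hj := jac_hyperB_sq (b₀ := b₀) ha hs (p + 1)
    rw [applyR_succ]
    simp only [minSol, Finset.prod_range_succ, Nat.add_eq_zero_iff, one_ne_zero, and_false, if_false]
    field_simp
    rw [show p + 1 + 1 = p + 2 by ring] at *
    rw [h, ← hj]
    ring

/-- Supplies the domination in `hasSum_powR`: the solution at `t'` is a supersolution for the
smaller spectral parameter `t'⁻¹` when `t < t'`. -/
lemma minSol_le (ha : 1 / 2 < a) (hs : 1 / 2 ≤ s) {t t' : ℝ} (ht0 : 0 < t) (htt : t ≤ t')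
    (ht : t' < 1) :
    minSol a s b₀ t ≤ (hypU a s 0 (t' ^ 2) / hypU a s 0 (t ^ 2)) • minSol a s b₀ t' := by
  intro p
  have ht0' : 0 < t' := ht0.trans_le htt
  have h1 : t' ^ 2 < 1 := by nlinarith
  have h0 : t ^ 2 ≤ t' ^ 2 := by nlinarith
  have h2 := hypU_mono ha hs (p + 1) (sq_nonneg t) h0 h1
  have h5 := hypU_pos ha hs (p + 1) (sq_nonneg t) (h0.trans_lt h1)
  have h3 := hypU_pos ha hs 0 (sq_nonneg t) (h0.trans_lt h1)
  have h3' := (hypU_pos ha hs 0 (sq_nonneg t') h1).ne'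
  have h4 : 0 < ∏ i ∈ Finset.range p, jac (hyperB a s b₀) i :=
    Finset.prod_pos fun i _ => jac_hyperB_pos ha hs i
  simp only [minSol, Pi.smul_apply, smul_eq_mul]
  rw [div_mul_div_comm, mul_comm (hypU a s 0 (t' ^ 2)), mul_div_mul_right _ _ h3']
  gcongr

lemma applyR_le_of_mem {b w : ℕ → ℝ} {ρ : ℝ} (hw : w ∈ positiveSolutions b ρ) :
    applyR b w ≤ ρ • w := by
  intro p
  rw [hw.2 p, Pi.smul_apply, smul_eq_mul]
  split_ifs <;> linarith

lemma hasSum_powR_hyperB (ha : 1 / 2 < a) (hs : 1 / 2 ≤ s) {t : ℝ} (ht0 : 0 < t) (ht : t < 1) :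
    HasSum (fun n => powR (hyperB a s b₀) n 0 0 / t⁻¹ ^ (n + 1)) (minSol a s b₀ t 0) := by
  obtain ⟨t', htt, ht1⟩ := exists_between ht
  have ht0' : 0 < t' := ht0.trans htt
  have h1 : t' ^ 2 < 1 := by nlinarith
  have h2 : t ^ 2 < 1 := by nlinarith
  refine hasSum_powR (minSol_mem ha hs ht0 ht) (inv_pos.2 ht0').le
    (div_nonneg (hypU_pos ha hs 0 (sq_nonneg t') h1).le (hypU_pos ha hs 0 (sq_nonneg t) h2).le)
    (inv_strictAnti₀ ht0 htt) (applyR_le_of_mem (minSol_mem ha hs ht0' ht1))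
    (minSol_le ha hs ht0 htt.le ht1)

lemma minW_hyperB (ha : 1 / 2 < a) (hs : 1 / 2 ≤ s) {t : ℝ} (ht0 : 0 < t) (ht : t < 1) :
    minW (hyperB a s b₀) t⁻¹ = ENNReal.ofReal (minSol a s b₀ t 0) :=
  minW_eq (inv_pos.2 ht0) (minSol_mem ha hs ht0 ht) (hasSum_powR_hyperB ha hs ht0 ht)

lemma isConvergenceNorm_hyperB (ha : 1 / 2 < a) (hs : 1 / 2 ≤ s) :
    IsConvergenceNorm (hyperB a s b₀) 1 := by
  refine isConvergenceNorm_one (jac_hyperB_pos ha hs) (tendsto_jac_hyperB ha hs) fun ρ hρ => ?_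
  have ht0 : 0 < ρ⁻¹ := inv_pos.2 (by linarith)
  have ht1 : ρ⁻¹ < 1 := inv_lt_one_of_one_lt₀ hρ
  have h := applyR_le_of_mem (minSol_mem (b₀ := b₀) ha hs ht0 ht1)
  rw [inv_inv] at h
  exact ⟨_, minSol_pos ha hs ht0 ht1, h⟩

/-! ### Summability of the weights of the killed paths -/

lemma killVal_one_succ {b : ℕ → ℝ} (hb : ∀ p, 0 < b (p + 1)) (n : ℕ) :
    killVal b 1 (n + 1) = 1 / (2 * b 1) *
      (√(b 1) * (applyR b)^[n] (fun p => 1 / √(b (p + 1))) 0) := by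
  rw [killVal_succ', ← killOp_iterate_eq hb (f := 1) (w := fun p => 1 / √(b (p + 1)))]
  intro p
  have : √(b (p + 1)) ≠ 0 := (Real.sqrt_pos.2 (hb p)).ne'
  rw [mul_one_div, div_self this]
  rfl

lemma jac_mul_one_div_sqrt {b : ℕ → ℝ} (hb : ∀ p, 0 < b (p + 1)) (p : ℕ) :
    jac b p * (1 / √(b (p + 2))) = 1 / b (p + 2) / 2 * (1 / √(b (p + 1))) := by
  have h1 := Real.sqrt_pos.2 (hb p)
  have h2 := Real.sqrt_pos.2 (hb (p + 1))
  have h := jac_mul_sqrt hb p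
  have h3 := Real.mul_self_sqrt (hb (p + 1)).le
  have h4 := hb (p + 1)
  rw [show p + 1 + 1 = p + 2 by ring] at *
  field_simp at h ⊢
  linarith

lemma jac_mul_one_div_sqrt' {b : ℕ → ℝ} (hb : ∀ p, 0 < b (p + 1)) (p : ℕ) :
    jac b p * (1 / √(b (p + 1))) = 1 / b (p + 1) / 2 * (1 / √(b (p + 2))) := by
  have h1 := Real.sqrt_pos.2 (hb p)
  have h2 := Real.sqrt_pos.2 (hb (p + 1))
  have h := jac_mul_sqrt' hb p
  have h3 := Real.mul_self_sqrt (hb (p)).le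
  have h4 := hb p
  rw [show p + 1 + 1 = p + 2 by ring] at *
  field_simp at h ⊢
  linarith

/-- After conjugation the constant observable becomes `y = 1 / √b`. Since eventually `1 / b ≤ r`, `R
y ≤ r y` holds outside a finite set. A multiple of a positive supersolution at some `r' < r` repairs
that set, so the iterates grow at most like `r ^ n`, with `r t < 1`. -/
lemma summable_killVal {b : ℕ → ℝ} (hb : ∀ p, 0 < b (p + 1))
    (hbge : ∀ r : ℝ, 1 < r → ∀ᶠ n : ℕ in atTop, 1 / b (n + 1) ≤ r)
    (hsuper : ∀ ρ : ℝ, 1 < ρ → ∃ w : ℕ → ℝ, (∀ p, 0 < w p) ∧ applyR b w ≤ ρ • w)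
    {t : ℝ} (ht0 : 0 < t) (ht : t < 1) : Summable fun j => killVal b 1 j * t ^ j := by
  obtain ⟨r, hr1, hrt⟩ := exists_between ((one_lt_inv₀ ht0).2 ht)
  obtain ⟨r', hr1', hrr⟩ := exists_between hr1
  obtain ⟨v, hv, hvs⟩ := hsuper r' hr1'
  obtain ⟨P, hP⟩ := eventually_atTop.1 (hbge r hr1)
  set y : ℕ → ℝ := fun p => 1 / √(b (p + 1)) with hy
  have hypos : ∀ p, 0 < y p := fun p => one_div_pos.2 (Real.sqrt_pos.2 (hb p))
  have hyR : ∀ p, P + 1 ≤ p → applyR b y p ≤ r * y p := by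
    intro p hp
    obtain ⟨q, rfl⟩ : ∃ q, p = q + 1 := ⟨p - 1, by lia⟩
    have e1 : jac b q * y q = 1 / b (q + 1) / 2 * y (q + 1) := jac_mul_one_div_sqrt' hb q
    have e2 : jac b (q + 1) * y (q + 2) = 1 / b (q + 3) / 2 * y (q + 1) :=
      jac_mul_one_div_sqrt hb (q + 1)
    rw [applyR_succ, e1, e2]
    have h1 := hP q (by lia)
    have h2 : 1 / b (q + 3) ≤ r := hP (q + 2) (by lia)
    nlinarith [hypos (q + 1)]
  -- At each exceptional `p` the slack `C (r - r') v p` of the supersolution exceeds `R y`.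
  set C := ∑ p ∈ Finset.range (P + 1), |applyR b y p| / ((r - r') * v p) with hC
  have hterm : ∀ p, 0 ≤ |applyR b y p| / ((r - r') * v p) := fun p =>
    div_nonneg (abs_nonneg _) (mul_nonneg (by linarith) (hv p).le)
  have hC0 : 0 ≤ C := Finset.sum_nonneg fun p _ => hterm p
  have hfs : applyR b (y + C • v) ≤ r • (y + C • v) := by
    intro p
    rw [applyR_add, applyR_smul]
    simp only [Pi.add_apply, Pi.smul_apply, smul_eq_mul]
    have h1 := mul_le_mul_of_nonneg_left (hvs p) hC0
    rw [Pi.smul_apply, smul_eq_mul] at h1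
    have hCv := mul_nonneg hC0 (hv p).le
    by_cases hp : P + 1 ≤ p
    · have h2 := hyR p hp
      nlinarith
    · have h3 : |applyR b y p| / ((r - r') * v p) ≤ C :=
        Finset.single_le_sum (f := fun p => |applyR b y p| / ((r - r') * v p))
          (fun p _ => hterm p) (Finset.mem_range.2 (by lia))
      rw [div_le_iff₀ (mul_pos (by linarith) (hv p))] at h3
      have h4 := le_abs_self (applyR b y p)
      have h5 := mul_pos (show 0 < r by linarith) (hypos p)
      nlinarith
  have hyle : y ≤ y + C • v := fun p => by
    have hCv := mul_nonneg hC0 (hv p).le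
    simpa using hCv
  have hr0 : 0 < r := by linarith
  have hbound : ∀ n, (applyR b)^[n] y 0 ≤ r ^ n * (y + C • v) 0 := fun n =>
    (applyR_iterate_mono b hyle n 0).trans (applyR_iterate_le b hr0.le hfs n 0)
  have hnn : ∀ n, 0 ≤ (applyR b)^[n] y 0 := fun n => by
    have := powR_mul_le b (fun p => (hypos p).le) n 0 0
    exact (mul_nonneg (powR_nonneg b n 0 0) (hypos 0).le).trans this
  have hrt1 : r * t < 1 := by
    rw [lt_inv_comm₀ hr0 ht0] at hrt
    calc r * t < r * r⁻¹ := mul_lt_mul_of_pos_left hrt hr0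
      _ = 1 := mul_inv_cancel₀ hr0.ne'
  have hgeo := (summable_geometric_of_lt_one (mul_nonneg hr0.le ht0.le) hrt1).mul_left
    (1 / (2 * b 1) * (√(b 1) * (y + C • v) 0) * t)
  have hb1 := hb 0
  rw [zero_add] at hb1
  rw [← summable_nat_add_iff 1]
  refine Summable.of_nonneg_of_le (fun n => ?_) (fun n => ?_) hgeo
  · rw [killVal_one_succ hb]
    have := hnn n
    positivity
  · rw [killVal_one_succ hb]
    have h1 : (applyR b)^[n] y 0 * t ^ n ≤ (y + C • v) 0 * (r * t) ^ n := by
      rw [mul_pow]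
      nlinarith [mul_le_mul_of_nonneg_right (hbound n) (pow_pos ht0 n).le]
    calc 1 / (2 * b 1) * (√(b 1) * (applyR b)^[n] y 0) * t ^ (n + 1)
        = 1 / (2 * b 1) * √(b 1) * t * ((applyR b)^[n] y 0 * t ^ n) := by ring
      _ ≤ 1 / (2 * b 1) * √(b 1) * t * ((y + C • v) 0 * (r * t) ^ n) :=
        mul_le_mul_of_nonneg_left h1 (by positivity)
      _ = _ := by ring


/-! ### The Gibbs equation -/

/-- `Φ z = 𝔴₁ (ρ) / ρ` as a function of `z = ρ⁻²`. -/
def gibbsFun (a s z : ℝ) : ℝ := z * hypU a s 1 z / hypU a s 0 z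

lemma mul_minSol_zero {t : ℝ} : t * minSol a s b₀ t 0 = gibbsFun a s (t ^ 2) := by
  simp only [minSol, gibbsFun, Finset.prod_range_zero]
  ring

lemma hasSum_gibbsFun (ha : 1 / 2 < a) (hs : 1 / 2 ≤ s) (b₀ : ℝ) {z : ℝ} (hz0 : 0 < z)
    (hz : z < 1) :
    HasSum (fun n => powR (hyperB a s b₀) (2 * n) 0 0 * z ^ (n + 1)) (gibbsFun a s z) := by
  have ht0 : 0 < √z := Real.sqrt_pos.2 hz0
  have ht : √z < 1 := by rwa [Real.sqrt_lt' one_pos, one_pow]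
  have h := (hasSum_powR_hyperB (b₀ := b₀) ha hs ht0 ht).mul_left √z
  rw [mul_minSol_zero, Real.sq_sqrt hz0.le] at h
  have hinj : Function.Injective fun n : ℕ => 2 * n := fun m n hmn => by
    simp only at hmn
    lia
  refine ((hinj.hasSum_iff fun n hn => ?_).2 h).congr_fun fun n => ?_
  · obtain ⟨k, rfl | rfl⟩ := Nat.even_or_odd' n
    · exact absurd ⟨k, rfl⟩ hn
    · rw [powR_odd, zero_div, mul_zero]
  · rw [Function.comp_apply, inv_pow, div_inv_eq_mul, mul_left_comm, ← pow_succ',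
      show 2 * n + 1 + 1 = 2 * (n + 1) by ring, pow_mul, Real.sq_sqrt hz0.le]

lemma minW_hyperB_eq (ha : 1 / 2 < a) (hs : 1 / 2 ≤ s) (b₀ : ℝ) {ρ : ℝ} (hρ : 1 < ρ) :
    minW (hyperB a s b₀) ρ = ENNReal.ofReal (ρ * gibbsFun a s (ρ ^ 2)⁻¹) := by
  have hρ0 : 0 < ρ := by linarith
  have h := minW_hyperB (b₀ := b₀) ha hs (inv_pos.2 hρ0) (inv_lt_one_of_one_lt₀ hρ)
  rw [inv_inv] at h
  rw [h, ← inv_pow, ← mul_minSol_zero (b₀ := b₀), ← mul_assoc, mul_inv_cancel₀ hρ0.ne', one_mul]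

lemma gibbsFun_sub_ge (ha : 1 / 2 < a) (hs : 1 / 2 ≤ s) {x y : ℝ} (hx : 0 < x) (hxy : x ≤ y)
    (hy : y < 1) : y - x ≤ gibbsFun a s y - gibbsFun a s x := by
  have h := (hasSum_gibbsFun ha hs 0 (hx.trans_le hxy) hy).sub
    (hasSum_gibbsFun ha hs 0 hx (hxy.trans_lt hy))
  have h0 := le_hasSum h 0 (fun n _ => by
    rw [← mul_sub]
    exact mul_nonneg (powR_nonneg _ _ _ _)
      (sub_nonneg.2 (pow_le_pow_left₀ hx.le hxy _)))
  simpa [powR] using h0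

lemma gibbsFun_strictMonoOn (ha : 1 / 2 < a) (hs : 1 / 2 ≤ s) :
    StrictMonoOn (gibbsFun a s) (Set.Ioo 0 1) := by
  intro x hx y hy hxy
  have := gibbsFun_sub_ge ha hs hx.1 hxy.le hy.2
  linarith

lemma hypCoeff_one_eq (ha : 1 / 2 < a) (hs : 1 / 2 ≤ s) (n : ℕ) :
    hypCoeff a (a + 1 / 2) (2 * a + s) n =
      (2 * a + s - 1) / (a - 1 / 2) * ((a - 1 / 2 + n) / (2 * a + s - 1 + n)) *
        hypCoeff (a - 1 / 2) a (2 * a + s - 1) n := by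
  have hn : (0 : ℝ) ≤ n := Nat.cast_nonneg n
  have h1 : 0 < a - 1 / 2 := by linarith
  have h2 : 0 < 2 * a + s - 1 := by linarith
  have h3 : hypCoeff a (a + 1 / 2) (2 * a + s) n = hypCoeff a (a - 1 / 2) (2 * a + s - 1) n *
      ((2 * a + s - 1) / (2 * a + s - 1 + n)) * ((a - 1 / 2 + n) / (a - 1 / 2)) := by
    rw [← hypCoeff_shift_right _ _ h2, ← hypCoeff_shift_mid _ _ h1]
    congr 1 <;> ring
  rw [h3, hypCoeff_comm a (a - 1 / 2)]
  have h4 : 2 * a + s - 1 + n ≠ 0 := by linarith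
  field_simp

lemma hypCoeff_one_le (ha : 1 / 2 < a) (hs : 1 / 2 ≤ s) (n : ℕ) :
    hypCoeff a (a + 1 / 2) (2 * a + s) n ≤
      (2 * a + s - 1) / (a - 1 / 2) * hypCoeff (a - 1 / 2) a (2 * a + s - 1) n := by
  have hn : (0 : ℝ) ≤ n := Nat.cast_nonneg n
  have h1 : 0 < a - 1 / 2 := by linarith
  have h2 : 0 < 2 * a + s - 1 := by linarith
  rw [hypCoeff_one_eq ha hs]
  refine mul_le_mul_of_nonneg_right ?_ (hypCoeff_pos h1 (by linarith) h2 n).le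
  refine mul_le_of_le_one_right (by positivity) ?_
  rw [div_le_one (by positivity)]
  linarith

lemma hypU_zero : hypU a s 0 = ₂F₁ (a - 1 / 2) a (2 * a + s - 1) := by
  simp [hypU]

lemma hypU_one : hypU a s 1 = ₂F₁ a (a + 1 / 2) (2 * a + s) := by
  rw [hypU, Nat.cast_one, show a - 1 / 2 + 1 / 2 = a by ring,
    show 2 * a + s - 1 + 1 = 2 * a + s by ring]

/-- Comparing coefficients bounds `Φ` up to `z = 1` even when `s = 1/2`, where numerator and
denominator both diverge; this makes the critical value finite. The linear factor `z` also yields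
small values of `Φ` near `0`. -/
lemma gibbsFun_le (ha : 1 / 2 < a) (hs : 1 / 2 ≤ s) {z : ℝ} (hz0 : 0 ≤ z) (hz : z < 1) :
    gibbsFun a s z ≤ z * ((2 * a + s - 1) / (a - 1 / 2)) := by
  have hU0 := hypU_pos ha hs 0 hz0 hz
  rw [gibbsFun, mul_div_assoc]
  refine mul_le_mul_of_nonneg_left ?_ hz0
  rw [div_le_iff₀ hU0, hypU_zero, hypU_one]
  have hz' : |z| < 1 := by rwa [abs_of_nonneg hz0]
  refine hasSum_le (fun n => ?_)
    (hasSum_hyp (by linarith) (by linarith) (by linarith) hz')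
    ((hasSum_hyp (by linarith) (by linarith) (by linarith) hz').mul_left
      ((2 * a + s - 1) / (a - 1 / 2)))
  rw [← mul_assoc]
  exact mul_le_mul_of_nonneg_right (hypCoeff_one_le ha hs n) (pow_nonneg hz0 n)

lemma gibbsFun_pos (ha : 1 / 2 < a) (hs : 1 / 2 ≤ s) {z : ℝ} (hz0 : 0 < z) (hz : z < 1) :
    0 < gibbsFun a s z :=
  div_pos (mul_pos hz0 (hypU_pos ha hs 1 hz0.le hz)) (hypU_pos ha hs 0 hz0.le hz)

/-- The derivatives of the hypergeometric functions of the model. -/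
def hypDU (a s : ℝ) (p : ℕ) (z : ℝ) : ℝ :=
  (a - 1 / 2 + p / 2) * (a + p / 2) / (2 * a + s - 1 + p) *
    ₂F₁ (a - 1 / 2 + p / 2 + 1) (a + p / 2 + 1) (2 * a + s - 1 + p + 1) z

lemma hasDerivAt_hypU (ha : 1 / 2 < a) (hs : 1 / 2 ≤ s) (p : ℕ) {z : ℝ} (hz0 : 0 ≤ z)
    (hz : z < 1) : HasDerivAt (hypU a s p) (hypDU a s p z) z := by
  have hp : (0 : ℝ) ≤ p := Nat.cast_nonneg p
  exact hasDerivAt_hyp (by linarith) (by linarith) (by linarith) (by rwa [abs_of_nonneg hz0])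

/-- The logarithmic derivative `z Φ' z / Φ z`. -/
def gibbsLogDeriv (a s z : ℝ) : ℝ :=
  1 + z * (hypDU a s 1 z / hypU a s 1 z - hypDU a s 0 z / hypU a s 0 z)

lemma hasDerivAt_gibbsFun (ha : 1 / 2 < a) (hs : 1 / 2 ≤ s) {z : ℝ} (hz0 : 0 < z) (hz : z < 1) :
    HasDerivAt (gibbsFun a s) (gibbsFun a s z / z * gibbsLogDeriv a s z) z := by
  have h0 := (hypU_pos ha hs 0 hz0.le hz).ne'
  have h1 := (hypU_pos ha hs 1 hz0.le hz).ne'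
  have h := ((hasDerivAt_id z).mul (hasDerivAt_hypU ha hs 1 hz0.le hz)).div
    (hasDerivAt_hypU ha hs 0 hz0.le hz) h0
  refine h.congr_deriv ?_
  simp only [gibbsFun, gibbsLogDeriv, id, Pi.mul_apply]
  field_simp
  ring

lemma densityDenom_eq {z : ℝ} (hz0 : 0 < z) :
    densityDenom a s (√z)⁻¹ = 2 * gibbsLogDeriv a s z := by
  have hz : ((√z)⁻¹ ^ 2)⁻¹ = z := by rw [inv_pow, inv_inv, Real.sq_sqrt hz0.le]
  have hz' : 2 / (√z)⁻¹ ^ 2 = 2 * z := by rw [div_eq_mul_inv, hz]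
  rw [densityDenom, hz, hz', gibbsLogDeriv, hypU_zero, hypU_one, hypDU, hypDU, Nat.cast_zero,
    Nat.cast_one, show a - 1 / 2 + 1 / 2 = a by ring, show a + 1 / 2 + 1 = a + 3 / 2 by ring,
    show 2 * a + s - 1 + 1 = 2 * a + s by ring, zero_div, add_zero, add_zero, add_zero,
    show a - 1 / 2 + 1 = a + 1 / 2 by ring, show 2 * a + s - 1 + 1 = 2 * a + s by ring]
  ring

/-- The density of returns for the hypergeometric model. -/
lemma isReturnDensity_hyperB (ha : 1 / 2 < a) (hs : 1 / 2 ≤ s) (hb₀ : 0 < b₀) {z : ℝ}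
    (hz0 : 0 < z) (hz : z < 1) (h : gibbsFun a s z = 4 * b₀ * hyperB a s b₀ 1) :
    0 < gibbsLogDeriv a s z ∧
      IsReturnDensity (hyperB a s b₀) (1 / (2 * gibbsLogDeriv a s z)) := by
  have ht0 : 0 < √z := Real.sqrt_pos.2 hz0
  have ht : √z < 1 := by rwa [Real.sqrt_lt' one_pos, one_pow]
  have hΦ := gibbsFun_pos ha hs hz0 hz
  -- The quotient `Φ(z x) / Φ(z)` generates the tilted excursion law: the Gibbs equation gives it
  -- total mass one, and its derivative at `x = 1` is `z Φ'(z) / Φ(z)`.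
  refine isReturnDensity_of_renewal (hyperB_pos ha hs hb₀) ht0
    (F := fun x => gibbsFun a s (z * x) / gibbsFun a s z) (fun x hx0 hx1 => ?_) ?_ ?_ ?_
  · have h1 := (hasSum_gibbsFun ha hs b₀ (mul_pos hz0 hx0)
      ((mul_le_of_le_one_right hz0.le hx1).trans_lt hz)).div_const (gibbsFun a s z)
    refine h1.congr_fun fun n => ?_
    rw [h, hyperB_zero, pow_mul, Real.sq_sqrt hz0.le, mul_pow]
    ring
  · rw [mul_one, div_self hΦ.ne']
  · have h2 : HasDerivAt (fun x : ℝ => z * x) z 1 := by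
      simpa using (hasDerivAt_id (1 : ℝ)).const_mul z
    have h1 := hasDerivAt_gibbsFun ha hs hz0 hz
    rw [← mul_one z] at h1
    have h3 := (HasDerivAt.comp (1 : ℝ) h1 h2).div_const (gibbsFun a s z)
    refine h3.congr_deriv ?_
    rw [mul_one]
    field_simp
  · refine summable_killVal (hyperB_succ_pos ha hs)
      (fun r hr => eventually_inv_hyperB_le ha hs hr) (fun ρ hρ => ?_) ht0 ht
    have hi0 : 0 < ρ⁻¹ := inv_pos.2 (by linarith)
    have hi1 : ρ⁻¹ < 1 := inv_lt_one_of_one_lt₀ hρ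
    have hm := applyR_le_of_mem (minSol_mem (b₀ := b₀) ha hs hi0 hi1)
    rw [inv_inv] at hm
    exact ⟨_, minSol_pos ha hs hi0 hi1, hm⟩

lemma isGibbsRoot_hyperB (ha : 1 / 2 < a) (hs : 1 / 2 ≤ s) (hb₀ : 0 < b₀) {z : ℝ}
    (hz0 : 0 < z) (hz : z < 1) (h : gibbsFun a s z = 4 * b₀ * hyperB a s b₀ 1) :
    IsGibbsRoot (hyperB a s b₀) (√z)⁻¹ := by
  have ht0 : 0 < √z := Real.sqrt_pos.2 hz0
  have ht : √z < 1 := by rwa [Real.sqrt_lt' one_pos, one_pow]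
  have hb1 := hyperB_succ_pos (b₀ := b₀) ha hs 0
  rw [zero_add] at hb1
  refine ⟨⟨(one_lt_inv₀ ht0).2 ht, ?_⟩, fun r hr hmin => ?_⟩
  · rw [minW_hyperB_eq ha hs b₀ ((one_lt_inv₀ ht0).2 ht), inv_pow, inv_inv,
      Real.sq_sqrt hz0.le, h, hyperB_zero]
    congr 1
    ring
  · have hr0 : 0 < r := by linarith
    have hr2 : 1 < r ^ 2 := by nlinarith
    have hy0 : 0 < (r ^ 2)⁻¹ := by positivity
    have hy1 : (r ^ 2)⁻¹ < 1 := inv_lt_one_of_one_lt₀ hr2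
    have hΦ := gibbsFun_pos ha hs hy0 hy1
    rw [minW_hyperB_eq ha hs b₀ hr, hyperB_zero,
      ENNReal.ofReal_eq_ofReal_iff (by positivity) (by positivity)] at hmin
    have h2 : gibbsFun a s (r ^ 2)⁻¹ = gibbsFun a s z := by
      rw [h]
      refine mul_left_cancel₀ hr0.ne' (hmin.trans ?_)
      ring
    have h3 := (gibbsFun_strictMonoOn ha hs).injOn ⟨hy0, hy1⟩ ⟨hz0, hz⟩ h2
    rw [← h3, Real.sqrt_inv, Real.sqrt_sq hr0.le, inv_inv]

/-- The limit of the Gibbs function at the critical point. -/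
lemma exists_gibbsFun_limit (ha : 1 / 2 < a) (hs : 1 / 2 ≤ s) :
    ∃ Φ₁ : ℝ, Tendsto (gibbsFun a s) (𝓝[<] 1) (𝓝 Φ₁) ∧
      ∀ z ∈ Set.Ioo (0 : ℝ) 1, gibbsFun a s z < Φ₁ := by
  have hmono := gibbsFun_strictMonoOn ha hs
  have hbdd : BddAbove (gibbsFun a s '' Set.Ioo 0 1) := by
    refine ⟨(2 * a + s - 1) / (a - 1 / 2), ?_⟩
    rintro _ ⟨z, hz, rfl⟩
    refine (gibbsFun_le ha hs hz.1.le hz.2).trans (mul_le_of_le_one_left ?_ hz.2.le)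
    exact div_nonneg (by linarith) (by linarith)
  refine ⟨sSup (gibbsFun a s '' Set.Ioo 0 1), ?_, fun z hz => ?_⟩
  · exact hmono.monotoneOn.tendsto_nhdsWithin_Ioo_left ⟨1 / 2, by norm_num, by norm_num⟩ hbdd
  · have hz' : (z + 1) / 2 ∈ Set.Ioo (0 : ℝ) 1 := ⟨by linarith [hz.1], by linarith [hz.2]⟩
    exact (hmono hz hz' (by linarith [hz.2])).trans_le (le_csSup hbdd ⟨_, hz', rfl⟩)

lemma isCriticalValue_hyperB (ha : 1 / 2 < a) (hs : 1 / 2 ≤ s) (b₀ : ℝ) {Φ₁ : ℝ} (hΦ₁ : 0 < Φ₁)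
    (hlim : Tendsto (gibbsFun a s) (𝓝[<] 1) (𝓝 Φ₁)) :
    IsCriticalValue (hyperB a s b₀) (Φ₁ / (4 * hyperB a s b₀ 1)) := by
  have hb1 := hyperB_succ_pos (b₀ := b₀) ha hs 0
  rw [zero_add] at hb1
  refine ⟨by positivity, 1, isConvergenceNorm_hyperB ha hs, ?_⟩
  have hz : Tendsto (fun ρ : ℝ => (ρ ^ 2)⁻¹) (𝓝[>] 1) (𝓝[<] 1) := by
    refine tendsto_nhdsWithin_iff.2 ⟨?_, ?_⟩
    · have : Tendsto (fun ρ : ℝ => (ρ ^ 2)⁻¹) (𝓝 1) (𝓝 ((1 ^ 2)⁻¹)) :=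
        (tendsto_id.pow 2).inv₀ (by norm_num)
      rw [one_pow, inv_one] at this
      exact this.mono_left nhdsWithin_le_nhds
    · filter_upwards [self_mem_nhdsWithin] with ρ hρ
      have hρ' : 1 < ρ := hρ
      exact inv_lt_one_of_one_lt₀ (one_lt_pow₀ hρ' two_ne_zero)
  have h1 := ENNReal.tendsto_ofReal ((hlim.comp hz).div_const (4 * hyperB a s b₀ 1))
  refine h1.congr' ?_
  filter_upwards [self_mem_nhdsWithin] with ρ hρ
  have hρ' : 1 < ρ := hρ
  have hρ0 : 0 < ρ := by linarith
  rw [minW_hyperB_eq ha hs b₀ hρ', ← ENNReal.ofReal_div_of_pos (by positivity)]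
  congr 1
  rw [Function.comp_apply]
  field_simp

lemma exists_gibbsFun_eq (ha : 1 / 2 < a) (hs : 1 / 2 ≤ s) {Φ₁ c : ℝ}
    (hlim : Tendsto (gibbsFun a s) (𝓝[<] 1) (𝓝 Φ₁)) (hc0 : 0 < c) (hc : c < Φ₁) :
    ∃ z ∈ Set.Ioo (0 : ℝ) 1, gibbsFun a s z = c := by
  have hK : 0 < (2 * a + s - 1) / (a - 1 / 2) := div_pos (by linarith) (by linarith)
  obtain ⟨y, hy, hcy⟩ := (Filter.Eventually.and (Ioo_mem_nhdsLT one_pos :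
    ∀ᶠ y : ℝ in 𝓝[<] 1, y ∈ Set.Ioo (0 : ℝ) 1) (hlim.eventually_const_lt hc)).exists
  -- The second entry makes the linear bound `gibbsFun_le` give `Φ(x) ≤ c`, the lower end for the
  -- intermediate value theorem.
  set x := min y (c / ((2 * a + s - 1) / (a - 1 / 2))) with hx
  have hx0 : 0 < x := lt_min hy.1 (div_pos hc0 hK)
  have hxy : x ≤ y := min_le_left _ _
  have hxc : gibbsFun a s x ≤ c := by
    refine (gibbsFun_le ha hs hx0.le (hxy.trans_lt hy.2)).trans ?_
    rw [← le_div_iff₀ hK]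
    exact min_le_right _ _
  have hcont : ContinuousOn (gibbsFun a s) (Set.Icc x y) := fun w hw =>
    (hasDerivAt_gibbsFun ha hs (hx0.trans_le hw.1)
      (hw.2.trans_lt hy.2)).continuousAt.continuousWithinAt
  obtain ⟨w, hw, hwc⟩ := intermediate_value_Icc hxy hcont ⟨hxc, hcy.le⟩
  exact ⟨w, ⟨hx0.trans_le hw.1, hw.2.trans_lt hy.2⟩, hwc⟩


/-! ### Behaviour at the critical point -/

/-- The value at `1` of the hypergeometric functions of the model. -/
def hypUOne (a s : ℝ) (p : ℕ) : ℝ :=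
  ∑' n, hypCoeff (a - 1 / 2 + p / 2) (a + p / 2) (2 * a + s - 1 + p) n

lemma tendsto_hypU (ha : 1 / 2 < a) (hs : 1 / 2 < s) (p : ℕ) :
    Tendsto (hypU a s p) (𝓝[<] 1) (𝓝 (hypUOne a s p)) := by
  have hp : (0 : ℝ) ≤ p := Nat.cast_nonneg p
  exact tendsto_hyp_one (by linarith) (by linarith) (by linarith) (by linarith)

lemma hypUOne_pos (ha : 1 / 2 < a) (hs : 1 / 2 < s) (p : ℕ) : 0 < hypUOne a s p := by
  have hp : (0 : ℝ) ≤ p := Nat.cast_nonneg p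
  have hpos := hypCoeff_pos (show 0 < a - 1 / 2 + (p : ℝ) / 2 by linarith)
    (show 0 < a + (p : ℝ) / 2 by linarith) (show 0 < 2 * a + s - 1 + (p : ℝ) by linarith)
  exact (summable_hypCoeff (by linarith) (by linarith) (by linarith) (by linarith)).tsum_pos
    (fun n => (hpos n).le) 0 (hpos 0)

lemma tendsto_one_sub_rpow {x : ℝ} (hx : 0 < x) :
    Tendsto (fun z : ℝ => (1 - z) ^ x) (𝓝[<] 1) (𝓝 0) := by
  have h : Tendsto (fun z : ℝ => 1 - z) (𝓝[<] 1) (𝓝 0) := by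
    have : Tendsto (fun z : ℝ => 1 - z) (𝓝 1) (𝓝 (1 - 1)) := tendsto_id.const_sub 1
    rw [sub_self] at this
    exact this.mono_left nhdsWithin_le_nhds
  have := h.rpow_const (Or.inr hx.le)
  rwa [Real.zero_rpow hx.ne'] at this

/-- The coefficients of the differentiated series and of `(1 - z) ^ -(3/2 - s)` decay at the same
power rate, so the Abelian theorem gives the ratio of the functions. The prefactor of the derivative
is absorbed by `Γ(x + 1) = x Γ(x)`. -/
lemma tendsto_one_sub_rpow_mul_hypDU (ha : 1 / 2 < a) (hs : 1 / 2 < s) (hs' : s < 3 / 2) (p : ℕ) :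
    Tendsto (fun z => (1 - z) ^ (3 / 2 - s) * hypDU a s p z) (𝓝[<] 1)
      (𝓝 (hypConst (a - 1 / 2 + p / 2) (a + p / 2) (2 * a + s - 1 + p) /
        hypConst (3 / 2 - s) 1 1)) := by
  have hp : (0 : ℝ) ≤ p := Nat.cast_nonneg p
  have hα : 0 < a - 1 / 2 + (p : ℝ) / 2 := by linarith
  have hβ : 0 < a + (p : ℝ) / 2 := by linarith
  have hγ : 0 < 2 * a + s - 1 + (p : ℝ) := by linarith
  have hη : 0 < 3 / 2 - s := by linarith
  have hcoef := tendsto_hypCoeff_div (show 0 < a - 1 / 2 + (p : ℝ) / 2 + 1 by linarith)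
    (show 0 < a + (p : ℝ) / 2 + 1 by linarith) (show 0 < 2 * a + s - 1 + (p : ℝ) + 1 by linarith)
    hη one_pos one_pos (by ring)
  have htop : Tendsto (fun z : ℝ => (1 - z) ^ (-(3 / 2 - s))) (𝓝[<] 1) atTop := by
    have h1 : Tendsto (fun z : ℝ => (1 - z) ^ (3 / 2 - s)) (𝓝[<] 1) (𝓝[>] 0) := by
      refine tendsto_nhdsWithin_iff.2 ⟨tendsto_one_sub_rpow hη, ?_⟩
      filter_upwards [self_mem_nhdsWithin] with z hz
      exact Real.rpow_pos_of_pos (sub_pos.2 (Set.mem_Iio.1 hz)) _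
    refine h1.inv_tendsto_nhdsGT_zero.congr' ?_
    filter_upwards [self_mem_nhdsWithin] with z hz
    rw [Real.rpow_neg (sub_pos.2 (Set.mem_Iio.1 hz)).le]
    rfl
  have h := tendsto_powerSeries_div (hypCoeff_pos hη one_pos one_pos) hcoef
    (fun x hx => hasSum_hyp (by linarith) (by linarith) (by linarith)
      (by rw [abs_of_pos hx.1]; exact hx.2))
    (fun x hx => hasSum_one_sub_rpow hx.1.le hx.2) htop
  have h2 := h.const_mul ((a - 1 / 2 + p / 2) * (a + p / 2) / (2 * a + s - 1 + p))
  have e : (a - 1 / 2 + p / 2) * (a + p / 2) / (2 * a + s - 1 + p) *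
      (hypConst (a - 1 / 2 + p / 2 + 1) (a + p / 2 + 1) (2 * a + s - 1 + p + 1) /
        hypConst (3 / 2 - s) 1 1) =
      hypConst (a - 1 / 2 + p / 2) (a + p / 2) (2 * a + s - 1 + p) /
        hypConst (3 / 2 - s) 1 1 := by
    rw [mul_div_assoc']
    congr 1
    have := Real.Gamma_pos_of_pos hα
    have := Real.Gamma_pos_of_pos hβ
    have := Real.Gamma_pos_of_pos hγ
    simp only [hypConst]
    rw [Real.Gamma_add_one hα.ne', Real.Gamma_add_one hβ.ne', Real.Gamma_add_one hγ.ne']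
    generalize a - 1 / 2 + (p : ℝ) / 2 = α at *
    generalize a + (p : ℝ) / 2 = β at *
    generalize 2 * a + s - 1 + (p : ℝ) = γ at *
    field_simp
  rw [e] at h2
  refine h2.congr' ?_
  filter_upwards [self_mem_nhdsWithin] with z hz
  have hz' : 0 < 1 - z := sub_pos.2 (Set.mem_Iio.1 hz)
  rw [Real.rpow_neg hz'.le, div_inv_eq_mul, hypDU]
  ring

lemma hypConst_one (ha : 1 / 2 < a) (hs : 1 / 2 ≤ s) :
    hypConst a (a + 1 / 2) (2 * a + s) =
      (2 * a + s - 1) / (a - 1 / 2) * hypConst (a - 1 / 2) a (2 * a + s - 1) := by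
  have h1 : 0 < a - 1 / 2 := by linarith
  have h2 : 0 < 2 * a + s - 1 := by linarith
  have h3 := Real.Gamma_pos_of_pos h1
  have h4 := Real.Gamma_pos_of_pos (show 0 < a by linarith)
  have e1 := Real.Gamma_add_one h1.ne'
  have e2 := Real.Gamma_add_one h2.ne'
  rw [show a - 1 / 2 + 1 = a + 1 / 2 by ring] at e1
  rw [show 2 * a + s - 1 + 1 = 2 * a + s by ring] at e2
  rw [hypConst, hypConst, e1, e2]
  field_simp

/-- From `p = 0` to `p = 1` the singular constant is multiplied by exactly this factor
(`hypConst_one`), but the value at `1` by strictly less. This is why the two singularities in the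
logarithmic derivative do not cancel. -/
lemma hypUOne_one_lt (ha : 1 / 2 < a) (hs : 1 / 2 < s) :
    hypUOne a s 1 < (2 * a + s - 1) / (a - 1 / 2) * hypUOne a s 0 := by
  have e0 : hypUOne a s 0 = ∑' n, hypCoeff (a - 1 / 2) a (2 * a + s - 1) n := by
    simp [hypUOne]
  have e1 : hypUOne a s 1 = ∑' n, hypCoeff a (a + 1 / 2) (2 * a + s) n := by
    rw [hypUOne, Nat.cast_one, show a - 1 / 2 + 1 / 2 = a by ring,
      show 2 * a + s - 1 + 1 = 2 * a + s by ring]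
  rw [e0, e1, ← tsum_mul_left]
  refine Summable.tsum_lt_tsum (i := 0) (hypCoeff_one_le ha hs.le) ?_
    (summable_hypCoeff (by linarith) (by linarith) (by linarith) (by linarith))
    ((summable_hypCoeff (by linarith) (by linarith) (by linarith) (by linarith)).mul_left _)
  rw [hypCoeff_zero, hypCoeff_zero, mul_one, one_lt_div (by linarith)]
  linarith

/-- The divergence of the mean return time at the critical point. -/
lemma tendsto_gibbsLogDeriv_of_lt (ha : 1 / 2 < a) (hs : 1 / 2 < s) (hs' : s < 3 / 2) :
    ∃ D > 0, Tendsto (fun z => (1 - z) ^ (3 / 2 - s) * gibbsLogDeriv a s z) (𝓝[<] 1) (𝓝 D) := by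
  have hη : 0 < 3 / 2 - s := by linarith
  have hS0 := hypUOne_pos ha hs 0
  have hS1 := hypUOne_pos ha hs 1
  have h0 := (tendsto_one_sub_rpow_mul_hypDU ha hs hs' 0).div (tendsto_hypU ha hs 0) hS0.ne'
  have h1 := (tendsto_one_sub_rpow_mul_hypDU ha hs hs' 1).div (tendsto_hypU ha hs 1) hS1.ne'
  have hid : Tendsto (fun z : ℝ => z) (𝓝[<] 1) (𝓝 1) := tendsto_id.mono_left nhdsWithin_le_nhds
  have h2 := (tendsto_one_sub_rpow hη).add (hid.mul (h1.sub h0))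
  refine ⟨_, ?_, h2.congr fun z => ?_⟩
  · rw [zero_add, one_mul, gt_iff_lt, sub_pos]
    have hc := hypConst_pos (show 0 < a - 1 / 2 by linarith) (show 0 < a by linarith)
      (show 0 < 2 * a + s - 1 by linarith)
    have hc' := hypConst_pos hη one_pos one_pos
    have hlt := hypUOne_one_lt ha hs
    simp only [Nat.cast_zero, Nat.cast_one, zero_div, add_zero]
    rw [show a - 1 / 2 + 1 / 2 = a by ring, show 2 * a + s - 1 + 1 = 2 * a + s by ring,
      hypConst_one ha hs.le]
    generalize hypConst (a - 1 / 2) a (2 * a + s - 1) = A at *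
    generalize (2 * a + s - 1) / (a - 1 / 2) = K at *
    rw [div_div, div_div, div_lt_div_iff₀ (by positivity) (by positivity)]
    have := mul_lt_mul_of_pos_left hlt (mul_pos hc hc')
    nlinarith
  · simp only [gibbsLogDeriv, Pi.div_apply]
    ring

/-- Here `U_p'(1) / U_p(1)` is the product of the upper parameters over `s - 3/2`, and the products
for `p = 1` and `p = 0` differ by `a (a + 1/2) - a (a - 1/2) = a`. -/
lemma tendsto_gibbsLogDeriv_of_gt (ha : 1 / 2 < a) (hs : 3 / 2 < s) :
    Tendsto (gibbsLogDeriv a s) (𝓝[<] 1) (𝓝 (1 + a / (s - 3 / 2))) := by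
  have hid : Tendsto (fun z : ℝ => z) (𝓝[<] 1) (𝓝 1) := tendsto_id.mono_left nhdsWithin_le_nhds
  have hDU : ∀ p : ℕ, Tendsto (fun z => hypDU a s p z / hypU a s p z) (𝓝[<] 1)
      (𝓝 ((a - 1 / 2 + p / 2) * (a + p / 2) / (s - 3 / 2))) := by
    intro p
    have hp : (0 : ℝ) ≤ p := Nat.cast_nonneg p
    have hα : 0 < a - 1 / 2 + (p : ℝ) / 2 := by linarith
    have hβ : 0 < a + (p : ℝ) / 2 := by linarith
    have hγ : 0 < 2 * a + s - 1 + (p : ℝ) := by linarith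
    have hS := hypUOne_pos ha (show 1 / 2 < s by linarith) p
    have h1 := (tendsto_hyp_one (show 0 < a - 1 / 2 + (p : ℝ) / 2 + 1 by linarith)
      (show 0 < a + (p : ℝ) / 2 + 1 by linarith)
      (show 0 < 2 * a + s - 1 + (p : ℝ) + 1 by linarith) (by linarith)).const_mul
        ((a - 1 / 2 + p / 2) * (a + p / 2) / (2 * a + s - 1 + p))
    have h2 := h1.div (tendsto_hypU ha (show 1 / 2 < s by linarith) p) hS.ne'
    have h3 := tsum_hypCoeff_derivative hα hβ hγ (by linarith)
    rw [show 2 * a + s - 1 + p - (a - 1 / 2 + (p : ℝ) / 2) - (a + p / 2) - 1 = s - 3 / 2 by ring]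
      at h3
    have h4 : s - 3 / 2 ≠ 0 := by linarith
    refine h2.trans (le_of_eq (congrArg 𝓝 ?_))
    rw [div_eq_div_iff hS.ne' h4, mul_comm _ (s - 3 / 2), h3, hypUOne]
  have h := (hid.mul ((hDU 1).sub (hDU 0))).const_add 1
  refine (h.congr fun z => rfl).trans (le_of_eq ?_)
  congr 1
  have h4 : s - 3 / 2 ≠ 0 := by linarith
  simp only [Nat.cast_zero, Nat.cast_one]
  field_simp
  ring

/-- By l'Hôpital, the singularity of `Φ'`, proportional to `(1 - z) ^ (s - 3/2)`, integrates to a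
gap `Φ₁ - Φ` of order `(1 - z) ^ (s - 1/2)`. -/
lemma tendsto_gibbsFun_sub_div (ha : 1 / 2 < a) (hs : 1 / 2 < s) {D Φ₁ : ℝ}
    (hD : Tendsto (fun z => (1 - z) ^ (3 / 2 - s) * gibbsLogDeriv a s z) (𝓝[<] 1) (𝓝 D))
    (hΦ : Tendsto (gibbsFun a s) (𝓝[<] 1) (𝓝 Φ₁)) :
    Tendsto (fun z => (Φ₁ - gibbsFun a s z) / (1 - z) ^ (s - 1 / 2)) (𝓝[<] 1)
      (𝓝 (Φ₁ * D / (s - 1 / 2))) := by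
  have hδ : 0 < s - 1 / 2 := by linarith
  have hid : Tendsto (fun z : ℝ => z) (𝓝[<] 1) (𝓝 1) := tendsto_id.mono_left nhdsWithin_le_nhds
  have hmem : ∀ᶠ z : ℝ in 𝓝[<] 1, z ∈ Set.Ioo (0 : ℝ) 1 := Ioo_mem_nhdsLT one_pos
  refine HasDerivAt.lhopital_zero_nhdsLT
    (f' := fun z => -(gibbsFun a s z / z * gibbsLogDeriv a s z))
    (g' := fun z => -1 * (s - 1 / 2) * (1 - z) ^ (s - 1 / 2 - 1)) ?_ ?_ ?_ ?_ ?_ ?_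
  · filter_upwards [hmem] with z hz
    exact (hasDerivAt_gibbsFun ha hs.le hz.1 hz.2).const_sub Φ₁
  · filter_upwards [hmem] with z hz
    exact ((hasDerivAt_id z).const_sub 1).rpow_const (Or.inl (sub_pos.2 hz.2).ne')
  · filter_upwards [hmem] with z hz
    have := Real.rpow_pos_of_pos (sub_pos.2 hz.2) (s - 1 / 2 - 1)
    exact mul_ne_zero (by linarith) this.ne'
  · have := hΦ.const_sub Φ₁
    rwa [sub_self] at this
  · exact tendsto_one_sub_rpow hδ
  · have h1 := ((hΦ.div hid one_ne_zero).mul hD).div_const (s - 1 / 2)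
    rw [div_one] at h1
    refine h1.congr' ?_
    filter_upwards [hmem] with z hz
    have hz' : 0 < 1 - z := sub_pos.2 hz.2
    rw [show s - 1 / 2 - 1 = -(3 / 2 - s) by ring, Real.rpow_neg hz'.le, Pi.div_apply]
    have := Real.rpow_pos_of_pos hz' (3 / 2 - s)
    have := hz.1
    field_simp

end SOS

/-! ### Assembly: parametrisation by `z = ρ⁻²` and elimination of `1 - z`. -/

open SOS in
theorem mainTheorem8 (a s : ℝ) (ha : 3 / 4 < a) (hs : 1 / 2 ≤ s) :
    ∃ (b₀c : ℝ) (ρ m : ℝ → ℝ),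
      (∀ b₀ : ℝ, SOS.IsCriticalValue (SOS.hyperB a s b₀) b₀c) ∧
      (∀ b₀ : ℝ, 0 < b₀ → b₀ < b₀c →
        SOS.IsGibbsRoot (SOS.hyperB a s b₀) (ρ b₀) ∧
        SOS.IsReturnDensity (SOS.hyperB a s b₀) (m b₀)) ∧
      (∀ b₀ : ℝ, 0 < b₀ → b₀ < b₀c →
        0 < SOS.densityDenom a s (ρ b₀) ∧ m b₀ = 1 / SOS.densityDenom a s (ρ b₀)) ∧
      ((1 / 2 < s ∧ s < 3 / 2 ↔ -(3 / 8) < (s - s ^ 2) / 2 ∧ (s - s ^ 2) / 2 < 1 / 8) ∧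
        (1 / 2 < s → s < 3 / 2 →
          Tendsto m (𝓝[<] b₀c) (𝓝 0) ∧
          (∃ L : ℝ, L ≠ 0 ∧
            Tendsto (fun b₀ => m b₀ / (b₀c - b₀) ^ ((3 / 2 - s) / (s - 1 / 2)))
              (𝓝[<] b₀c) (𝓝 L)) ∧
          (3 / 2 - s) / (s - 1 / 2) =
            (2 - √(1 - 8 * ((s - s ^ 2) / 2))) / √(1 - 8 * ((s - s ^ 2) / 2)))) ∧
      ((3 / 2 < s ↔ (s - s ^ 2) / 2 < -(3 / 8)) ∧
        (3 / 2 < s →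
          Tendsto m (𝓝[<] b₀c) (𝓝 (1 / (2 + 2 * a / (s - 3 / 2)))) ∧
          0 < 1 / (2 + 2 * a / (s - 3 / 2)))) := by
  have ha' : 1 / 2 < a := by linarith
  obtain ⟨Φ₁, hlim, hlt⟩ := exists_gibbsFun_limit ha' hs
  have hΦ₁ : 0 < Φ₁ := (gibbsFun_pos ha' hs (z := 1 / 2) (by norm_num) (by norm_num)).trans
    (hlt _ ⟨by norm_num, by norm_num⟩)
  set b₁ := hyperB a s 0 1 with hb₁
  have hb₁0 : 0 < b₁ := hyperB_succ_pos ha' hs 0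
  -- The critical value must not depend on `b₀`, so `b₁` is fixed by evaluating the family at the
  -- irrelevant parameter `0`.
  have hb₁eq : ∀ b₀, hyperB a s b₀ 1 = b₁ := fun b₀ => by simp [hb₁, hyperB]
  set b₀c := Φ₁ / (4 * b₁) with hb₀c
  have hb₀c0 : 0 < b₀c := by positivity
  have hex : ∀ b₀ : ℝ, ∃ z : ℝ, 0 < b₀ → b₀ < b₀c →
      z ∈ Set.Ioo (0 : ℝ) 1 ∧ gibbsFun a s z = 4 * b₀ * b₁ := by
    intro b₀
    by_cases h : 0 < b₀ ∧ b₀ < b₀c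
    · have h2 : 4 * b₀ * b₁ < Φ₁ := by
        have := (lt_div_iff₀ (by positivity)).1 h.2
        linarith
      obtain ⟨z, hz, hzc⟩ := exists_gibbsFun_eq ha' hs hlim
        (mul_pos (mul_pos four_pos h.1) hb₁0) h2
      exact ⟨z, fun _ _ => ⟨hz, hzc⟩⟩
    · exact ⟨0, fun h1 h2 => absurd ⟨h1, h2⟩ h⟩
  choose ζ hζ using hex
  set m : ℝ → ℝ := fun b₀ => 1 / densityDenom a s (√(ζ b₀))⁻¹ with hm
  have hmeq : ∀ b₀, 0 < b₀ → b₀ < b₀c → m b₀ = 1 / (2 * gibbsLogDeriv a s (ζ b₀)) := by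
    intro b₀ h0 h1
    simp only [hm]
    rw [densityDenom_eq (hζ b₀ h0 h1).1.1]
  have hmem : ∀ᶠ b₀ : ℝ in 𝓝[<] b₀c, b₀ ∈ Set.Ioo 0 b₀c := Ioo_mem_nhdsLT hb₀c0
  have hmev : (fun b₀ => 1 / (2 * gibbsLogDeriv a s (ζ b₀))) =ᶠ[𝓝[<] b₀c] m := by
    filter_upwards [hmem] with b₀ hb
    exact (hmeq b₀ hb.1 hb.2).symm
  -- Strict monotonicity of `Φ`: once `4 b₀ b₁` exceeds `Φ(y)`, the root lies above `y`.
  have hζlim : Tendsto ζ (𝓝[<] b₀c) (𝓝[<] 1) := by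
    refine tendsto_nhdsWithin_iff.2 ⟨tendsto_order.2 ⟨fun x hx => ?_, fun x hx => ?_⟩, ?_⟩
    · set y := max x (1 / 2) with hy
      have hy0 : y ∈ Set.Ioo (0 : ℝ) 1 :=
        ⟨lt_max_of_lt_right (by norm_num), max_lt hx (by norm_num)⟩
      have hyc : gibbsFun a s y / (4 * b₁) < b₀c :=
        div_lt_div_of_pos_right (hlt y hy0) (by positivity)
      filter_upwards [hmem, Ioo_mem_nhdsLT hyc] with b₀ hb hb'
      obtain ⟨hz, hzc⟩ := hζ b₀ hb.1 hb.2
      have h1 := (div_lt_iff₀ (by positivity)).1 hb'.1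
      have h2 : gibbsFun a s y < gibbsFun a s (ζ b₀) := by linarith
      exact (le_max_left _ _).trans_lt (((gibbsFun_strictMonoOn ha' hs).lt_iff_lt hy0 hz).1 h2)
    · filter_upwards [hmem] with b₀ hb
      exact (hζ b₀ hb.1 hb.2).1.2.trans hx
    · filter_upwards [hmem] with b₀ hb
      exact (hζ b₀ hb.1 hb.2).1.2
  refine ⟨b₀c, fun b₀ => (√(ζ b₀))⁻¹, m, fun b₀ => ?_, fun b₀ h0 h1 => ?_, fun b₀ h0 h1 => ?_,
    ⟨⟨?_, ?_⟩, fun hs1 hs2 => ?_⟩, ⟨⟨?_, ?_⟩, fun hs1 => ?_⟩⟩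
  · have h := isCriticalValue_hyperB ha' hs b₀ hΦ₁ hlim
    rwa [hb₁eq] at h
  · obtain ⟨hz, hzc⟩ := hζ b₀ h0 h1
    rw [← hb₁eq b₀] at hzc
    refine ⟨isGibbsRoot_hyperB ha' hs h0 hz.1 hz.2 hzc, ?_⟩
    rw [hmeq b₀ h0 h1]
    exact (isReturnDensity_hyperB ha' hs h0 hz.1 hz.2 hzc).2
  · obtain ⟨hz, hzc⟩ := hζ b₀ h0 h1
    rw [← hb₁eq b₀] at hzc
    refine ⟨?_, rfl⟩
    rw [densityDenom_eq hz.1]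
    exact mul_pos two_pos (isReturnDensity_hyperB ha' hs h0 hz.1 hz.2 hzc).1
  · rintro ⟨h1, h2⟩
    constructor <;> nlinarith
  · rintro ⟨h1, h2⟩
    have h3 : s ≠ 1 / 2 := by
      rintro rfl
      norm_num at h2
    exact ⟨lt_of_le_of_ne hs h3.symm, by nlinarith⟩
  · obtain ⟨D, hD0, hD⟩ := tendsto_gibbsLogDeriv_of_lt ha' hs1 hs2
    have hδ : 0 < s - 1 / 2 := by linarith
    have hη : 0 < 3 / 2 - s := by linarith
    have hunit : ∀ᶠ z : ℝ in 𝓝[<] 1, z ∈ Set.Ioo (0 : ℝ) 1 := Ioo_mem_nhdsLT one_pos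
    have h1 : Tendsto (fun z => (1 / (2 * gibbsLogDeriv a s z)) / (1 - z) ^ (3 / 2 - s))
        (𝓝[<] 1) (𝓝 (1 / (2 * D))) := by
      refine (tendsto_const_nhds.div (hD.const_mul 2) (by positivity)).congr fun z => ?_
      rw [div_div, Pi.div_apply]
      ring
    have h2 : Tendsto (fun z => 1 / (2 * gibbsLogDeriv a s z)) (𝓝[<] 1) (𝓝 0) := by
      have h := h1.mul (tendsto_one_sub_rpow hη)
      rw [mul_zero] at h
      refine h.congr' ?_
      filter_upwards [hunit] with z hz
      rw [div_mul_cancel₀ _ (Real.rpow_pos_of_pos (sub_pos.2 hz.2) _).ne']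
    refine ⟨(h2.comp hζlim).congr' hmev, ?_, ?_⟩
    · have h3 := (tendsto_gibbsFun_sub_div ha' hs1 hD hlim).div_const (4 * b₁)
      have hc0 : 0 < Φ₁ * D / (s - 1 / 2) / (4 * b₁) := by positivity
      -- This power turns `(1 - z) ^ (s - 1/2)` into `(1 - z) ^ (3/2 - s)`, the order of `m` in
      -- `h1`, so that `1 - z` cancels in the quotient.
      have h4 := h3.rpow_const (p := (3 / 2 - s) / (s - 1 / 2)) (Or.inl hc0.ne')
      have hc1 := Real.rpow_pos_of_pos hc0 ((3 / 2 - s) / (s - 1 / 2))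
      have h5 := (h1.div h4 hc1.ne').comp hζlim
      refine ⟨_, (div_pos (by positivity) hc1).ne', h5.congr' ?_⟩
      filter_upwards [hmem] with b₀ hb
      obtain ⟨hz, hzc⟩ := hζ b₀ hb.1 hb.2
      have hz' : 0 < 1 - ζ b₀ := sub_pos.2 hz.2
      have hzp := Real.rpow_pos_of_pos hz' (3 / 2 - s)
      have hΦz : 0 < Φ₁ - gibbsFun a s (ζ b₀) := sub_pos.2 (hlt _ hz)
      have hbb : b₀c - b₀ = (Φ₁ - gibbsFun a s (ζ b₀)) / (4 * b₁) := by
        rw [hzc, hb₀c]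
        field_simp
      rw [Function.comp_apply, Pi.div_apply, hmeq b₀ hb.1 hb.2, hbb, div_right_comm _ _ (4 * b₁),
        Real.div_rpow (by positivity) (by positivity), ← Real.rpow_mul hz'.le,
        mul_div_cancel₀ _ hδ.ne', div_div_div_cancel_right₀ hzp.ne']
    · have e : √(1 - 8 * ((s - s ^ 2) / 2)) = 2 * s - 1 := by
        rw [show 1 - 8 * ((s - s ^ 2) / 2) = (2 * s - 1) ^ 2 by ring, Real.sqrt_sq (by linarith)]
      rw [e, div_eq_div_iff hδ.ne' (by linarith)]
      ring
  · intro h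
    nlinarith
  · intro h
    nlinarith
  · have hs3 : 0 < s - 3 / 2 := by linarith
    have h1 := (tendsto_const_nhds (x := (1 : ℝ))).div
      ((tendsto_gibbsLogDeriv_of_gt ha' hs1).const_mul 2) (by positivity)
    have e : (2 : ℝ) * (1 + a / (s - 3 / 2)) = 2 + 2 * a / (s - 3 / 2) := by ring
    rw [e] at h1
    exact ⟨(h1.comp hζlim).congr' hmev, by positivity⟩
end
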